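/- **Theorem (correctness of declarative lifting of closed terms).** *The calculus.* Consider the call-by-value, dependently typed calculus $\lambda_{\mathtt{OADT}\Psi}$. Its expressions and types form one syntactic class: $$e,\tau ::= \mathsf{unit}\mid\mathsf{bool}\mid\widehat{\mathsf{bool}}\mid\tau\times\tau\mid\tau\,\hat{+}\,\tau\mid\Pi x{:}\tau,\tau\mid\Psi\hat T\mid T\mid\hat T\,e\mid x\mid()\mid b\mid\lambda x{:}\tau.e\mid\mathsf{let}\ x=e\ \mathsf{in}\ e\mid e\,e\mid C\,e\mid\mathsf{if}\ e\ \mathsf{then}\ e\ \mathsf{else}\ e\mid\mathsf{mux}\ e\,e\,e\mid(e,e)\mid\langle e,e\rangle\mid\pi_b e\mid\widehat{\mathsf{inj}}_b\langle\tau\rangle e\mid\widehat{\mathsf{match}}\ e\ \mathsf{with}\ x{\Rightarrow}e\mid x{\Rightarrow}e\mid\mathsf{match}\ e\ \mathsf{with}\ \overline{C\,x{\Rightarrow}e}\mid\mathsf s_{\mathsf{bool}}\,e\mid[b]\mid[\mathsf{inj}_b\langle\hat\omega\rangle\,\hat v].$$ Here $\hat\omega::=\mathsf{unit}\mid\widehat{\mathsf{bool}}\mid\hat\omega\times\hat\omega\mid\hat\omega\hat+\hat\omega$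 are the oblivious type values, $\hat v::=()\mid[b]\mid(\hat v,\hat v)\mid[\mathsf{inj}_b\langle\hat\omega\rangle\hat v]$ the oblivious values, and $v::=\hat v\mid b\mid(v,v)\mid\langle v,v\rangle\mid\lambda x{:}\tau.e\mid C\,v$ the values. A global context $\Sigma$ maps names to definitions $\mathsf{data}\ T=\overline{C\,\tau}$ (algebraic data types), $\mathsf{fn}\ f{:}\tau=e$ (recursive functions) and $\mathsf{obliv}\ \hat T(x{:}\tau)=\tau'$ (OADTs; $\tau$ is the public view type). Write $e\to e'$ for small-step reduction under $\Sigma$ (arguments of an application are evaluated before the function; all three parts of a $\mathsf{mux}$ are evaluated; $\widehat{\mathsf{match}}$ on a boxed injection steps to a $\mathsf{mux}$ on its tag in which the pattern variable of the wrong branch is any oblivious value of the right type), $\to^i$ for exactly $i$ steps and $\to^*$ for any number of steps. Kinding $\Gamma\vdash\tau::\kappa$, with $\kappa$ any, public, oblivious or mixed, and typing $\Gamma\vdash e:\tau$ are the standard rules of this dependent calculus, with conversion along the equivalence generated by parallel reduction. Constructor arguments and public view types are public, bodies of OADTs are oblivious, and the result types of $\mathsf{mux}$ and $\widehat{\mathsf{match}}$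 must be oblivious. In the *leaky* variant of the rules this last condition is dropped; each function is declared secure or leaky, and secure code uses no leaky function. "Typed" means typed by the secure rules unless said otherwise. *Specification types* are $\theta::=\mathsf{unit}\mid\mathsf{bool}\mid\widehat{\mathsf{bool}}\mid T\mid\Psi\hat T\mid\theta\times\theta\mid\theta\to\theta$, required to be well-kinded in the empty local context. The erasure $\lfloor\theta\rfloor$ replaces $\widehat{\mathsf{bool}}$ by $\mathsf{bool}$ and $\Psi\hat T$ by the public type of $\hat T$. *Logical relation.* For $n\in\mathbb N$, all pairs in $\mathcal V_n[\theta]$ and $\mathcal E_n[\theta]$ consist of a closed term of type $\lfloor\theta\rfloor$ and a closed term of type $\theta$; the pairs in $\mathcal V_n[\theta]$ are pairs of values; and $$\begin{aligned} \mathcal V_n[\mathsf{unit}],\ \mathcal V_n[\mathsf{bool}],\ \mathcal V_n[T]&=\{(v,v')\mid 0<n\Rightarrow v=v'\},\\ \mathcal V_n[\widehat{\mathsf{bool}}]&=\{(b,[b'])\mid 0<n\Rightarrow b=b'\},\\ \mathcal V_n[\Psi\hat T]&=\{(v,\langle k,\hat v\rangle)\mid 0<n\Rightarrow r\,k\,\hat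 v\to^*v\}\quad(r\text{ the retraction of }\hat T),\\ \mathcal V_n[\theta_1\times\theta_2]&=\{((v_1,v_2),(v_1',v_2'))\mid(v_j,v_j')\in\mathcal V_n[\theta_j],\ j=1,2\},\\ \mathcal V_n[\theta_1\to\theta_2]&=\{(\lambda x{:}\lfloor\theta_1\rfloor.e,\ \lambda x{:}\theta_1.e')\mid\forall i<n,\ \forall(v,v')\in\mathcal V_i[\theta_1],\ ([v/x]e,[v'/x]e')\in\mathcal E_i[\theta_2]\},\\ \mathcal E_n[\theta]&=\{(e,e')\mid\forall i<n,\ \forall\text{ values }v',\ e'\to^iv'\Rightarrow\exists\text{ a value }v,\ e\to^*v\wedge(v,v')\in\mathcal V_{n-i}[\theta]\}. \end{aligned}$$ *Structures.* A structure context $\mathcal S$ consists of the following; all values mentioned are closed and typed, and all functions are global functions of $\Sigma$. - Every OADT $\hat T$ of $\Sigma$, with public view type $\tau$, has one OADT-structure: a public data type $T$, a section $s:\Pi k{:}\tau,T\to\hat T\,k$, a (leaky) retraction $r:\Pi k{:}\tau,\hat T\,k\to T$, a view function $\nu:T\to\tau$ and a relation $v\preccurlyeq k$ between values of $T$ and $\tau$,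 such that (i) $v\preccurlyeq k$ and $s\,k\,v\to^*\hat v$ imply $r\,k\,\hat v\to^*v$; (ii) $r\,k\,\hat v\to^*v$ implies $v\preccurlyeq k$; (iii) $\nu\,v\to^*k$ implies $v\preccurlyeq k$. - Join-structures of some OADTs: a partial order $\sqsubseteq$ on the values of $\tau$, a join $\sqcup:\tau\to\tau\to\tau$ and a function $\mathsf{reshape}:\Pi k{:}\tau,\Pi k'{:}\tau,\hat T\,k\to\hat T\,k'$, such that $k_1\sqcup k_2\to^*k$ implies $k_1,k_2\sqsubseteq k$; $v\preccurlyeq k\sqsubseteq k'$ implies $v\preccurlyeq k'$; and $r\,k\,\hat v\to^*v$, $v\preccurlyeq k'$ and $\mathsf{reshape}\,k\,k'\,\hat v\to^*\hat v'$ imply $r\,k'\,\hat v'\to^*v$. - Intro-structures of some OADTs $\hat T$ for $\mathsf{data}\ T=\overline{C\,\eta}$: for each constructor $C_i$ a function $\hat C_i:\theta_i\to\Psi\hat T$ with $\lfloor\theta_i\rfloor=\eta_i$, such that $(v,v')\in\mathcal V_n[\theta_i]$ implies $(C_i\,v,\hat C_i\,v')\in\mathcal E_n[\Psi\hat T]$,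 for all $n$. - Elim-structures of some OADTs $\hat T$ for $\mathsf{data}\ T=\overline{C\,\eta}$: functions $\widehat{\mathsf{match}}_\alpha:\Psi\hat T\to\overline{(\theta\to\alpha)}\to\alpha$, for some specification types $\alpha$, with $\lfloor\theta_i\rfloor=\eta_i$, such that for all $n$, if $r\,k\,\hat v\to^*C_i\,v_i$ and $(\lambda x{:}\eta_j.e_j,\lambda x{:}\theta_j.e_j')\in\mathcal V_n[\theta_j\to\alpha]$ for every $j$, then $([v_i/x]e_i,\ \widehat{\mathsf{match}}_\alpha\,\langle k,\hat v\rangle\,\overline{(\lambda x{:}\theta.e')})\in\mathcal E_n[\alpha]$. - Coercion-structures between some OADTs $\hat T,\hat T'$ with the same public type: functions $c:\Psi\hat T\to\Psi\hat T'$ such that $r\,k\,\hat v\to^*v$ and $c\,\langle k,\hat v\rangle\to^*\langle k',\hat v'\rangle$ imply $r'\,k'\,\hat v'\to^*v$. *Lifting.* $\theta$ is *mergeable* with witness $\mathit{ite}_\theta:\widehat{\mathsf{bool}}\to\theta\to\theta\to\theta$: for $\mathsf{unit}$ and $\widehat{\mathsf{bool}}$, $\lambda b\,x\,y.\,\mathsf{mux}\,b\,x\,y$;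 for products and function types, componentwise and pointwise (only the codomain need be mergeable); for $\Psi\hat T$ with a join-structure, $\lambda b\,x\,y.\,\mathsf{let}\ k=\pi_1x\sqcup\pi_1y\ \mathsf{in}\ \langle k,\mathsf{mux}\,b\,(\mathsf{reshape}\,(\pi_1x)\,k\,(\pi_2x))\,(\mathsf{reshape}\,(\pi_1y)\,k\,(\pi_2y))\rangle$. *Coercions* ${\uparrow}:\theta\rightsquigarrow\theta'$ are generated by identities $\lambda x.x$; $\lambda x.\mathsf s_{\mathsf{bool}}x:\mathsf{bool}\rightsquigarrow\widehat{\mathsf{bool}}$; $\lambda x.\langle\nu\,x,s\,(\nu\,x)\,x\rangle:T\rightsquigarrow\Psi\hat T$ for $\hat T$ with public type $T$; coercion-structures; products $\lambda x.({\uparrow}_1(\pi_1x),{\uparrow}_2(\pi_2x))$; and function types, contravariantly, $\lambda x.\lambda y.{\uparrow}_2(x\,({\uparrow}_1y))$. A lifting context $\mathcal L$ is a set of entries $x:\theta\triangleright\hat x$ relating global functions. The lifting judgment $\mathcal S;\mathcal L;\Sigma;\Gamma\vdash e:\theta\triangleright\hat e$, where $\Gamma$ gives target types of the local variables, is generated by: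 the congruence rules for $()$, $b$, local variables, abstraction ($\lambda x{:}\lfloor\theta_1\rfloor.e$ lifts to $\lambda x{:}\theta_1.\hat e$), application, let, pairs, projections, conditionals with condition lifted at $\mathsf{bool}$, constructors $C_i$ at $T$ and matches with discriminee lifted at $T$; and by - $x:\theta\triangleright\hat x$ for entries of $\mathcal L$; - $\mathsf{if}\ e_0\ \mathsf{then}\ e_1\ \mathsf{else}\ e_2:\theta\triangleright\mathit{ite}_\theta\,\hat e_0\,\hat e_1\,\hat e_2$ if $e_0:\widehat{\mathsf{bool}}\triangleright\hat e_0$, $e_j:\theta\triangleright\hat e_j$ and $\theta$ is mergeable; - $C_i\,e:\Psi\hat T\triangleright\hat C_i\,\hat e$ if $e:\theta_i\triangleright\hat e$, for an intro-structure of $\hat T$; - $\mathsf{match}\ e_0\ \mathsf{with}\ \overline{C\,x\Rightarrow e}:\alpha\triangleright\widehat{\mathsf{match}}_\alpha\,\hat e_0\,\overline{(\lambda x{:}\theta.\hat e)}$ if $e_0:\Psi\hat T\triangleright\hat e_0$ and $\Gamma,x{:}\theta_i\vdash e_i:\alpha\triangleright\hat e_i$ for all $i$, for a member of an elim-structure of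 $\hat T$; - $e:\theta'\triangleright{\uparrow}\,\hat e$ if $e:\theta\triangleright\hat e$ and ${\uparrow}:\theta\rightsquigarrow\theta'$. $\mathcal L$ is *$n$-valid* if $(x,\hat x)\in\mathcal E_n[\theta]$ for every entry $x:\theta\triangleright\hat x$ of $\mathcal L$. *Statement.* Let $\Sigma$ be a well-typed global context, $\mathcal S$ a structure context over $\Sigma$ as above, $\mathcal L$ a lifting context and $n\in\mathbb N$. If $\mathcal S;\mathcal L;\Sigma;\cdot\vdash e:\theta\triangleright\hat e$ and $\mathcal L$ is $n$-valid, then $(e,\hat e)\in\mathcal E_n[\theta]$. That is, $e$ and $\hat e$ are closed and typed at $\lfloor\theta\rfloor$ and $\theta$, and whenever $\hat e\to^i\hat v$ with $i<n$ and $\hat v$ a value, there is a value $v$ with $e\to^*v$ and $(v,\hat v)\in\mathcal V_{n-i}[\theta]$. -/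

import Mathlib

namespace Taypsi

/-! ## Terms -/

/-- Global names (of functions, algebraic data types and oblivious types). -/
abbrev Name := ℕ

/-- Oblivious type values: `ω ::= unit | obool | ω * ω | ω + ω` (oblivious sum). -/
inductive OTy where
  | unit
  | obool
  | prod (ω₁ ω₂ : OTy)
  | sum (ω₁ ω₂ : OTy)

/-- Oblivious values: `() | [b] | (v, v) | [inj_b<ω> v]`. -/
inductive OVal where
  | unit
  | lit (b : Bool)
  | pair (v₁ v₂ : OVal)
  | inj (b : Bool) (ω : OTy) (v : OVal)

/-- Expressions and types, which form one category. Local variables are de Bruijn indices.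
Constructors are named by their data type and their position in its definition.
Throughout, the boolean `true` stands for left / first, `false` for right / second. -/
inductive Expr where
  | unitTy
  | boolTy
  | oboolTy
  | prodTy (τ₁ τ₂ : Expr)
  | osumTy (τ₁ τ₂ : Expr)
  /-- dependent function type; binds one variable in the codomain -/
  | pi (τ₁ τ₂ : Expr)
  /-- the type of pairs of a public view and a value of an oblivious type at that view -/
  | psi (O : Name)
  | adt (T : Name)
  | var (x : ℕ)
  /-- global function name -/
  | gvar (f : Name)
  | unit
  | lit (b : Bool)
  /-- annotated abstraction; binds one variable in the body -/
  | lam (τ e : Expr)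
  /-- `let x = e₁ in e₂`; binds one variable in `e₂` -/
  | letIn (e₁ e₂ : Expr)
  | app (e₁ e₂ : Expr)
  /-- the `i`-th constructor of the data type `T`, applied to its argument -/
  | ctor (T : Name) (i : ℕ) (e : Expr)
  /-- application of an oblivious type name to a public view -/
  | oapp (O : Name) (e : Expr)
  | ite (e₀ e₁ e₂ : Expr)
  /-- oblivious conditional -/
  | mux (e₀ e₁ e₂ : Expr)
  | pair (e₁ e₂ : Expr)
  | psiPair (e₁ e₂ : Expr)
  | proj (b : Bool) (e : Expr)
  /-- oblivious injection `inj_b<τ> e` -/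
  | oinj (b : Bool) (τ e : Expr)
  /-- oblivious sum elimination; each branch binds one variable -/
  | omatch (e₀ e₁ e₂ : Expr)
  /-- elimination of the data type `T`; each of the `k` branches binds one variable -/
  | mtch (T : Name) (k : ℕ) (e₀ : Expr) (br : Fin k → Expr)
  /-- boolean section -/
  | sec (e : Expr)
  | boxLit (b : Bool)
  | boxInj (b : Bool) (ω : OTy) (v : OVal)

def OTy.toExpr : OTy → Expr
  | .unit => .unitTy
  | .obool => .oboolTy
  | .prod ω₁ ω₂ => .prodTy ω₁.toExpr ω₂.toExpr
  | .sum ω₁ ω₂ => .osumTy ω₁.toExpr ω₂.toExpr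

def OVal.toExpr : OVal → Expr
  | .unit => .unit
  | .lit b => .boxLit b
  | .pair v₁ v₂ => .pair v₁.toExpr v₂.toExpr
  | .inj b ω v => .boxInj b ω v

/-- Lift a renaming under one binder. -/
def upRen (ξ : ℕ → ℕ) : ℕ → ℕ
  | 0 => 0
  | x + 1 => ξ x + 1

def Expr.rename : Expr → (ℕ → ℕ) → Expr
  | .unitTy, _ => .unitTy
  | .boolTy, _ => .boolTy
  | .oboolTy, _ => .oboolTy
  | .prodTy τ₁ τ₂, ξ => .prodTy (τ₁.rename ξ) (τ₂.rename ξ)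
  | .osumTy τ₁ τ₂, ξ => .osumTy (τ₁.rename ξ) (τ₂.rename ξ)
  | .pi τ₁ τ₂, ξ => .pi (τ₁.rename ξ) (τ₂.rename (upRen ξ))
  | .psi O, _ => .psi O
  | .adt T, _ => .adt T
  | .var x, ξ => .var (ξ x)
  | .gvar f, _ => .gvar f
  | .unit, _ => .unit
  | .lit b, _ => .lit b
  | .lam τ e, ξ => .lam (τ.rename ξ) (e.rename (upRen ξ))
  | .letIn e₁ e₂, ξ => .letIn (e₁.rename ξ) (e₂.rename (upRen ξ))
  | .app e₁ e₂, ξ => .app (e₁.rename ξ) (e₂.rename ξ)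
  | .ctor T i e, ξ => .ctor T i (e.rename ξ)
  | .oapp O e, ξ => .oapp O (e.rename ξ)
  | .ite e₀ e₁ e₂, ξ => .ite (e₀.rename ξ) (e₁.rename ξ) (e₂.rename ξ)
  | .mux e₀ e₁ e₂, ξ => .mux (e₀.rename ξ) (e₁.rename ξ) (e₂.rename ξ)
  | .pair e₁ e₂, ξ => .pair (e₁.rename ξ) (e₂.rename ξ)
  | .psiPair e₁ e₂, ξ => .psiPair (e₁.rename ξ) (e₂.rename ξ)
  | .proj b e, ξ => .proj b (e.rename ξ)
  | .oinj b τ e, ξ => .oinj b (τ.rename ξ) (e.rename ξ)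
  | .omatch e₀ e₁ e₂, ξ => .omatch (e₀.rename ξ) (e₁.rename (upRen ξ)) (e₂.rename (upRen ξ))
  | .mtch T k e₀ br, ξ => .mtch T k (e₀.rename ξ) (fun i => (br i).rename (upRen ξ))
  | .sec e, ξ => .sec (e.rename ξ)
  | .boxLit b, _ => .boxLit b
  | .boxInj b ω v, _ => .boxInj b ω v

/-- Weakening by one variable. -/
def Expr.shift (e : Expr) : Expr := e.rename Nat.succ

/-- Lift a substitution under one binder. -/
def upSub (σ : ℕ → Expr) : ℕ → Expr
  | 0 => .var 0
  | x + 1 => (σ x).shift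

/-- Capture-avoiding parallel substitution. -/
def Expr.subst : Expr → (ℕ → Expr) → Expr
  | .unitTy, _ => .unitTy
  | .boolTy, _ => .boolTy
  | .oboolTy, _ => .oboolTy
  | .prodTy τ₁ τ₂, σ => .prodTy (τ₁.subst σ) (τ₂.subst σ)
  | .osumTy τ₁ τ₂, σ => .osumTy (τ₁.subst σ) (τ₂.subst σ)
  | .pi τ₁ τ₂, σ => .pi (τ₁.subst σ) (τ₂.subst (upSub σ))
  | .psi O, _ => .psi O
  | .adt T, _ => .adt T
  | .var x, σ => σ x
  | .gvar f, _ => .gvar f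
  | .unit, _ => .unit
  | .lit b, _ => .lit b
  | .lam τ e, σ => .lam (τ.subst σ) (e.subst (upSub σ))
  | .letIn e₁ e₂, σ => .letIn (e₁.subst σ) (e₂.subst (upSub σ))
  | .app e₁ e₂, σ => .app (e₁.subst σ) (e₂.subst σ)
  | .ctor T i e, σ => .ctor T i (e.subst σ)
  | .oapp O e, σ => .oapp O (e.subst σ)
  | .ite e₀ e₁ e₂, σ => .ite (e₀.subst σ) (e₁.subst σ) (e₂.subst σ)
  | .mux e₀ e₁ e₂, σ => .mux (e₀.subst σ) (e₁.subst σ) (e₂.subst σ)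
  | .pair e₁ e₂, σ => .pair (e₁.subst σ) (e₂.subst σ)
  | .psiPair e₁ e₂, σ => .psiPair (e₁.subst σ) (e₂.subst σ)
  | .proj b e, σ => .proj b (e.subst σ)
  | .oinj b τ e, σ => .oinj b (τ.subst σ) (e.subst σ)
  | .omatch e₀ e₁ e₂, σ => .omatch (e₀.subst σ) (e₁.subst (upSub σ)) (e₂.subst (upSub σ))
  | .mtch T k e₀ br, σ => .mtch T k (e₀.subst σ) (fun i => (br i).subst (upSub σ))
  | .sec e, σ => .sec (e.subst σ)
  | .boxLit b, _ => .boxLit b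
  | .boxInj b ω v, _ => .boxInj b ω v

/-- `e.inst a` is `[a/x]e`, where `x` is the variable `0` of `e`. -/
def Expr.inst (e a : Expr) : Expr :=
  e.subst fun
    | 0 => a
    | x + 1 => .var x

/-- `τ.instCtor T i` is `[C x / y]τ` for `C` the `i`-th constructor of `T`: the variable `0` of
the result is `x`. -/
def Expr.instCtor (τ : Expr) (T : Name) (i : ℕ) : Expr :=
  τ.subst fun
    | 0 => .ctor T i (.var 0)
    | x + 1 => .var (x + 1)

/-- `apps e [a₁, …, aₘ]` is `e a₁ … aₘ`. -/
def apps (e : Expr) (as : List Expr) : Expr := as.foldl .app e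

/-- Values. -/
inductive IsVal : Expr → Prop
  | unit : IsVal .unit
  | lit (b) : IsVal (.lit b)
  | boxLit (b) : IsVal (.boxLit b)
  | boxInj (b ω v) : IsVal (.boxInj b ω v)
  | pair {v₁ v₂} : IsVal v₁ → IsVal v₂ → IsVal (.pair v₁ v₂)
  | psiPair {v₁ v₂} : IsVal v₁ → IsVal v₂ → IsVal (.psiPair v₁ v₂)
  | lam (τ e) : IsVal (.lam τ e)
  | ctor {T i v} : IsVal v → IsVal (.ctor T i v)

/-- Oblivious value synthesis: `v` is an oblivious value of the oblivious type value `ω`. -/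
inductive OValTy : OVal → OTy → Prop
  | unit : OValTy .unit .unit
  | lit (b) : OValTy (.lit b) .obool
  | pair {v₁ v₂ ω₁ ω₂} : OValTy v₁ ω₁ → OValTy v₂ ω₂ → OValTy (.pair v₁ v₂) (.prod ω₁ ω₂)
  | inj {b v ω₁ ω₂} : OValTy v (if b then ω₁ else ω₂) →
      OValTy (.inj b (.sum ω₁ ω₂) v) (.sum ω₁ ω₂)

/-! ## Global definitions -/

/-- Checking mode. Secure code is subject to the security side conditions on the result types of
oblivious eliminations; leaky code (such as retraction functions) is not, and may not be used by
secure code. -/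
inductive Mode where
  | secure
  | leaky

/-- Code of mode `m₁` may be used in code of mode `m₂`. -/
def Mode.Le (m₁ m₂ : Mode) : Prop := m₁ = m₂ ∨ m₂ = .leaky

inductive GDef where
  /-- `data T = C τ | …`, with `k` constructors -/
  | data (k : ℕ) (τ : Fin k → Expr)
  /-- `fn f : τ = e`, checked in mode `m` -/
  | fn (m : Mode) (τ e : Expr)
  /-- `obliv O (x : τ) = body`; `body` has the single variable `0` -/
  | obliv (τ body : Expr)

/-- Global contexts: maps from names to global definitions. -/
abbrev GCtx := Name → Option GDef

/-! ## Small-step semantics -/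

/-- Small-step semantics. The rules `ctx_…` are reduction under the evaluation contexts. -/
inductive Step (G : GCtx) : Expr → Expr → Prop
  | fn {f m τ e} : G f = some (.fn m τ e) → Step G (.gvar f) e
  | oadt {O τ body v} : G O = some (.obliv τ body) → IsVal v →
      Step G (.oapp O v) (body.inst v)
  | app {τ e v} : IsVal v → Step G (.app (.lam τ e) v) (e.inst v)
  | letIn {v e} : IsVal v → Step G (.letIn v e) (e.inst v)
  | ite {b e₁ e₂} : Step G (.ite (.lit b) e₁ e₂) (if b then e₁ else e₂)
  | mux {b v₁ v₂} : IsVal v₁ → IsVal v₂ →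
      Step G (.mux (.boxLit b) v₁ v₂) (if b then v₁ else v₂)
  | mtch {T k v br} (i : Fin k) : IsVal v →
      Step G (.mtch T k (.ctor T i v) br) ((br i).inst v)
  | proj {b v₁ v₂} : IsVal v₁ → IsVal v₂ →
      Step G (.proj b (.pair v₁ v₂)) (if b then v₁ else v₂)
  | psiProj {b v₁ v₂} : IsVal v₁ → IsVal v₂ →
      Step G (.proj b (.psiPair v₁ v₂)) (if b then v₁ else v₂)
  | sec {b} : Step G (.sec (.lit b)) (.boxLit b)
  | oinj {b} {ω : OTy} {v : OVal} : Step G (.oinj b ω.toExpr v.toExpr) (.boxInj b ω v)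
  | omatch {b ω₁ ω₂ v v₁ v₂ e₁ e₂} : OValTy v₁ ω₁ → OValTy v₂ ω₂ →
      Step G (.omatch (.boxInj b (.sum ω₁ ω₂) v) e₁ e₂)
        (.mux (.boxLit b)
          (if b then e₁.inst v.toExpr else e₁.inst v₁.toExpr)
          (if b then e₂.inst v₂.toExpr else e₂.inst v.toExpr))
  | ctx_prodTy₁ {τ₁ τ₁' τ₂} : Step G τ₁ τ₁' → Step G (.prodTy τ₁ τ₂) (.prodTy τ₁' τ₂)
  | ctx_prodTy₂ {ω : OTy} {τ₂ τ₂'} : Step G τ₂ τ₂' →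
      Step G (.prodTy ω.toExpr τ₂) (.prodTy ω.toExpr τ₂')
  | ctx_osumTy₁ {τ₁ τ₁' τ₂} : Step G τ₁ τ₁' → Step G (.osumTy τ₁ τ₂) (.osumTy τ₁' τ₂)
  | ctx_osumTy₂ {ω : OTy} {τ₂ τ₂'} : Step G τ₂ τ₂' →
      Step G (.osumTy ω.toExpr τ₂) (.osumTy ω.toExpr τ₂')
  | ctx_letIn {e₁ e₁' e₂} : Step G e₁ e₁' → Step G (.letIn e₁ e₂) (.letIn e₁' e₂)
  | ctx_app₂ {e₁ e₂ e₂'} : Step G e₂ e₂' → Step G (.app e₁ e₂) (.app e₁ e₂')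
  | ctx_app₁ {e₁ e₁' v} : IsVal v → Step G e₁ e₁' → Step G (.app e₁ v) (.app e₁' v)
  | ctx_ctor {T i e e'} : Step G e e' → Step G (.ctor T i e) (.ctor T i e')
  | ctx_oapp {O e e'} : Step G e e' → Step G (.oapp O e) (.oapp O e')
  | ctx_ite {e₀ e₀' e₁ e₂} : Step G e₀ e₀' → Step G (.ite e₀ e₁ e₂) (.ite e₀' e₁ e₂)
  | ctx_mux₀ {e₀ e₀' e₁ e₂} : Step G e₀ e₀' → Step G (.mux e₀ e₁ e₂) (.mux e₀' e₁ e₂)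
  | ctx_mux₁ {v₀ e₁ e₁' e₂} : IsVal v₀ → Step G e₁ e₁' →
      Step G (.mux v₀ e₁ e₂) (.mux v₀ e₁' e₂)
  | ctx_mux₂ {v₀ v₁ e₂ e₂'} : IsVal v₀ → IsVal v₁ → Step G e₂ e₂' →
      Step G (.mux v₀ v₁ e₂) (.mux v₀ v₁ e₂')
  | ctx_pair₁ {e₁ e₁' e₂} : Step G e₁ e₁' → Step G (.pair e₁ e₂) (.pair e₁' e₂)
  | ctx_pair₂ {v₁ e₂ e₂'} : IsVal v₁ → Step G e₂ e₂' → Step G (.pair v₁ e₂) (.pair v₁ e₂')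
  | ctx_psiPair₁ {e₁ e₁' e₂} : Step G e₁ e₁' → Step G (.psiPair e₁ e₂) (.psiPair e₁' e₂)
  | ctx_psiPair₂ {v₁ e₂ e₂'} : IsVal v₁ → Step G e₂ e₂' →
      Step G (.psiPair v₁ e₂) (.psiPair v₁ e₂')
  | ctx_proj {b e e'} : Step G e e' → Step G (.proj b e) (.proj b e')
  | ctx_oinj₁ {b τ τ' e} : Step G τ τ' → Step G (.oinj b τ e) (.oinj b τ' e)
  | ctx_oinj₂ {b} {ω : OTy} {e e'} : Step G e e' →
      Step G (.oinj b ω.toExpr e) (.oinj b ω.toExpr e')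
  | ctx_omatch {e₀ e₀' e₁ e₂} : Step G e₀ e₀' → Step G (.omatch e₀ e₁ e₂) (.omatch e₀' e₁ e₂)
  | ctx_mtch {T k e₀ e₀' br} : Step G e₀ e₀' → Step G (.mtch T k e₀ br) (.mtch T k e₀' br)
  | ctx_sec {e e'} : Step G e e' → Step G (.sec e) (.sec e')

/-- Reduction in exactly `n` steps. -/
inductive StepN (G : GCtx) : ℕ → Expr → Expr → Prop
  | zero (e) : StepN G 0 e e
  | succ {n e₁ e₂ e₃} : Step G e₁ e₂ → StepN G n e₂ e₃ → StepN G (n + 1) e₁ e₃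

/-- Reduction in any number of steps. -/
def Steps (G : GCtx) : Expr → Expr → Prop := Relation.ReflTransGen (Step G)

/-! ## Type equivalence -/

/-- Parallel reduction. -/
inductive Pared (G : GCtx) : Expr → Expr → Prop
  | refl (e) : Pared G e e
  | fn {f m τ e} : G f = some (.fn m τ e) → Pared G (.gvar f) e
  | oadt {O τ body e e'} : G O = some (.obliv τ body) → Pared G e e' →
      Pared G (.oapp O e) (body.inst e')
  | beta {τ e₁ e₁' e₂ e₂'} : Pared G e₁ e₁' → Pared G e₂ e₂' →
      Pared G (.app (.lam τ e₁) e₂) (e₁'.inst e₂')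
  | letBeta {e₁ e₁' e₂ e₂'} : Pared G e₁ e₁' → Pared G e₂ e₂' →
      Pared G (.letIn e₁ e₂) (e₂'.inst e₁')
  | iteBeta {b e₁ e₁' e₂ e₂'} : Pared G e₁ e₁' → Pared G e₂ e₂' →
      Pared G (.ite (.lit b) e₁ e₂) (if b then e₁' else e₂')
  | muxBeta {b e₁ e₁' e₂ e₂'} : Pared G e₁ e₁' → Pared G e₂ e₂' →
      Pared G (.mux (.boxLit b) e₁ e₂) (if b then e₁' else e₂')
  | mtchBeta {T k e e'} {br : Fin k → Expr} {d} (i : Fin k) : Pared G e e' → Pared G (br i) d →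
      Pared G (.mtch T k (.ctor T i e) br) (d.inst e')
  | projBeta {b e₁ e₁' e₂ e₂'} : Pared G e₁ e₁' → Pared G e₂ e₂' →
      Pared G (.proj b (.pair e₁ e₂)) (if b then e₁' else e₂')
  | psiProjBeta {b e₁ e₁' e₂ e₂'} : Pared G e₁ e₁' → Pared G e₂ e₂' →
      Pared G (.proj b (.psiPair e₁ e₂)) (if b then e₁' else e₂')
  | secBeta {b} : Pared G (.sec (.lit b)) (.boxLit b)
  | oinjBeta {b} {ω : OTy} {v : OVal} : Pared G (.oinj b ω.toExpr v.toExpr) (.boxInj b ω v)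
  | omatchBeta {b ω₁ ω₂ v v₁ v₂ e₁ e₁' e₂ e₂'} : OValTy v₁ ω₁ → OValTy v₂ ω₂ →
      Pared G e₁ e₁' → Pared G e₂ e₂' →
      Pared G (.omatch (.boxInj b (.sum ω₁ ω₂) v) e₁ e₂)
        (.mux (.boxLit b)
          (if b then e₁'.inst v.toExpr else e₁'.inst v₁.toExpr)
          (if b then e₂'.inst v₂.toExpr else e₂'.inst v.toExpr))
  | prodTy {τ₁ τ₁' τ₂ τ₂'} : Pared G τ₁ τ₁' → Pared G τ₂ τ₂' →
      Pared G (.prodTy τ₁ τ₂) (.prodTy τ₁' τ₂')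
  | osumTy {τ₁ τ₁' τ₂ τ₂'} : Pared G τ₁ τ₁' → Pared G τ₂ τ₂' →
      Pared G (.osumTy τ₁ τ₂) (.osumTy τ₁' τ₂')
  | pi {τ₁ τ₁' τ₂ τ₂'} : Pared G τ₁ τ₁' → Pared G τ₂ τ₂' → Pared G (.pi τ₁ τ₂) (.pi τ₁' τ₂')
  | lam {τ τ' e e'} : Pared G τ τ' → Pared G e e' → Pared G (.lam τ e) (.lam τ' e')
  | letIn {e₁ e₁' e₂ e₂'} : Pared G e₁ e₁' → Pared G e₂ e₂' →
      Pared G (.letIn e₁ e₂) (.letIn e₁' e₂')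
  | app {e₁ e₁' e₂ e₂'} : Pared G e₁ e₁' → Pared G e₂ e₂' → Pared G (.app e₁ e₂) (.app e₁' e₂')
  | ctor {T i e e'} : Pared G e e' → Pared G (.ctor T i e) (.ctor T i e')
  | oapp {O e e'} : Pared G e e' → Pared G (.oapp O e) (.oapp O e')
  | ite {e₀ e₀' e₁ e₁' e₂ e₂'} : Pared G e₀ e₀' → Pared G e₁ e₁' → Pared G e₂ e₂' →
      Pared G (.ite e₀ e₁ e₂) (.ite e₀' e₁' e₂')
  | mux {e₀ e₀' e₁ e₁' e₂ e₂'} : Pared G e₀ e₀' → Pared G e₁ e₁' → Pared G e₂ e₂' →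
      Pared G (.mux e₀ e₁ e₂) (.mux e₀' e₁' e₂')
  | pair {e₁ e₁' e₂ e₂'} : Pared G e₁ e₁' → Pared G e₂ e₂' →
      Pared G (.pair e₁ e₂) (.pair e₁' e₂')
  | psiPair {e₁ e₁' e₂ e₂'} : Pared G e₁ e₁' → Pared G e₂ e₂' →
      Pared G (.psiPair e₁ e₂) (.psiPair e₁' e₂')
  | proj {b e e'} : Pared G e e' → Pared G (.proj b e) (.proj b e')
  | oinj {b τ τ' e e'} : Pared G τ τ' → Pared G e e' → Pared G (.oinj b τ e) (.oinj b τ' e')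
  | omatch {e₀ e₀' e₁ e₁' e₂ e₂'} : Pared G e₀ e₀' → Pared G e₁ e₁' → Pared G e₂ e₂' →
      Pared G (.omatch e₀ e₁ e₂) (.omatch e₀' e₁' e₂')
  | mtch {T k e₀ e₀'} {br br' : Fin k → Expr} : Pared G e₀ e₀' →
      (∀ i, Pared G (br i) (br' i)) → Pared G (.mtch T k e₀ br) (.mtch T k e₀' br')
  | sec {e e'} : Pared G e e' → Pared G (.sec e) (.sec e')

/-- Type equivalence: the equivalence relation generated by parallel reduction. -/
def TyEquiv (G : GCtx) : Expr → Expr → Prop := Relation.EqvGen (Pared G)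

/-! ## Kinding and typing -/

/-- Kinds: any, public, oblivious, mixed. -/
inductive Kind where
  | any
  | pub
  | obl
  | mixed

/-- The order on kinds: `any` is least, `mixed` is greatest, `pub` and `obl` are incomparable. -/
def Kind.Le (κ₁ κ₂ : Kind) : Prop := κ₁ = κ₂ ∨ κ₁ = .any ∨ κ₂ = .mixed

/-- The kind demanded of the result type of `mux` and of the oblivious match: oblivious in secure
mode, only well-kinded in leaky mode. -/
def Mode.branchKind : Mode → Kind
  | .secure => .obl
  | .leaky => .mixed

mutual

/-- `Kinding G m Γ τ κ`: the type `τ` has kind `κ` in the local context `Γ`. The head of `Γ` is the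
type of the variable `0`, and each type in `Γ` lives in the rest of `Γ`. -/
inductive Kinding (G : GCtx) : Mode → List Expr → Expr → Kind → Prop
  | sub {m Γ τ κ κ'} : Kinding G m Γ τ κ → κ.Le κ' → Kinding G m Γ τ κ'
  | unit {m Γ} : Kinding G m Γ .unitTy .any
  | bool {m Γ} : Kinding G m Γ .boolTy .pub
  | obool {m Γ} : Kinding G m Γ .oboolTy .obl
  | adt {m Γ T k τ} : G T = some (.data k τ) → Kinding G m Γ (.adt T) .pub
  | oadt {m Γ O τ body e} : G O = some (.obliv τ body) → Typing G m Γ e τ →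
      Kinding G m Γ (.oapp O e) .obl
  | pi {m Γ τ₁ τ₂ κ₁ κ₂} : Kinding G m Γ τ₁ κ₁ → Kinding G m (τ₁ :: Γ) τ₂ κ₂ →
      Kinding G m Γ (.pi τ₁ τ₂) .mixed
  | prod {m Γ τ₁ τ₂ κ} : Kinding G m Γ τ₁ κ → Kinding G m Γ τ₂ κ →
      Kinding G m Γ (.prodTy τ₁ τ₂) κ
  | osum {m Γ τ₁ τ₂} : Kinding G m Γ τ₁ .obl → Kinding G m Γ τ₂ .obl →
      Kinding G m Γ (.osumTy τ₁ τ₂) .obl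
  | psi {m Γ O τ body} : G O = some (.obliv τ body) → Kinding G m Γ (.psi O) .mixed
  | letIn {m Γ e τ τ'} : Typing G m Γ e τ → Kinding G m (τ :: Γ) τ' .obl →
      Kinding G m Γ (.letIn e τ') .obl
  | ite {m Γ e₀ τ₁ τ₂} : Typing G m Γ e₀ .boolTy → Kinding G m Γ τ₁ .obl →
      Kinding G m Γ τ₂ .obl → Kinding G m Γ (.ite e₀ τ₁ τ₂) .obl
  | mtch {m Γ T k e₀} {τ τ' : Fin k → Expr} : G T = some (.data k τ) →
      Typing G m Γ e₀ (.adt T) → (∀ i, Kinding G m (τ i :: Γ) (τ' i) .obl) →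
      Kinding G m Γ (.mtch T k e₀ τ') .obl

/-- `Typing G m Γ e τ`: the expression `e` has type `τ` in the local context `Γ`. -/
inductive Typing (G : GCtx) : Mode → List Expr → Expr → Expr → Prop
  | conv {m Γ e τ τ' κ} : Typing G m Γ e τ → TyEquiv G τ τ' → Kinding G m Γ τ' κ →
      Typing G m Γ e τ'
  | unit {m Γ} : Typing G m Γ .unit .unitTy
  | lit {m Γ b} : Typing G m Γ (.lit b) .boolTy
  | var {m Γ x κ} {τ : Expr} : Γ[x]? = some τ → Kinding G m Γ (τ.rename (· + (x + 1))) κ →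
      Typing G m Γ (.var x) (τ.rename (· + (x + 1)))
  | fn {m Γ f m₀ τ e} : G f = some (.fn m₀ τ e) → m₀.Le m → Typing G m Γ (.gvar f) τ
  | abs {m Γ τ₁ τ₂ e κ} : Typing G m (τ₁ :: Γ) e τ₂ → Kinding G m Γ τ₁ κ →
      Typing G m Γ (.lam τ₁ e) (.pi τ₁ τ₂)
  | app {m Γ e₁ e₂ τ₁} {τ₂ : Expr} : Typing G m Γ e₂ (.pi τ₁ τ₂) → Typing G m Γ e₁ τ₁ →
      Typing G m Γ (.app e₂ e₁) (τ₂.inst e₁)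
  | letIn {m Γ e₁ e₂ τ₁} {τ₂ : Expr} : Typing G m Γ e₁ τ₁ → Typing G m (τ₁ :: Γ) e₂ τ₂ →
      Typing G m Γ (.letIn e₁ e₂) (τ₂.inst e₁)
  | pair {m Γ e₁ e₂ τ₁ τ₂} : Typing G m Γ e₁ τ₁ → Typing G m Γ e₂ τ₂ →
      Typing G m Γ (.pair e₁ e₂) (.prodTy τ₁ τ₂)
  | proj {m Γ b e τ₁ τ₂} : Typing G m Γ e (.prodTy τ₁ τ₂) →
      Typing G m Γ (.proj b e) (if b then τ₁ else τ₂)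
  | ite {m Γ e₀ e₁ e₂ κ} {τ : Expr} : Typing G m Γ e₀ .boolTy →
      Typing G m Γ e₁ (τ.inst (.lit true)) → Typing G m Γ e₂ (τ.inst (.lit false)) →
      Kinding G m Γ (τ.inst e₀) κ →
      Typing G m Γ (.ite e₀ e₁ e₂) (τ.inst e₀)
  | ctor {m Γ T k e} {τ : Fin k → Expr} (i : Fin k) : G T = some (.data k τ) →
      Typing G m Γ e (τ i) → Typing G m Γ (.ctor T i e) (.adt T)
  | mtch {m Γ T k e₀ κ} {τ' : Expr} {τ br : Fin k → Expr} : G T = some (.data k τ) →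
      Typing G m Γ e₀ (.adt T) →
      (∀ i, Typing G m (τ i :: Γ) (br i) (τ'.instCtor T i)) →
      Kinding G m Γ (τ'.inst e₀) κ →
      Typing G m Γ (.mtch T k e₀ br) (τ'.inst e₀)
  | psiPair {m Γ O τ body e₁ e₂} : G O = some (.obliv τ body) → Typing G m Γ e₁ τ →
      Typing G m Γ e₂ (.oapp O e₁) → Typing G m Γ (.psiPair e₁ e₂) (.psi O)
  | psiProj₁ {m Γ O τ body e} : G O = some (.obliv τ body) → Typing G m Γ e (.psi O) →
      Typing G m Γ (.proj true e) τ
  | psiProj₂ {m Γ O τ body e} : G O = some (.obliv τ body) → Typing G m Γ e (.psi O) →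
      Typing G m Γ (.proj false e) (.oapp O (.proj true e))
  | mux {m Γ e₀ e₁ e₂ τ} : Typing G m Γ e₀ .oboolTy → Kinding G m Γ τ m.branchKind →
      Typing G m Γ e₁ τ → Typing G m Γ e₂ τ → Typing G m Γ (.mux e₀ e₁ e₂) τ
  | oinj {m Γ b e τ₁ τ₂} : Typing G m Γ e (if b then τ₁ else τ₂) →
      Kinding G m Γ (.osumTy τ₁ τ₂) .obl →
      Typing G m Γ (.oinj b (.osumTy τ₁ τ₂) e) (.osumTy τ₁ τ₂)
  | omatch {m Γ e₀ e₁ e₂ τ₁ τ₂} {τ : Expr} : Typing G m Γ e₀ (.osumTy τ₁ τ₂) →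
      Kinding G m Γ τ m.branchKind →
      Typing G m (τ₁ :: Γ) e₁ τ.shift → Typing G m (τ₂ :: Γ) e₂ τ.shift →
      Typing G m Γ (.omatch e₀ e₁ e₂) τ
  | sec {m Γ e} : Typing G m Γ e .boolTy → Typing G m Γ (.sec e) .oboolTy
  | boxLit {m Γ b} : Typing G m Γ (.boxLit b) .oboolTy
  | boxInj {m Γ b v} {ω : OTy} : OValTy (.inj b ω v) ω → Typing G m Γ (.boxInj b ω v) ω.toExpr

end

/-- Typing of global definitions. -/
def GDef.WellTyped (G : GCtx) : GDef → Prop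
  | .data _ τ => ∀ i, Kinding G .secure [] (τ i) .pub
  | .fn m τ e => (∃ κ, Kinding G m [] τ κ) ∧ Typing G m [] e τ
  | .obliv τ body => Kinding G .secure [] τ .pub ∧ Kinding G .secure [τ] body .obl

def GCtx.WellTyped (G : GCtx) : Prop := ∀ x D, G x = some D → D.WellTyped G

/-- `v` is a closed, securely typed value of type `τ`. -/
def ValOf (G : GCtx) (v τ : Expr) : Prop := IsVal v ∧ Typing G .secure [] v τ

/-! ## Specification types, structures and the logical relation -/

/-- Specification types. -/
inductive SpecTy where
  | unit
  | bool
  | obool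
  | adt (T : Name)
  | psi (O : Name)
  | prod (θ₁ θ₂ : SpecTy)
  | arr (θ₁ θ₂ : SpecTy)

/-- A specification type as a type. It is closed, so the codomain of an arrow needs no shift. -/
def SpecTy.toExpr : SpecTy → Expr
  | .unit => .unitTy
  | .bool => .boolTy
  | .obool => .oboolTy
  | .adt T => .adt T
  | .psi O => .psi O
  | .prod θ₁ θ₂ => .prodTy θ₁.toExpr θ₂.toExpr
  | .arr θ₁ θ₂ => .pi θ₁.toExpr θ₂.toExpr

/-- Well-kinded in the empty local context: all data types and oblivious types are defined. -/
def SpecTy.WellKinded (G : GCtx) (θ : SpecTy) : Prop := ∃ κ, Kinding G .secure [] θ.toExpr κ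

/-- `arrows [θ₁, …, θₘ] α` is `θ₁ → … → θₘ → α`. -/
def SpecTy.arrows (θs : List SpecTy) (α : SpecTy) : SpecTy := θs.foldr .arr α

/-- The data of an OADT-structure of an oblivious algebraic data type (OADT): the public data type, the (names of the global) section,
retraction and view functions, and the relation `HasView v k`: `k` is a valid public view of `v`. -/
structure OADTStruct where
  pub : Name
  sect : Name
  retr : Name
  view : Name
  HasView : Expr → Expr → Prop

/-- The data of a join-structure of `oadt`: an order on public views, and the join and reshape
functions. -/
structure JoinStruct where
  oadt : Name
  Le : Expr → Expr → Prop
  join : Name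
  reshape : Name

/-- The data of an intro-structure of `oadt`: one function for each constructor of its public type,
with the specification type of the argument. -/
structure IntroStruct where
  oadt : Name
  k : ℕ
  θ : Fin k → SpecTy
  fn : Fin k → Name

/-- A member of an elim-structure of `oadt`: the eliminator with return type `α`, with the
specification types of the pattern variables. -/
structure ElimStruct where
  oadt : Name
  α : SpecTy
  k : ℕ
  θ : Fin k → SpecTy
  fn : Name

/-- The data of a coercion-structure. -/
structure CoerStruct where
  src : Name
  dst : Name
  fn : Name

/-- Structure contexts. Every OADT has one OADT-structure; the value of `oadt` at a name that is
not a defined OADT is irrelevant. -/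
structure PsiCtx where
  oadt : Name → OADTStruct
  joins : Set JoinStruct
  intros : Set IntroStruct
  elims : Set ElimStruct
  coers : Set CoerStruct

/-- Erasure of specification types to simple types. -/
def SpecTy.erase (S : PsiCtx) : SpecTy → SpecTy
  | .unit => .unit
  | .bool => .bool
  | .obool => .bool
  | .adt T => .adt T
  | .psi O => .adt (S.oadt O).pub
  | .prod θ₁ θ₂ => .prod (θ₁.erase S) (θ₂.erase S)
  | .arr θ₁ θ₂ => .arr (θ₁.erase S) (θ₂.erase S)

/-- The expression interpretation over a given (step-indexed) value interpretation `R` of `θ`. -/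
def ExpRel (G : GCtx) (S : PsiCtx) (θ : SpecTy) (R : ℕ → Expr → Expr → Prop)
    (n : ℕ) (e e' : Expr) : Prop :=
  Typing G .secure [] e (θ.erase S).toExpr ∧ Typing G .secure [] e' θ.toExpr ∧
  ∀ i < n, ∀ v', IsVal v' → StepN G i e' v' →
    ∃ v, IsVal v ∧ Steps G e v ∧ R (n - i) v v'

/-- Pairs of closed, well-typed values (of the erased type and of the type itself) that satisfy the
condition `core`, which depends on the form of the type. -/
def ValRelCore (G : GCtx) (S : PsiCtx) (θ : SpecTy) (core : ℕ → Expr → Expr → Prop)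
    (n : ℕ) (v v' : Expr) : Prop :=
  ValOf G v (θ.erase S).toExpr ∧ ValOf G v' θ.toExpr ∧ core n v v'

/-- The value interpretation: `(v, v')` belongs to the `n`-th value interpretation of `θ`. -/
def ValRel (G : GCtx) (S : PsiCtx) : SpecTy → ℕ → Expr → Expr → Prop
  | .unit => ValRelCore G S .unit fun n v v' => 0 < n → v = v'
  | .bool => ValRelCore G S .bool fun n v v' => 0 < n → v = v'
  | .adt T => ValRelCore G S (.adt T) fun n v v' => 0 < n → v = v'
  | .obool => ValRelCore G S .obool fun n v v' =>
      ∃ b b', v = .lit b ∧ v' = .boxLit b' ∧ (0 < n → b = b')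
  | .psi O => ValRelCore G S (.psi O) fun n v v' =>
      ∃ (k : Expr) (w : OVal), v' = .psiPair k w.toExpr ∧
        (0 < n → Steps G (apps (.gvar (S.oadt O).retr) [k, w.toExpr]) v)
  | .prod θ₁ θ₂ => ValRelCore G S (.prod θ₁ θ₂) fun n v v' =>
      ∃ v₁ v₂ v₁' v₂', v = .pair v₁ v₂ ∧ v' = .pair v₁' v₂' ∧
        ValRel G S θ₁ n v₁ v₁' ∧ ValRel G S θ₂ n v₂ v₂'
  | .arr θ₁ θ₂ => ValRelCore G S (.arr θ₁ θ₂) fun n v v' =>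
      ∃ e e', v = .lam (θ₁.erase S).toExpr e ∧ v' = .lam θ₁.toExpr e' ∧
        ∀ i < n, ∀ u u', ValRel G S θ₁ i u u' →
          ExpRel G S θ₂ (ValRel G S θ₂) i (e.inst u) (e'.inst u')

/-- The expression interpretation: `(e, e')` belongs to the `n`-th expression interpretation of
`θ`, i.e. `e'` refines `e` within `n` steps. -/
def ERel (G : GCtx) (S : PsiCtx) (θ : SpecTy) (n : ℕ) (e e' : Expr) : Prop :=
  ExpRel G S θ (ValRel G S θ) n e e'

/-! ## Laws of the structures -/

/-- `A` is an OADT-structure of `O`, with public view type `τ`. The retraction is leaky. -/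
structure OADTStruct.IsValid (G : GCtx) (O : Name) (τ : Expr) (A : OADTStruct) : Prop where
  pub_def : ∃ k η, G A.pub = some (.data k η)
  sect_ty : Typing G .secure [] (.gvar A.sect) (.pi τ (.pi (.adt A.pub) (.oapp O (.var 1))))
  retr_ty : Typing G .leaky [] (.gvar A.retr) (.pi τ (.pi (.oapp O (.var 0)) (.adt A.pub)))
  view_ty : Typing G .secure [] (.gvar A.view) (.pi (.adt A.pub) τ)
  retr_sect : ∀ (v k : Expr) (w : OVal), ValOf G v (.adt A.pub) → ValOf G k τ →
    ValOf G w.toExpr (.oapp O k) → A.HasView v k →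
    Steps G (apps (.gvar A.sect) [k, v]) w.toExpr → Steps G (apps (.gvar A.retr) [k, w.toExpr]) v
  retr_view : ∀ (v k : Expr) (w : OVal), ValOf G v (.adt A.pub) → ValOf G k τ →
    ValOf G w.toExpr (.oapp O k) → Steps G (apps (.gvar A.retr) [k, w.toExpr]) v → A.HasView v k
  view_view : ∀ v k : Expr, ValOf G v (.adt A.pub) → ValOf G k τ →
    Steps G (.app (.gvar A.view) v) k → A.HasView v k

/-- `J` is a join-structure. -/
structure JoinStruct.IsValid (G : GCtx) (S : PsiCtx) (τ : Expr) (J : JoinStruct) : Prop where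
  join_ty : Typing G .secure [] (.gvar J.join) (.pi τ (.pi τ τ))
  reshape_ty : Typing G .secure [] (.gvar J.reshape)
    (.pi τ (.pi τ (.pi (.oapp J.oadt (.var 1)) (.oapp J.oadt (.var 1)))))
  le_refl : ∀ k, ValOf G k τ → J.Le k k
  le_antisymm : ∀ k₁ k₂, ValOf G k₁ τ → ValOf G k₂ τ → J.Le k₁ k₂ → J.Le k₂ k₁ → k₁ = k₂
  le_trans : ∀ k₁ k₂ k₃, ValOf G k₁ τ → ValOf G k₂ τ → ValOf G k₃ τ →
    J.Le k₁ k₂ → J.Le k₂ k₃ → J.Le k₁ k₃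
  le_join : ∀ k₁ k₂ k, ValOf G k₁ τ → ValOf G k₂ τ → ValOf G k τ →
    Steps G (apps (.gvar J.join) [k₁, k₂]) k → J.Le k₁ k ∧ J.Le k₂ k
  view_mono : ∀ v k k', ValOf G v (.adt (S.oadt J.oadt).pub) → ValOf G k τ → ValOf G k' τ →
    (S.oadt J.oadt).HasView v k → J.Le k k' → (S.oadt J.oadt).HasView v k'
  retr_reshape : ∀ (v k k' : Expr) (w w' : OVal), ValOf G v (.adt (S.oadt J.oadt).pub) →
    ValOf G k τ → ValOf G k' τ →
    ValOf G w.toExpr (.oapp J.oadt k) → ValOf G w'.toExpr (.oapp J.oadt k') →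
    Steps G (apps (.gvar (S.oadt J.oadt).retr) [k, w.toExpr]) v →
    (S.oadt J.oadt).HasView v k' →
    Steps G (apps (.gvar J.reshape) [k, k', w.toExpr]) w'.toExpr →
    Steps G (apps (.gvar (S.oadt J.oadt).retr) [k', w'.toExpr]) v

/-- `I` is an intro-structure. -/
structure IntroStruct.IsValid (G : GCtx) (S : PsiCtx) (I : IntroStruct) : Prop where
  oadt_def : ∃ τ body, G I.oadt = some (.obliv τ body)
  compat : G (S.oadt I.oadt).pub = some (.data I.k fun i => ((I.θ i).erase S).toExpr)
  fn_ty : ∀ i, Typing G .secure [] (.gvar (I.fn i)) (SpecTy.arr (I.θ i) (.psi I.oadt)).toExpr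
  refines : ∀ (i : Fin I.k) (n : ℕ) (v v' : Expr), ValRel G S (I.θ i) n v v' →
    ERel G S (.psi I.oadt) n (.ctor (S.oadt I.oadt).pub i v) (.app (.gvar (I.fn i)) v')

/-- `E` is a member of an elim-structure. -/
structure ElimStruct.IsValid (G : GCtx) (S : PsiCtx) (E : ElimStruct) : Prop where
  oadt_def : ∃ τ body, G E.oadt = some (.obliv τ body)
  compat : G (S.oadt E.oadt).pub = some (.data E.k fun i => ((E.θ i).erase S).toExpr)
  fn_ty : Typing G .secure [] (.gvar E.fn)
    (SpecTy.arr (.psi E.oadt)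
      (SpecTy.arrows (List.ofFn fun i => SpecTy.arr (E.θ i) E.α) E.α)).toExpr
  refines : ∀ (i : Fin E.k) (n : ℕ) (v k : Expr) (w : OVal) (e e' : Fin E.k → Expr),
    ValOf G v ((E.θ i).erase S).toExpr →
    ValOf G (.psiPair k w.toExpr) (.psi E.oadt) →
    Steps G (apps (.gvar (S.oadt E.oadt).retr) [k, w.toExpr]) (.ctor (S.oadt E.oadt).pub i v) →
    (∀ j, ValRel G S (.arr (E.θ j) E.α) n
      (.lam ((E.θ j).erase S).toExpr (e j)) (.lam (E.θ j).toExpr (e' j))) →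
    ERel G S E.α n ((e i).inst v)
      (apps (.app (.gvar E.fn) (.psiPair k w.toExpr))
        (List.ofFn fun j => .lam (E.θ j).toExpr (e' j)))

/-- `C` is a coercion-structure. -/
structure CoerStruct.IsValid (G : GCtx) (S : PsiCtx) (C : CoerStruct) : Prop where
  src_def : ∃ τ body, G C.src = some (.obliv τ body)
  dst_def : ∃ τ body, G C.dst = some (.obliv τ body)
  compat : (S.oadt C.src).pub = (S.oadt C.dst).pub
  fn_ty : Typing G .secure [] (.gvar C.fn) (SpecTy.arr (.psi C.src) (.psi C.dst)).toExpr
  refines : ∀ (v k k' : Expr) (w w' : OVal), ValOf G v (.adt (S.oadt C.src).pub) →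
    ValOf G (.psiPair k w.toExpr) (.psi C.src) → ValOf G (.psiPair k' w'.toExpr) (.psi C.dst) →
    Steps G (apps (.gvar (S.oadt C.src).retr) [k, w.toExpr]) v →
    Steps G (.app (.gvar C.fn) (.psiPair k w.toExpr)) (.psiPair k' w'.toExpr) →
    Steps G (apps (.gvar (S.oadt C.dst).retr) [k', w'.toExpr]) v

/-- All structures of the context are structures for `G`, and every OADT has an OADT-structure. -/
structure PsiCtx.IsValid (G : GCtx) (S : PsiCtx) : Prop where
  oadt : ∀ O τ body, G O = some (.obliv τ body) → (S.oadt O).IsValid G O τ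
  joins : ∀ J ∈ S.joins, ∃ τ body, G J.oadt = some (.obliv τ body) ∧ J.IsValid G S τ
  intros : ∀ I ∈ S.intros, I.IsValid G S
  elims : ∀ E ∈ S.elims, E.IsValid G S
  coers : ∀ C ∈ S.coers, C.IsValid G S

/-! ## Declarative lifting -/

/-- `Mergeable G S θ i`: the type `θ` is mergeable, with witness `i : obool → θ → θ → θ`. Witnesses
are closed, so they need no shift under binders. -/
inductive Mergeable (G : GCtx) (S : PsiCtx) : SpecTy → Expr → Prop
  | unit : Mergeable G S .unit
      (.lam .oboolTy (.lam .unitTy (.lam .unitTy (.mux (.var 2) (.var 1) (.var 0)))))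
  | obool : Mergeable G S .obool
      (.lam .oboolTy (.lam .oboolTy (.lam .oboolTy (.mux (.var 2) (.var 1) (.var 0)))))
  | psi {J} : J ∈ S.joins → Mergeable G S (.psi J.oadt)
      (.lam .oboolTy (.lam (.psi J.oadt) (.lam (.psi J.oadt)
        (.letIn (apps (.gvar J.join) [.proj true (.var 1), .proj true (.var 0)])
          (.psiPair (.var 0)
            (.mux (.var 3)
              (apps (.gvar J.reshape) [.proj true (.var 2), .var 0, .proj false (.var 2)])
              (apps (.gvar J.reshape) [.proj true (.var 1), .var 0, .proj false (.var 1)])))))))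
  | prod {θ₁ θ₂ i₁ i₂} : Mergeable G S θ₁ i₁ → Mergeable G S θ₂ i₂ →
      Mergeable G S (.prod θ₁ θ₂)
        (.lam .oboolTy (.lam (SpecTy.prod θ₁ θ₂).toExpr (.lam (SpecTy.prod θ₁ θ₂).toExpr
          (.pair
            (apps i₁ [.var 2, .proj true (.var 1), .proj true (.var 0)])
            (apps i₂ [.var 2, .proj false (.var 1), .proj false (.var 0)])))))
  | arr {θ₁ θ₂ i₂} : θ₁.WellKinded G → Mergeable G S θ₂ i₂ →
      Mergeable G S (.arr θ₁ θ₂)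
        (.lam .oboolTy (.lam (SpecTy.arr θ₁ θ₂).toExpr (.lam (SpecTy.arr θ₁ θ₂).toExpr
          (.lam θ₁.toExpr
            (apps i₂ [.var 3, .app (.var 2) (.var 0), .app (.var 1) (.var 0)])))))

/-- `Coercible G S θ θ' c`: the type `θ` is coercible to `θ'`, with closed witness `c : θ → θ'`. -/
inductive Coercible (G : GCtx) (S : PsiCtx) : SpecTy → SpecTy → Expr → Prop
  | refl {θ} : θ.WellKinded G → Coercible G S θ θ (.lam θ.toExpr (.var 0))
  | bool : Coercible G S .bool .obool (.lam .boolTy (.sec (.var 0)))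
  | sect {O τ body} : G O = some (.obliv τ body) →
      Coercible G S (.adt (S.oadt O).pub) (.psi O)
        (.lam (.adt (S.oadt O).pub)
          (.psiPair (.app (.gvar (S.oadt O).view) (.var 0))
            (apps (.gvar (S.oadt O).sect) [.app (.gvar (S.oadt O).view) (.var 0), .var 0])))
  | psi {C} : C ∈ S.coers → Coercible G S (.psi C.src) (.psi C.dst) (.gvar C.fn)
  | prod {θ₁ θ₂ θ₁' θ₂' c₁ c₂} : Coercible G S θ₁ θ₁' c₁ → Coercible G S θ₂ θ₂' c₂ →
      Coercible G S (.prod θ₁ θ₂) (.prod θ₁' θ₂')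
        (.lam (SpecTy.prod θ₁ θ₂).toExpr
          (.pair (.app c₁ (.proj true (.var 0))) (.app c₂ (.proj false (.var 0)))))
  | arr {θ₁ θ₂ θ₁' θ₂' c₁ c₂} : Coercible G S θ₁' θ₁ c₁ → Coercible G S θ₂ θ₂' c₂ →
      Coercible G S (.arr θ₁ θ₂) (.arr θ₁' θ₂')
        (.lam (SpecTy.arr θ₁ θ₂).toExpr
          (.lam θ₁'.toExpr (.app c₂ (.app (.var 1) (.app c₁ (.var 0))))))

/-- A lifting context: `(x, θ, y)` says that the global function `x` is lifted, at type `θ`, to the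
global function `y`. -/
abbrev LiftCtx := Set (Name × SpecTy × Name)

/-- `Lift G S L Γ e θ e'`: the expression `e` is lifted to `e'` at the target type `θ`; the local
context `Γ` records the target types of the local variables. -/
inductive Lift (G : GCtx) (S : PsiCtx) (L : LiftCtx) :
    List SpecTy → Expr → SpecTy → Expr → Prop
  | unit {Γ} : Lift G S L Γ .unit .unit .unit
  | lit {Γ b} : Lift G S L Γ (.lit b) .bool (.lit b)
  | var {Γ x θ} : Γ[x]? = some θ → Lift G S L Γ (.var x) θ (.var x)
  | fn {Γ x θ y} : (x, θ, y) ∈ L → Lift G S L Γ (.gvar x) θ (.gvar y)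
  | abs {Γ θ₁ θ₂ e e'} : θ₁.WellKinded G → Lift G S L (θ₁ :: Γ) e θ₂ e' →
      Lift G S L Γ (.lam (θ₁.erase S).toExpr e) (.arr θ₁ θ₂) (.lam θ₁.toExpr e')
  | app {Γ θ₁ θ₂ e₁ e₂ e₁' e₂'} : Lift G S L Γ e₂ (.arr θ₁ θ₂) e₂' → Lift G S L Γ e₁ θ₁ e₁' →
      Lift G S L Γ (.app e₂ e₁) θ₂ (.app e₂' e₁')
  | letIn {Γ θ₁ θ₂ e₁ e₂ e₁' e₂'} : Lift G S L Γ e₁ θ₁ e₁' → Lift G S L (θ₁ :: Γ) e₂ θ₂ e₂' →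
      Lift G S L Γ (.letIn e₁ e₂) θ₂ (.letIn e₁' e₂')
  | pair {Γ θ₁ θ₂ e₁ e₂ e₁' e₂'} : Lift G S L Γ e₁ θ₁ e₁' → Lift G S L Γ e₂ θ₂ e₂' →
      Lift G S L Γ (.pair e₁ e₂) (.prod θ₁ θ₂) (.pair e₁' e₂')
  | proj {Γ b θ₁ θ₂ e e'} : Lift G S L Γ e (.prod θ₁ θ₂) e' →
      Lift G S L Γ (.proj b e) (if b then θ₁ else θ₂) (.proj b e')
  | ite₁ {Γ θ e₀ e₁ e₂ e₀' e₁' e₂'} : Lift G S L Γ e₀ .bool e₀' →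
      Lift G S L Γ e₁ θ e₁' → Lift G S L Γ e₂ θ e₂' →
      Lift G S L Γ (.ite e₀ e₁ e₂) θ (.ite e₀' e₁' e₂')
  | ite₂ {Γ θ i e₀ e₁ e₂ e₀' e₁' e₂'} : Lift G S L Γ e₀ .obool e₀' → Mergeable G S θ i →
      Lift G S L Γ e₁ θ e₁' → Lift G S L Γ e₂ θ e₂' →
      Lift G S L Γ (.ite e₀ e₁ e₂) θ (apps i [e₀', e₁', e₂'])
  | ctor₁ {Γ T k e e'} {η : Fin k → SpecTy} (i : Fin k) :
      G T = some (.data k fun j => (η j).toExpr) → Lift G S L Γ e (η i) e' →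
      Lift G S L Γ (.ctor T i e) (.adt T) (.ctor T i e')
  | ctor₂ {Γ I e e'} (i : Fin I.k) : I ∈ S.intros → Lift G S L Γ e (I.θ i) e' →
      Lift G S L Γ (.ctor (S.oadt I.oadt).pub i e) (.psi I.oadt) (.app (.gvar (I.fn i)) e')
  | mtch₁ {Γ T k θ e₀ e₀'} {η : Fin k → SpecTy} {br br' : Fin k → Expr} :
      θ.WellKinded G → G T = some (.data k fun j => (η j).toExpr) →
      Lift G S L Γ e₀ (.adt T) e₀' → (∀ i, Lift G S L (η i :: Γ) (br i) θ (br' i)) →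
      Lift G S L Γ (.mtch T k e₀ br) θ (.mtch T k e₀' br')
  | mtch₂ {Γ E e₀ e₀'} {br br' : Fin E.k → Expr} : E ∈ S.elims →
      Lift G S L Γ e₀ (.psi E.oadt) e₀' →
      (∀ i, Lift G S L (E.θ i :: Γ) (br i) E.α (br' i)) →
      Lift G S L Γ (.mtch (S.oadt E.oadt).pub E.k e₀ br) E.α
        (apps (.app (.gvar E.fn) e₀') (List.ofFn fun i => .lam (E.θ i).toExpr (br' i)))
  | coerce {Γ θ θ' c e e'} : Lift G S L Γ e θ e' → Coercible G S θ θ' c →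
      Lift G S L Γ e θ' (.app c e')

/-- A lifting context is `n`-valid if each lifted function refines its source within `n` steps. -/
def LiftCtx.NValid (G : GCtx) (S : PsiCtx) (L : LiftCtx) (n : ℕ) : Prop :=
  ∀ x θ y, (x, θ, y) ∈ L → ERel G S θ n (.gvar x) (.gvar y)

end Taypsi

namespace Taypsi

/-! ## Substitution algebra -/

/-- Extend a substitution by an image for the variable `0`. -/
def scons (a : Expr) (σ : ℕ → Expr) : ℕ → Expr
  | 0 => a
  | x + 1 => σ x

theorem upSub_var : upSub .var = .var := by
  funext x; cases x <;> rfl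

theorem upSub_ren (ξ : ℕ → ℕ) : upSub (fun x => .var (ξ x)) = fun x => .var (upRen ξ x) := by
  funext x; cases x <;> rfl

@[simp] theorem Expr.subst_id (e : Expr) : e.subst .var = e := by
  induction e <;> simp_all [Expr.subst, upSub_var]

theorem Expr.rename_eq_subst (e : Expr) (ξ : ℕ → ℕ) :
    e.rename ξ = e.subst (fun x => .var (ξ x)) := by
  induction e generalizing ξ <;> simp_all [Expr.subst, Expr.rename, upSub_ren]

theorem Expr.rename_subst (e : Expr) (ξ : ℕ → ℕ) (σ : ℕ → Expr) :
    (e.rename ξ).subst σ = e.subst (fun x => σ (ξ x)) := by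
  have up (ξ : ℕ → ℕ) (σ : ℕ → Expr) :
      (fun x => upSub σ (upRen ξ x)) = upSub (fun x => σ (ξ x)) := by
    funext x; cases x <;> rfl
  induction e generalizing ξ σ <;> simp_all [Expr.subst, Expr.rename]

theorem Expr.rename_rename (e : Expr) (ξ ζ : ℕ → ℕ) :
    (e.rename ξ).rename ζ = e.rename (fun x => ζ (ξ x)) := by
  rw [rename_eq_subst _ ζ, rename_subst, rename_eq_subst]

theorem Expr.subst_rename (e : Expr) (σ : ℕ → Expr) (ξ : ℕ → ℕ) :
    (e.subst σ).rename ξ = e.subst (fun x => (σ x).rename ξ) := by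
  have up (σ : ℕ → Expr) (ξ : ℕ → ℕ) :
      (fun x => (upSub σ x).rename (upRen ξ)) = upSub (fun x => (σ x).rename ξ) := by
    funext x
    cases x
    · rfl
    · simp only [upSub, Expr.shift, rename_rename]; rfl
  induction e generalizing σ ξ <;> simp_all [Expr.subst, Expr.rename]

theorem Expr.subst_subst (e : Expr) (σ ρ : ℕ → Expr) :
    (e.subst σ).subst ρ = e.subst (fun x => (σ x).subst ρ) := by
  have up (σ ρ : ℕ → Expr) :
      (fun x => (upSub σ x).subst (upSub ρ)) = upSub (fun x => (σ x).subst ρ) := by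
    funext x
    cases x
    · rfl
    · simp only [upSub, Expr.shift, rename_subst, subst_rename]
  induction e generalizing σ ρ <;> simp_all [Expr.subst]

theorem Expr.inst_eq (e a : Expr) : e.inst a = e.subst (scons a .var) := by
  unfold Expr.inst; congr

theorem Expr.subst_up_inst (e a : Expr) (σ : ℕ → Expr) :
    (e.subst (upSub σ)).inst a = e.subst (scons a σ) := by
  rw [inst_eq, subst_subst]
  congr; funext x; cases x
  · rfl
  · simp only [upSub, Expr.shift, rename_subst, scons, Expr.subst_id]

theorem Expr.inst_subst (e a : Expr) (σ : ℕ → Expr) :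
    (e.inst a).subst σ = (e.subst (upSub σ)).inst (a.subst σ) := by
  rw [subst_up_inst, inst_eq, subst_subst]
  congr; funext x; cases x <;> rfl

@[simp] theorem Expr.shift_inst (e a : Expr) : e.shift.inst a = e := by
  rw [inst_eq, Expr.shift, rename_subst]; exact Expr.subst_id _

theorem Expr.shift_subst_up (e : Expr) (σ : ℕ → Expr) :
    e.shift.subst (upSub σ) = (e.subst σ).shift := by
  simp only [Expr.shift, rename_subst, subst_rename, upSub]

theorem Expr.instCtor_inst (e a : Expr) (T : Name) (i : ℕ) :
    (e.instCtor T i).inst a = e.inst (.ctor T i a) := by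
  rw [inst_eq, inst_eq, instCtor, subst_subst]
  congr; funext x; cases x <;> rfl

theorem Expr.instCtor_subst (e : Expr) (T : Name) (i : ℕ) (σ : ℕ → Expr) :
    (e.instCtor T i).subst (upSub σ) = (e.subst (upSub σ)).instCtor T i := by
  rw [instCtor, instCtor, subst_subst, subst_subst]
  congr; funext x; cases x
  · rfl
  · simp only [upSub, Expr.shift, rename_subst, Expr.subst]
    rw [rename_eq_subst]

@[simp] theorem OTy.toExpr_subst (ω : OTy) (σ : ℕ → Expr) : ω.toExpr.subst σ = ω.toExpr := by
  induction ω <;> simp_all [OTy.toExpr, Expr.subst]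

@[simp] theorem OVal.toExpr_subst (v : OVal) (σ : ℕ → Expr) : v.toExpr.subst σ = v.toExpr := by
  induction v <;> simp_all [OVal.toExpr, Expr.subst]

theorem OTy.toExpr_injective : ∀ {ω ω' : OTy}, ω.toExpr = ω'.toExpr → ω = ω' := by
  intro ω
  induction ω with
  | unit => intro ω' h; cases ω' <;> simp_all [OTy.toExpr]
  | obool => intro ω' h; cases ω' <;> simp_all [OTy.toExpr]
  | prod _ _ h₁ h₂ | sum _ _ h₁ h₂ =>
    intro ω' h
    cases ω' <;> simp only [OTy.toExpr, reduceCtorEq, Expr.prodTy.injEq, Expr.osumTy.injEq] at h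
    rw [h₁ h.1, h₂ h.2]

theorem OVal.toExpr_injective : ∀ {v v' : OVal}, v.toExpr = v'.toExpr → v = v' := by
  intro v
  induction v with
  | pair _ _ h₁ h₂ =>
    intro v' h
    cases v' <;> simp only [OVal.toExpr, reduceCtorEq, Expr.pair.injEq] at h
    rw [h₁ h.1, h₂ h.2]
  | _ => intro v' h; cases v' <;> simp_all [OVal.toExpr]

/-! ## Closed expressions -/

/-- All free variables of `e` are below `n`. -/
def Expr.ClosedAt (n : ℕ) (e : Expr) : Prop :=
  ∀ σ : ℕ → Expr, (∀ x < n, σ x = .var x) → e.subst σ = e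

theorem upSub_fixes {n : ℕ} {σ : ℕ → Expr} (h : ∀ x < n, σ x = .var x) :
    ∀ x < n + 1, upSub σ x = .var x := by
  intro x hx
  cases x with
  | zero => rfl
  | succ x => simp only [upSub, h x (by omega)]; rfl

theorem Expr.ClosedAt.subst {e : Expr} (h : e.ClosedAt 0) (σ : ℕ → Expr) : e.subst σ = e :=
  h σ (by omega)

theorem Expr.ClosedAt.rename {e : Expr} (h : e.ClosedAt 0) (ξ : ℕ → ℕ) : e.rename ξ = e := by
  rw [rename_eq_subst]; exact h.subst _

theorem Expr.ClosedAt.inst {e : Expr} (h : e.ClosedAt 0) (a : Expr) : e.inst a = e := by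
  rw [inst_eq]; exact h.subst _

mutual

theorem Kinding.closedAt {G : GCtx} {m : Mode} {Γ : List Expr} {τ : Expr} {κ : Kind} :
    Kinding G m Γ τ κ → τ.ClosedAt Γ.length
  | .sub h _ => h.closedAt
  | .unit => fun _ _ => rfl
  | .bool => fun _ _ => rfl
  | .obool => fun _ _ => rfl
  | .adt _ => fun _ _ => rfl
  | .oadt _ h => fun σ hσ => by simp only [Expr.subst, h.closedAt σ hσ]
  | .pi h₁ h₂ => fun σ hσ => by
      simp only [Expr.subst, h₁.closedAt σ hσ, h₂.closedAt _ (upSub_fixes hσ)]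
  | .prod h₁ h₂ => fun σ hσ => by simp only [Expr.subst, h₁.closedAt σ hσ, h₂.closedAt σ hσ]
  | .osum h₁ h₂ => fun σ hσ => by simp only [Expr.subst, h₁.closedAt σ hσ, h₂.closedAt σ hσ]
  | .psi _ => fun _ _ => rfl
  | .letIn h₁ h₂ => fun σ hσ => by
      simp only [Expr.subst, h₁.closedAt σ hσ, h₂.closedAt _ (upSub_fixes hσ)]
  | .ite h₀ h₁ h₂ => fun σ hσ => by
      simp only [Expr.subst, h₀.closedAt σ hσ, h₁.closedAt σ hσ, h₂.closedAt σ hσ]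
  | .mtch _ h₀ h => fun σ hσ => by
      simp only [Expr.subst, h₀.closedAt σ hσ, fun i => (h i).closedAt _ (upSub_fixes hσ)]

theorem Typing.closedAt {G : GCtx} {m : Mode} {Γ : List Expr} {e τ : Expr} :
    Typing G m Γ e τ → e.ClosedAt Γ.length
  | .conv h _ _ => h.closedAt
  | .unit => fun _ _ => rfl
  | .lit => fun _ _ => rfl
  | .var hx _ => fun σ hσ => hσ _ (List.getElem?_eq_some_iff.1 hx).1
  | .fn _ _ => fun _ _ => rfl
  | .abs h₂ h₁ => fun σ hσ => by
      simp only [Expr.subst, h₁.closedAt σ hσ, h₂.closedAt _ (upSub_fixes hσ)]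
  | .app h₁ h₂ => fun σ hσ => by simp only [Expr.subst, h₁.closedAt σ hσ, h₂.closedAt σ hσ]
  | .letIn h₁ h₂ => fun σ hσ => by
      simp only [Expr.subst, h₁.closedAt σ hσ, h₂.closedAt _ (upSub_fixes hσ)]
  | .pair h₁ h₂ => fun σ hσ => by simp only [Expr.subst, h₁.closedAt σ hσ, h₂.closedAt σ hσ]
  | .proj h => fun σ hσ => by simp only [Expr.subst, h.closedAt σ hσ]
  | .ite h₀ h₁ h₂ _ => fun σ hσ => by
      simp only [Expr.subst, h₀.closedAt σ hσ, h₁.closedAt σ hσ, h₂.closedAt σ hσ]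
  | .ctor _ _ h => fun σ hσ => by simp only [Expr.subst, h.closedAt σ hσ]
  | .mtch _ h₀ h _ => fun σ hσ => by
      simp only [Expr.subst, h₀.closedAt σ hσ, fun i => (h i).closedAt _ (upSub_fixes hσ)]
  | .psiPair _ h₁ h₂ => fun σ hσ => by
      simp only [Expr.subst, h₁.closedAt σ hσ, h₂.closedAt σ hσ]
  | .psiProj₁ _ h => fun σ hσ => by simp only [Expr.subst, h.closedAt σ hσ]
  | .psiProj₂ _ h => fun σ hσ => by simp only [Expr.subst, h.closedAt σ hσ]
  | .mux h₀ _ h₁ h₂ => fun σ hσ => by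
      simp only [Expr.subst, h₀.closedAt σ hσ, h₁.closedAt σ hσ, h₂.closedAt σ hσ]
  | .oinj h₁ h₂ => fun σ hσ => by
      rw [Expr.subst, h₁.closedAt σ hσ, h₂.closedAt σ hσ]
  | .omatch h₀ _ h₁ h₂ => fun σ hσ => by
      simp only [Expr.subst, h₀.closedAt σ hσ, h₁.closedAt _ (upSub_fixes hσ),
        h₂.closedAt _ (upSub_fixes hσ)]
  | .sec h => fun σ hσ => by simp only [Expr.subst, h.closedAt σ hσ]
  | .boxLit => fun _ _ => rfl
  | .boxInj _ => fun _ _ => rfl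

end

namespace GCtx.WellTyped

theorem fn_closed {G : GCtx} (hG : G.WellTyped) {f : Name} {m : Mode} {τ e : Expr} (h : G f = some (.fn m τ e)) :
    τ.ClosedAt 0 ∧ e.ClosedAt 0 :=
  have ⟨⟨_, h₁⟩, h₂⟩ := hG _ _ h
  ⟨h₁.closedAt, h₂.closedAt⟩

theorem obliv_closed {G : GCtx} (hG : G.WellTyped) {O : Name} {τ body : Expr} (h : G O = some (.obliv τ body)) :
    τ.ClosedAt 0 ∧ body.ClosedAt 1 :=
  have ⟨h₁, h₂⟩ := hG _ _ h
  ⟨h₁.closedAt, h₂.closedAt⟩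

theorem data_closed {G : GCtx} (hG : G.WellTyped) {T : Name} {k : ℕ} {τ : Fin k → Expr} (h : G T = some (.data k τ))
    (i : Fin k) : (τ i).ClosedAt 0 :=
  (hG _ _ h i).closedAt

theorem obliv_inst_subst {G : GCtx} (hG : G.WellTyped) {O : Name} {τ body : Expr} (h : G O = some (.obliv τ body))
    (e : Expr) (σ : ℕ → Expr) : (body.inst e).subst σ = body.inst (e.subst σ) := by
  rw [Expr.inst_subst, (hG.obliv_closed h).2 _ (upSub_fixes (by omega))]

end GCtx.WellTyped

end Taypsi

namespace Taypsi

/-! ## Parallel reduction and substitution -/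

namespace Pared

theorem subst_refl {G : GCtx} {R : (ℕ → Expr) → (ℕ → Expr) → Prop}
    (up : ∀ {σ σ'}, R σ σ' → R (upSub σ) (upSub σ'))
    (point : ∀ {σ σ'}, R σ σ' → ∀ x, Pared G (σ x) (σ' x)) (e : Expr) {σ σ' : ℕ → Expr}
    (h : R σ σ') : Pared G (e.subst σ) (e.subst σ') := by
  induction e generalizing σ σ' with
  | var x => exact point h x
  | prodTy _ _ h₁ h₂ => exact .prodTy (h₁ h) (h₂ h)
  | osumTy _ _ h₁ h₂ => exact .osumTy (h₁ h) (h₂ h)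
  | pi _ _ h₁ h₂ => exact .pi (h₁ h) (h₂ (up h))
  | lam _ _ h₁ h₂ => exact .lam (h₁ h) (h₂ (up h))
  | letIn _ _ h₁ h₂ => exact .letIn (h₁ h) (h₂ (up h))
  | app _ _ h₁ h₂ => exact .app (h₁ h) (h₂ h)
  | ctor _ _ _ h₁ => exact .ctor (h₁ h)
  | oapp _ _ h₁ => exact .oapp (h₁ h)
  | ite _ _ _ h₀ h₁ h₂ => exact .ite (h₀ h) (h₁ h) (h₂ h)
  | mux _ _ _ h₀ h₁ h₂ => exact .mux (h₀ h) (h₁ h) (h₂ h)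
  | pair _ _ h₁ h₂ => exact .pair (h₁ h) (h₂ h)
  | psiPair _ _ h₁ h₂ => exact .psiPair (h₁ h) (h₂ h)
  | proj _ _ h₁ => exact .proj (h₁ h)
  | oinj _ _ _ h₁ h₂ => exact .oinj (h₁ h) (h₂ h)
  | omatch _ _ _ h₀ h₁ h₂ => exact .omatch (h₀ h) (h₁ (up h)) (h₂ (up h))
  | mtch _ _ _ _ h₀ hb => exact .mtch (h₀ h) fun i => hb i (up h)
  | sec _ h₁ => exact .sec (h₁ h)
  | _ => exact .refl _

/-- Parallel reduction is compatible with every family of pointwise related substitutions that is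
closed under binders. -/
theorem subst_of {G : GCtx} (hG : G.WellTyped) {R : (ℕ → Expr) → (ℕ → Expr) → Prop}
    (up : ∀ {σ σ'}, R σ σ' → R (upSub σ) (upSub σ'))
    (point : ∀ {σ σ'}, R σ σ' → ∀ x, Pared G (σ x) (σ' x)) {e e' : Expr} (he : Pared G e e')
    {σ σ' : ℕ → Expr} (h : R σ σ') : Pared G (e.subst σ) (e'.subst σ') := by
  induction he generalizing σ σ' with
  | refl e => exact subst_refl (R := R) up point e h
  | fn hf => rw [(hG.fn_closed hf).2.subst]; exact .fn hf
  | oadt hO _ h₁ => rw [hG.obliv_inst_subst hO]; exact .oadt hO (h₁ h)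
  | beta _ _ h₁ h₂ => rw [Expr.inst_subst]; exact .beta (h₁ (up h)) (h₂ h)
  | letBeta _ _ h₁ h₂ => rw [Expr.inst_subst]; exact .letBeta (h₁ h) (h₂ (up h))
  | iteBeta _ _ h₁ h₂ => rw [apply_ite (Expr.subst · σ')]; exact .iteBeta (h₁ h) (h₂ h)
  | muxBeta _ _ h₁ h₂ => rw [apply_ite (Expr.subst · σ')]; exact .muxBeta (h₁ h) (h₂ h)
  | mtchBeta i _ _ h₁ h₂ => rw [Expr.inst_subst]; exact .mtchBeta i (h₁ h) (h₂ (up h))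
  | projBeta _ _ h₁ h₂ => rw [apply_ite (Expr.subst · σ')]; exact .projBeta (h₁ h) (h₂ h)
  | psiProjBeta _ _ h₁ h₂ => rw [apply_ite (Expr.subst · σ')]; exact .psiProjBeta (h₁ h) (h₂ h)
  | secBeta => exact .secBeta
  | oinjBeta => simp only [Expr.subst, OTy.toExpr_subst, OVal.toExpr_subst]; exact .oinjBeta
  | omatchBeta hv₁ hv₂ _ _ h₁ h₂ =>
    simp only [Expr.subst, apply_ite (Expr.subst · σ'), Expr.inst_subst, OVal.toExpr_subst]
    exact .omatchBeta hv₁ hv₂ (h₁ (up h)) (h₂ (up h))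
  | prodTy _ _ h₁ h₂ => exact .prodTy (h₁ h) (h₂ h)
  | osumTy _ _ h₁ h₂ => exact .osumTy (h₁ h) (h₂ h)
  | pi _ _ h₁ h₂ => exact .pi (h₁ h) (h₂ (up h))
  | lam _ _ h₁ h₂ => exact .lam (h₁ h) (h₂ (up h))
  | letIn _ _ h₁ h₂ => exact .letIn (h₁ h) (h₂ (up h))
  | app _ _ h₁ h₂ => exact .app (h₁ h) (h₂ h)
  | ctor _ h₁ => exact .ctor (h₁ h)
  | oapp _ h₁ => exact .oapp (h₁ h)
  | ite _ _ _ h₀ h₁ h₂ => exact .ite (h₀ h) (h₁ h) (h₂ h)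
  | mux _ _ _ h₀ h₁ h₂ => exact .mux (h₀ h) (h₁ h) (h₂ h)
  | pair _ _ h₁ h₂ => exact .pair (h₁ h) (h₂ h)
  | psiPair _ _ h₁ h₂ => exact .psiPair (h₁ h) (h₂ h)
  | proj _ h₁ => exact .proj (h₁ h)
  | oinj _ _ h₁ h₂ => exact .oinj (h₁ h) (h₂ h)
  | omatch _ _ _ h₀ h₁ h₂ => exact .omatch (h₀ h) (h₁ (up h)) (h₂ (up h))
  | mtch _ _ h₀ hb => exact .mtch (h₀ h) fun i => hb i (up h)
  | sec _ h₁ => exact .sec (h₁ h)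

theorem rename {G : GCtx} (hG : G.WellTyped) {e e' : Expr} (he : Pared G e e') (ξ : ℕ → ℕ) :
    Pared G (e.rename ξ) (e'.rename ξ) := by
  rw [Expr.rename_eq_subst, Expr.rename_eq_subst]
  refine subst_of hG (R := fun σ σ' => σ = σ' ∧ ∃ ξ, σ = fun x => .var (ξ x)) ?_ ?_ he
    ⟨rfl, ξ, rfl⟩
  · rintro _ _ ⟨rfl, ξ, rfl⟩
    exact ⟨rfl, _, upSub_ren ξ⟩
  · rintro _ _ ⟨rfl, _⟩ x
    exact .refl _

theorem subst {G : GCtx} (hG : G.WellTyped) {e e' : Expr} (he : Pared G e e') {σ σ' : ℕ → Expr}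
    (h : ∀ x, Pared G (σ x) (σ' x)) : Pared G (e.subst σ) (e'.subst σ') := by
  refine subst_of hG (R := fun σ σ' => ∀ x, Pared G (σ x) (σ' x)) ?_ (fun h => h) he h
  intro σ σ' h x
  cases x
  · exact .refl _
  · exact (h _).rename hG _

theorem inst {G : GCtx} (hG : G.WellTyped) {e e' a a' : Expr} (he : Pared G e e')
    (ha : Pared G a a') : Pared G (e.inst a) (e'.inst a') := by
  rw [Expr.inst_eq, Expr.inst_eq]
  refine he.subst hG fun x => ?_
  cases x
  · exact ha
  · exact .refl _

/-! ## Confluence -/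

theorem lam_inv {G : GCtx} {τ e x : Expr} (h : Pared G (.lam τ e) x) :
    ∃ τ' e', x = .lam τ' e' ∧ Pared G τ τ' ∧ Pared G e e' := by
  cases h with
  | refl => exact ⟨_, _, rfl, .refl _, .refl _⟩
  | lam h₁ h₂ => exact ⟨_, _, rfl, h₁, h₂⟩

theorem ctor_inv {G : GCtx} {T : Name} {i : ℕ} {e x : Expr} (h : Pared G (.ctor T i e) x) :
    ∃ e', x = .ctor T i e' ∧ Pared G e e' := by
  cases h with
  | refl => exact ⟨_, rfl, .refl _⟩
  | ctor h => exact ⟨_, rfl, h⟩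

theorem pair_inv {G : GCtx} {e₁ e₂ x : Expr} (h : Pared G (.pair e₁ e₂) x) :
    ∃ e₁' e₂', x = .pair e₁' e₂' ∧ Pared G e₁ e₁' ∧ Pared G e₂ e₂' := by
  cases h with
  | refl => exact ⟨_, _, rfl, .refl _, .refl _⟩
  | pair h₁ h₂ => exact ⟨_, _, rfl, h₁, h₂⟩

theorem psiPair_inv {G : GCtx} {e₁ e₂ x : Expr} (h : Pared G (.psiPair e₁ e₂) x) :
    ∃ e₁' e₂', x = .psiPair e₁' e₂' ∧ Pared G e₁ e₁' ∧ Pared G e₂ e₂' := by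
  cases h with
  | refl => exact ⟨_, _, rfl, .refl _, .refl _⟩
  | psiPair h₁ h₂ => exact ⟨_, _, rfl, h₁, h₂⟩

theorem prodTy_inv {G : GCtx} {τ₁ τ₂ x : Expr} (h : Pared G (.prodTy τ₁ τ₂) x) :
    ∃ τ₁' τ₂', x = .prodTy τ₁' τ₂' ∧ Pared G τ₁ τ₁' ∧ Pared G τ₂ τ₂' := by
  cases h with
  | refl => exact ⟨_, _, rfl, .refl _, .refl _⟩
  | prodTy h₁ h₂ => exact ⟨_, _, rfl, h₁, h₂⟩

theorem osumTy_inv {G : GCtx} {τ₁ τ₂ x : Expr} (h : Pared G (.osumTy τ₁ τ₂) x) :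
    ∃ τ₁' τ₂', x = .osumTy τ₁' τ₂' ∧ Pared G τ₁ τ₁' ∧ Pared G τ₂ τ₂' := by
  cases h with
  | refl => exact ⟨_, _, rfl, .refl _, .refl _⟩
  | osumTy h₁ h₂ => exact ⟨_, _, rfl, h₁, h₂⟩

theorem pi_inv {G : GCtx} {τ₁ τ₂ x : Expr} (h : Pared G (.pi τ₁ τ₂) x) :
    ∃ τ₁' τ₂', x = .pi τ₁' τ₂' ∧ Pared G τ₁ τ₁' ∧ Pared G τ₂ τ₂' := by
  cases h with
  | refl => exact ⟨_, _, rfl, .refl _, .refl _⟩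
  | pi h₁ h₂ => exact ⟨_, _, rfl, h₁, h₂⟩

theorem oty_inv {G : GCtx} {ω : OTy} {x : Expr} (h : Pared G ω.toExpr x) : x = ω.toExpr := by
  induction ω generalizing x with
  | unit => cases h; rfl
  | obool => cases h; rfl
  | prod _ _ h₁ h₂ =>
    obtain ⟨_, _, rfl, h₁', h₂'⟩ := prodTy_inv h
    rw [h₁ h₁', h₂ h₂']; rfl
  | sum _ _ h₁ h₂ =>
    obtain ⟨_, _, rfl, h₁', h₂'⟩ := osumTy_inv h
    rw [h₁ h₁', h₂ h₂']; rfl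

theorem oval_inv {G : GCtx} {v : OVal} {x : Expr} (h : Pared G v.toExpr x) : x = v.toExpr := by
  induction v generalizing x with
  | unit => cases h; rfl
  | lit => cases h; rfl
  | pair _ _ h₁ h₂ =>
    obtain ⟨_, _, rfl, h₁', h₂'⟩ := pair_inv h
    rw [h₁ h₁', h₂ h₂']; rfl
  | inj => cases h; rfl

theorem cond {G : GCtx} {c : Bool} {e₁ e₁' e₂ e₂' : Expr} (h₁ : Pared G e₁ e₁')
    (h₂ : Pared G e₂ e₂') : Pared G (if c then e₁ else e₂) (if c then e₁' else e₂') := by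
  cases c <;> assumption

/-- The branch of the oblivious match that agrees with the tag survives, whatever oblivious value
is chosen for the other branch. -/
theorem omatch_join {G : GCtx} (hG : G.WellTyped) {b : Bool} {v v₁ v₂ e₁ e₁' e₂ e₂' : Expr}
    (h₁ : Pared G e₁ e₁') (h₂ : Pared G e₂ e₂') :
    Pared G (.mux (.boxLit b)
        (if b then e₁.inst v else e₁.inst v₁) (if b then e₂.inst v₂ else e₂.inst v))
      (if b then e₁'.inst v else e₂'.inst v) := by
  cases b
  · exact .muxBeta (b := false) (e₁' := e₁.inst v₁) (.refl _) (h₂.inst hG (.refl _))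
  · exact .muxBeta (b := true) (e₂' := e₂.inst v₂) (h₁.inst hG (.refl _)) (.refl _)

theorem diamond {G : GCtx} (hG : G.WellTyped) {e a b : Expr} (ha : Pared G e a)
    (hb : Pared G e b) : ∃ c, Pared G a c ∧ Pared G b c := by
  induction ha generalizing b with
  | refl => exact ⟨_, hb, .refl _⟩
  | fn hf =>
    cases hb with
    | refl => exact ⟨_, .refl _, .fn hf⟩
    | fn hf' => cases hf.symm.trans hf'; exact ⟨_, .refl _, .refl _⟩
  | oadt hO h₁ i₁ =>
    cases hb with
    | refl => exact ⟨_, .refl _, .oadt hO h₁⟩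
    | oadt hO' h₁' =>
      cases hO.symm.trans hO'
      obtain ⟨_, j, j'⟩ := i₁ h₁'
      exact ⟨_, (Pared.refl _).inst hG j, (Pared.refl _).inst hG j'⟩
    | oapp h₁' =>
      obtain ⟨_, j, j'⟩ := i₁ h₁'
      exact ⟨_, (Pared.refl _).inst hG j, .oadt hO j'⟩
  | beta h₁ h₂ i₁ i₂ =>
    cases hb with
    | refl => exact ⟨_, .refl _, .beta h₁ h₂⟩
    | beta h₁' h₂' =>
      obtain ⟨⟨_, j₁, j₁'⟩, _, j₂, j₂'⟩ := And.intro (i₁ h₁') (i₂ h₂')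
      exact ⟨_, j₁.inst hG j₂, j₁'.inst hG j₂'⟩
    | app h₁' h₂' =>
      obtain ⟨_, _, rfl, -, h₁'⟩ := h₁'.lam_inv
      obtain ⟨⟨_, j₁, j₁'⟩, _, j₂, j₂'⟩ := And.intro (i₁ h₁') (i₂ h₂')
      exact ⟨_, j₁.inst hG j₂, .beta j₁' j₂'⟩
  | letBeta h₁ h₂ i₁ i₂ =>
    cases hb with
    | refl => exact ⟨_, .refl _, .letBeta h₁ h₂⟩
    | letBeta h₁' h₂' =>
      obtain ⟨⟨_, j₁, j₁'⟩, _, j₂, j₂'⟩ := And.intro (i₁ h₁') (i₂ h₂')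
      exact ⟨_, j₂.inst hG j₁, j₂'.inst hG j₁'⟩
    | letIn h₁' h₂' =>
      obtain ⟨⟨_, j₁, j₁'⟩, _, j₂, j₂'⟩ := And.intro (i₁ h₁') (i₂ h₂')
      exact ⟨_, j₂.inst hG j₁, .letBeta j₁' j₂'⟩
  | iteBeta h₁ h₂ i₁ i₂ =>
    cases hb with
    | refl => exact ⟨_, .refl _, .iteBeta h₁ h₂⟩
    | iteBeta h₁' h₂' =>
      obtain ⟨⟨_, j₁, j₁'⟩, _, j₂, j₂'⟩ := And.intro (i₁ h₁') (i₂ h₂')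
      exact ⟨_, j₁.cond j₂, j₁'.cond j₂'⟩
    | ite h₀' h₁' h₂' =>
      cases h₀'
      obtain ⟨⟨_, j₁, j₁'⟩, _, j₂, j₂'⟩ := And.intro (i₁ h₁') (i₂ h₂')
      exact ⟨_, j₁.cond j₂, .iteBeta j₁' j₂'⟩
  | muxBeta h₁ h₂ i₁ i₂ =>
    cases hb with
    | refl => exact ⟨_, .refl _, .muxBeta h₁ h₂⟩
    | muxBeta h₁' h₂' =>
      obtain ⟨⟨_, j₁, j₁'⟩, _, j₂, j₂'⟩ := And.intro (i₁ h₁') (i₂ h₂')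
      exact ⟨_, j₁.cond j₂, j₁'.cond j₂'⟩
    | mux h₀' h₁' h₂' =>
      cases h₀'
      obtain ⟨⟨_, j₁, j₁'⟩, _, j₂, j₂'⟩ := And.intro (i₁ h₁') (i₂ h₂')
      exact ⟨_, j₁.cond j₂, .muxBeta j₁' j₂'⟩
  | projBeta h₁ h₂ i₁ i₂ =>
    cases hb with
    | refl => exact ⟨_, .refl _, .projBeta h₁ h₂⟩
    | projBeta h₁' h₂' =>
      obtain ⟨⟨_, j₁, j₁'⟩, _, j₂, j₂'⟩ := And.intro (i₁ h₁') (i₂ h₂')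
      exact ⟨_, j₁.cond j₂, j₁'.cond j₂'⟩
    | proj h₀' =>
      obtain ⟨_, _, rfl, h₁', h₂'⟩ := h₀'.pair_inv
      obtain ⟨⟨_, j₁, j₁'⟩, _, j₂, j₂'⟩ := And.intro (i₁ h₁') (i₂ h₂')
      exact ⟨_, j₁.cond j₂, .projBeta j₁' j₂'⟩
  | psiProjBeta h₁ h₂ i₁ i₂ =>
    cases hb with
    | refl => exact ⟨_, .refl _, .psiProjBeta h₁ h₂⟩
    | psiProjBeta h₁' h₂' =>
      obtain ⟨⟨_, j₁, j₁'⟩, _, j₂, j₂'⟩ := And.intro (i₁ h₁') (i₂ h₂')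
      exact ⟨_, j₁.cond j₂, j₁'.cond j₂'⟩
    | proj h₀' =>
      obtain ⟨_, _, rfl, h₁', h₂'⟩ := h₀'.psiPair_inv
      obtain ⟨⟨_, j₁, j₁'⟩, _, j₂, j₂'⟩ := And.intro (i₁ h₁') (i₂ h₂')
      exact ⟨_, j₁.cond j₂, .psiProjBeta j₁' j₂'⟩
  | mtchBeta i h₁ h₂ i₁ i₂ =>
    generalize hi : (i : ℕ) = n at hb
    cases hb with
    | refl => subst hi; exact ⟨_, .refl _, .mtchBeta i h₁ h₂⟩
    | mtchBeta i' h₁' h₂' =>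
      cases Fin.ext hi
      obtain ⟨⟨_, j₁, j₁'⟩, _, j₂, j₂'⟩ := And.intro (i₁ h₁') (i₂ h₂')
      exact ⟨_, j₂.inst hG j₁, j₂'.inst hG j₁'⟩
    | mtch h₀' hb' =>
      subst hi
      obtain ⟨_, rfl, h₁'⟩ := h₀'.ctor_inv
      obtain ⟨⟨_, j₁, j₁'⟩, _, j₂, j₂'⟩ := And.intro (i₁ h₁') (i₂ (hb' i))
      exact ⟨_, j₂.inst hG j₁, .mtchBeta i j₁' j₂'⟩
  | secBeta =>
    cases hb with
    | refl => exact ⟨_, .refl _, .secBeta⟩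
    | secBeta => exact ⟨_, .refl _, .refl _⟩
    | sec h => cases h; exact ⟨_, .refl _, .secBeta⟩
  | @oinjBeta b ω v =>
    generalize hω : ω.toExpr = τ at hb
    generalize hv : v.toExpr = e at hb
    cases hb with
    | refl => subst hω hv; exact ⟨_, .refl _, .oinjBeta⟩
    | oinjBeta =>
      cases OTy.toExpr_injective hω
      cases OVal.toExpr_injective hv
      exact ⟨_, .refl _, .refl _⟩
    | oinj h₁ h₂ =>
      subst hω hv
      rw [h₁.oty_inv, h₂.oval_inv]
      exact ⟨_, .refl _, .oinjBeta⟩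
  | omatchBeta hv₁ hv₂ h₁ h₂ i₁ i₂ =>
    cases hb with
    | refl => exact ⟨_, .refl _, .omatchBeta hv₁ hv₂ h₁ h₂⟩
    | omatchBeta _ _ h₁' h₂' =>
      obtain ⟨⟨_, j₁, j₁'⟩, _, j₂, j₂'⟩ := And.intro (i₁ h₁') (i₂ h₂')
      exact ⟨_, omatch_join hG j₁ j₂, omatch_join hG j₁' j₂'⟩
    | omatch h₀' h₁' h₂' =>
      cases h₀'
      obtain ⟨⟨_, j₁, j₁'⟩, _, j₂, j₂'⟩ := And.intro (i₁ h₁') (i₂ h₂')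
      exact ⟨_, .mux (.refl _) (cond (j₁.inst hG (.refl _)) (j₁.inst hG (.refl _)))
        (cond (j₂.inst hG (.refl _)) (j₂.inst hG (.refl _))), .omatchBeta hv₁ hv₂ j₁' j₂'⟩
  | prodTy h₁ h₂ i₁ i₂ =>
    obtain ⟨_, _, rfl, h₁', h₂'⟩ := hb.prodTy_inv
    obtain ⟨⟨_, j₁, j₁'⟩, _, j₂, j₂'⟩ := And.intro (i₁ h₁') (i₂ h₂')
    exact ⟨_, .prodTy j₁ j₂, .prodTy j₁' j₂'⟩
  | osumTy h₁ h₂ i₁ i₂ =>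
    obtain ⟨_, _, rfl, h₁', h₂'⟩ := hb.osumTy_inv
    obtain ⟨⟨_, j₁, j₁'⟩, _, j₂, j₂'⟩ := And.intro (i₁ h₁') (i₂ h₂')
    exact ⟨_, .osumTy j₁ j₂, .osumTy j₁' j₂'⟩
  | pi h₁ h₂ i₁ i₂ =>
    obtain ⟨_, _, rfl, h₁', h₂'⟩ := hb.pi_inv
    obtain ⟨⟨_, j₁, j₁'⟩, _, j₂, j₂'⟩ := And.intro (i₁ h₁') (i₂ h₂')
    exact ⟨_, .pi j₁ j₂, .pi j₁' j₂'⟩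
  | lam h₁ h₂ i₁ i₂ =>
    obtain ⟨_, _, rfl, h₁', h₂'⟩ := hb.lam_inv
    obtain ⟨⟨_, j₁, j₁'⟩, _, j₂, j₂'⟩ := And.intro (i₁ h₁') (i₂ h₂')
    exact ⟨_, .lam j₁ j₂, .lam j₁' j₂'⟩
  | pair h₁ h₂ i₁ i₂ =>
    obtain ⟨_, _, rfl, h₁', h₂'⟩ := hb.pair_inv
    obtain ⟨⟨_, j₁, j₁'⟩, _, j₂, j₂'⟩ := And.intro (i₁ h₁') (i₂ h₂')
    exact ⟨_, .pair j₁ j₂, .pair j₁' j₂'⟩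
  | psiPair h₁ h₂ i₁ i₂ =>
    obtain ⟨_, _, rfl, h₁', h₂'⟩ := hb.psiPair_inv
    obtain ⟨⟨_, j₁, j₁'⟩, _, j₂, j₂'⟩ := And.intro (i₁ h₁') (i₂ h₂')
    exact ⟨_, .psiPair j₁ j₂, .psiPair j₁' j₂'⟩
  | ctor h₁ i₁ =>
    obtain ⟨_, rfl, h₁'⟩ := hb.ctor_inv
    obtain ⟨_, j₁, j₁'⟩ := i₁ h₁'
    exact ⟨_, .ctor j₁, .ctor j₁'⟩
  | letIn h₁ h₂ i₁ i₂ =>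
    cases hb with
    | refl => exact ⟨_, .refl _, .letIn h₁ h₂⟩
    | letBeta h₁' h₂' =>
      obtain ⟨⟨_, j₁, j₁'⟩, _, j₂, j₂'⟩ := And.intro (i₁ h₁') (i₂ h₂')
      exact ⟨_, .letBeta j₁ j₂, j₂'.inst hG j₁'⟩
    | letIn h₁' h₂' =>
      obtain ⟨⟨_, j₁, j₁'⟩, _, j₂, j₂'⟩ := And.intro (i₁ h₁') (i₂ h₂')
      exact ⟨_, .letIn j₁ j₂, .letIn j₁' j₂'⟩
  | app h₁ h₂ i₁ i₂ =>
    cases hb with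
    | refl => exact ⟨_, .refl _, .app h₁ h₂⟩
    | beta h₁' h₂' =>
      obtain ⟨_, _, rfl, -, -⟩ := h₁.lam_inv
      obtain ⟨⟨_, j₁, j₁'⟩, _, j₂, j₂'⟩ := And.intro (i₁ (.lam (.refl _) h₁')) (i₂ h₂')
      obtain ⟨_, _, rfl, -, j₁⟩ := j₁.lam_inv
      obtain ⟨_, _, h, -, j₁'⟩ := j₁'.lam_inv
      cases h
      exact ⟨_, .beta j₁ j₂, j₁'.inst hG j₂'⟩
    | app h₁' h₂' =>
      obtain ⟨⟨_, j₁, j₁'⟩, _, j₂, j₂'⟩ := And.intro (i₁ h₁') (i₂ h₂')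
      exact ⟨_, .app j₁ j₂, .app j₁' j₂'⟩
  | oapp h₁ i₁ =>
    cases hb with
    | refl => exact ⟨_, .refl _, .oapp h₁⟩
    | oadt hO h₁' =>
      obtain ⟨_, j₁, j₁'⟩ := i₁ h₁'
      exact ⟨_, .oadt hO j₁, (Pared.refl _).inst hG j₁'⟩
    | oapp h₁' =>
      obtain ⟨_, j₁, j₁'⟩ := i₁ h₁'
      exact ⟨_, .oapp j₁, .oapp j₁'⟩
  | ite h₀ h₁ h₂ i₀ i₁ i₂ =>
    cases hb with
    | refl => exact ⟨_, .refl _, .ite h₀ h₁ h₂⟩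
    | iteBeta h₁' h₂' =>
      cases h₀
      obtain ⟨⟨_, j₁, j₁'⟩, _, j₂, j₂'⟩ := And.intro (i₁ h₁') (i₂ h₂')
      exact ⟨_, .iteBeta j₁ j₂, j₁'.cond j₂'⟩
    | ite h₀' h₁' h₂' =>
      obtain ⟨⟨_, j₀, j₀'⟩, ⟨_, j₁, j₁'⟩, _, j₂, j₂'⟩ :=
        And.intro (i₀ h₀') (And.intro (i₁ h₁') (i₂ h₂'))
      exact ⟨_, .ite j₀ j₁ j₂, .ite j₀' j₁' j₂'⟩
  | mux h₀ h₁ h₂ i₀ i₁ i₂ =>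
    cases hb with
    | refl => exact ⟨_, .refl _, .mux h₀ h₁ h₂⟩
    | muxBeta h₁' h₂' =>
      cases h₀
      obtain ⟨⟨_, j₁, j₁'⟩, _, j₂, j₂'⟩ := And.intro (i₁ h₁') (i₂ h₂')
      exact ⟨_, .muxBeta j₁ j₂, j₁'.cond j₂'⟩
    | mux h₀' h₁' h₂' =>
      obtain ⟨⟨_, j₀, j₀'⟩, ⟨_, j₁, j₁'⟩, _, j₂, j₂'⟩ :=
        And.intro (i₀ h₀') (And.intro (i₁ h₁') (i₂ h₂'))
      exact ⟨_, .mux j₀ j₁ j₂, .mux j₀' j₁' j₂'⟩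
  | proj h₀ i₀ =>
    cases hb with
    | refl => exact ⟨_, .refl _, .proj h₀⟩
    | projBeta h₁' h₂' =>
      obtain ⟨_, _, rfl, -, -⟩ := h₀.pair_inv
      obtain ⟨_, j₀, j₀'⟩ := i₀ (.pair h₁' h₂')
      obtain ⟨_, _, rfl, j₁, j₂⟩ := j₀.pair_inv
      obtain ⟨_, _, h, j₁', j₂'⟩ := j₀'.pair_inv
      cases h
      exact ⟨_, .projBeta j₁ j₂, j₁'.cond j₂'⟩
    | psiProjBeta h₁' h₂' =>
      obtain ⟨_, _, rfl, -, -⟩ := h₀.psiPair_inv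
      obtain ⟨_, j₀, j₀'⟩ := i₀ (.psiPair h₁' h₂')
      obtain ⟨_, _, rfl, j₁, j₂⟩ := j₀.psiPair_inv
      obtain ⟨_, _, h, j₁', j₂'⟩ := j₀'.psiPair_inv
      cases h
      exact ⟨_, .psiProjBeta j₁ j₂, j₁'.cond j₂'⟩
    | proj h₀' =>
      obtain ⟨_, j₀, j₀'⟩ := i₀ h₀'
      exact ⟨_, .proj j₀, .proj j₀'⟩
  | @oinj _ τ _ e _ h₁ h₂ i₁ i₂ =>
    generalize hτ : τ = τ₀ at hb
    generalize he : e = e₀ at hb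
    cases hb with
    | refl => subst hτ he; exact ⟨_, .refl _, .oinj h₁ h₂⟩
    | oinjBeta =>
      subst hτ he
      rw [h₁.oty_inv, h₂.oval_inv]
      exact ⟨_, .oinjBeta, .refl _⟩
    | oinj h₁' h₂' =>
      subst hτ he
      obtain ⟨⟨_, j₁, j₁'⟩, _, j₂, j₂'⟩ := And.intro (i₁ h₁') (i₂ h₂')
      exact ⟨_, .oinj j₁ j₂, .oinj j₁' j₂'⟩
  | omatch h₀ h₁ h₂ i₀ i₁ i₂ =>
    cases hb with
    | refl => exact ⟨_, .refl _, .omatch h₀ h₁ h₂⟩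
    | omatchBeta hv₁ hv₂ h₁' h₂' =>
      cases h₀
      obtain ⟨⟨_, j₁, j₁'⟩, _, j₂, j₂'⟩ := And.intro (i₁ h₁') (i₂ h₂')
      exact ⟨_, .omatchBeta hv₁ hv₂ j₁ j₂,
        .mux (.refl _) (cond (j₁'.inst hG (.refl _)) (j₁'.inst hG (.refl _)))
          (cond (j₂'.inst hG (.refl _)) (j₂'.inst hG (.refl _)))⟩
    | omatch h₀' h₁' h₂' =>
      obtain ⟨⟨_, j₀, j₀'⟩, ⟨_, j₁, j₁'⟩, _, j₂, j₂'⟩ :=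
        And.intro (i₀ h₀') (And.intro (i₁ h₁') (i₂ h₂'))
      exact ⟨_, .omatch j₀ j₁ j₂, .omatch j₀' j₁' j₂'⟩
  | mtch h₀ hbr i₀ ibr =>
    cases hb with
    | refl => exact ⟨_, .refl _, .mtch h₀ hbr⟩
    | mtchBeta i h₁' h₂' =>
      obtain ⟨_, rfl, -⟩ := h₀.ctor_inv
      obtain ⟨⟨_, j₀, j₀'⟩, _, j₂, j₂'⟩ := And.intro (i₀ (.ctor h₁')) (ibr i h₂')
      obtain ⟨_, rfl, j₁⟩ := j₀.ctor_inv
      obtain ⟨_, h, j₁'⟩ := j₀'.ctor_inv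
      cases h
      exact ⟨_, .mtchBeta i j₁ j₂, j₂'.inst hG j₁'⟩
    | mtch h₀' hbr' =>
      obtain ⟨_, j₀, j₀'⟩ := i₀ h₀'
      choose c jc jc' using fun i => ibr i (hbr' i)
      exact ⟨_, .mtch j₀ jc, .mtch j₀' jc'⟩
  | sec h₀ i₀ =>
    cases hb with
    | refl => exact ⟨_, .refl _, .sec h₀⟩
    | secBeta => cases h₀; exact ⟨_, .secBeta, .refl _⟩
    | sec h₀' =>
      obtain ⟨_, j₀, j₀'⟩ := i₀ h₀'
      exact ⟨_, .sec j₀, .sec j₀'⟩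

end Pared

end Taypsi

namespace Taypsi

/-! ## Type equivalence -/

namespace TyEquiv

variable {G : GCtx} {a b c : Expr}

theorem refl (a : Expr) : TyEquiv G a a := Relation.EqvGen.refl a

theorem symm (h : TyEquiv G a b) : TyEquiv G b a := Relation.EqvGen.symm _ _ h

theorem trans (h : TyEquiv G a b) (h' : TyEquiv G b c) : TyEquiv G a c :=
  Relation.EqvGen.trans _ _ _ h h'

theorem of_pared (h : Pared G a b) : TyEquiv G a b := Relation.EqvGen.rel _ _ h

theorem of_pareds (h : Relation.ReflTransGen (Pared G) a b) : TyEquiv G a b := by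
  induction h with
  | refl => exact .refl _
  | tail _ h ih => exact ih.trans (of_pared h)

theorem map {f : Expr → Expr} (hf : ∀ a b, Pared G a b → Pared G (f a) (f b))
    (h : TyEquiv G a b) : TyEquiv G (f a) (f b) := by
  induction h with
  | rel _ _ h => exact of_pared (hf _ _ h)
  | refl => exact .refl _
  | symm _ _ _ ih => exact ih.symm
  | trans _ _ _ _ _ ih ih' => exact ih.trans ih'

theorem subst (hG : G.WellTyped) (h : TyEquiv G a b) (σ : ℕ → Expr) :
    TyEquiv G (a.subst σ) (b.subst σ) :=
  h.map (f := (·.subst σ)) fun _ _ h => h.subst hG fun _ => .refl _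

theorem inst_arg (hG : G.WellTyped) (a : Expr) {e e' : Expr} (h : Pared G e e') :
    TyEquiv G (a.inst e) (a.inst e') :=
  of_pared ((Pared.refl _).inst hG h)

/-- Church–Rosser. -/
theorem join (hG : G.WellTyped) (h : TyEquiv G a b) :
    ∃ c, Relation.ReflTransGen (Pared G) a c ∧ Relation.ReflTransGen (Pared G) b c := by
  have confluent {a b c : Expr} : Relation.ReflTransGen (Pared G) a b →
      Relation.ReflTransGen (Pared G) a c → Relation.Join (Relation.ReflTransGen (Pared G)) b c :=
    Relation.church_rosser fun _ _ _ h h' =>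
      let ⟨d, j, j'⟩ := h.diamond hG h'
      ⟨d, .single j, .single j'⟩
  induction h with
  | rel _ _ h => exact ⟨_, .single h, .refl⟩
  | refl => exact ⟨_, .refl, .refl⟩
  | symm _ _ _ ih =>
    obtain ⟨c, h, h'⟩ := ih
    exact ⟨c, h', h⟩
  | trans _ _ _ _ _ ih ih' =>
    obtain ⟨⟨_, h₁, h₂⟩, _, h₃, h₄⟩ := And.intro ih ih'
    obtain ⟨d, h₅, h₆⟩ := confluent h₂ h₃
    exact ⟨d, h₁.trans h₅, h₄.trans h₆⟩

end TyEquiv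

/-- The head of a type in head normal form. -/
inductive TyHead where
  | unit
  | bool
  | obool
  | prod
  | osum
  | pi
  | psi (O : Name)
  | adt (T : Name)

def Expr.tyHead : Expr → Option TyHead
  | .unitTy => some .unit
  | .boolTy => some .bool
  | .oboolTy => some .obool
  | .prodTy _ _ => some .prod
  | .osumTy _ _ => some .osum
  | .pi _ _ => some .pi
  | .psi O => some (.psi O)
  | .adt T => some (.adt T)
  | _ => none

theorem Pared.tyHead {G : GCtx} {a b : Expr} {t : TyHead} (h : Pared G a b)
    (ha : a.tyHead = some t) : b.tyHead = some t := by
  cases h <;> first | exact ha | cases ha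

theorem Pared.tyHead_star {G : GCtx} {a b : Expr} {t : TyHead}
    (h : Relation.ReflTransGen (Pared G) a b) (ha : a.tyHead = some t) : b.tyHead = some t := by
  induction h with
  | refl => exact ha
  | tail _ h ih => exact h.tyHead ih

namespace TyEquiv

variable {G : GCtx}

theorem tyHead {a b : Expr} {t t' : TyHead} (hG : G.WellTyped) (h : TyEquiv G a b)
    (ha : a.tyHead = some t) (hb : b.tyHead = some t') : t = t' := by
  obtain ⟨_, h, h'⟩ := h.join hG
  exact Option.some.inj ((Pared.tyHead_star h ha).symm.trans (Pared.tyHead_star h' hb))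

theorem pi_inj (hG : G.WellTyped) {a b a' b' : Expr} (h : TyEquiv G (.pi a b) (.pi a' b')) :
    TyEquiv G a a' ∧ TyEquiv G b b' := by
  have inv {a b x : Expr} (h : Relation.ReflTransGen (Pared G) (.pi a b) x) :
      ∃ a' b', x = .pi a' b' ∧ TyEquiv G a a' ∧ TyEquiv G b b' := by
    induction h with
    | refl => exact ⟨_, _, rfl, .refl _, .refl _⟩
    | tail _ h ih =>
      obtain ⟨_, _, rfl, h₁, h₂⟩ := ih
      obtain ⟨_, _, rfl, h₁', h₂'⟩ := h.pi_inv
      exact ⟨_, _, rfl, h₁.trans (of_pared h₁'), h₂.trans (of_pared h₂')⟩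
  obtain ⟨_, h, h'⟩ := h.join hG
  obtain ⟨_, _, rfl, h₁, h₂⟩ := inv h
  obtain ⟨_, _, h, h₁', h₂'⟩ := inv h'
  cases h
  exact ⟨h₁.trans h₁'.symm, h₂.trans h₂'.symm⟩

theorem _root_.Taypsi.Pared.prodTy_inv_star {G : GCtx} {a b x : Expr}
    (h : Relation.ReflTransGen (Pared G) (.prodTy a b) x) :
    ∃ a' b', x = .prodTy a' b' ∧ TyEquiv G a a' ∧ TyEquiv G b b' := by
  induction h with
  | refl => exact ⟨_, _, rfl, .refl _, .refl _⟩
  | tail _ h ih =>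
    obtain ⟨_, _, rfl, h₁, h₂⟩ := ih
    obtain ⟨_, _, rfl, h₁', h₂'⟩ := h.prodTy_inv
    exact ⟨_, _, rfl, h₁.trans (of_pared h₁'), h₂.trans (of_pared h₂')⟩

theorem prodTy_inj (hG : G.WellTyped) {a b a' b' : Expr}
    (h : TyEquiv G (.prodTy a b) (.prodTy a' b')) : TyEquiv G a a' ∧ TyEquiv G b b' := by
  obtain ⟨_, h, h'⟩ := h.join hG
  obtain ⟨_, _, rfl, h₁, h₂⟩ := Pared.prodTy_inv_star h
  obtain ⟨_, _, h, h₁', h₂'⟩ := Pared.prodTy_inv_star h'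
  cases h
  exact ⟨h₁.trans h₁'.symm, h₂.trans h₂'.symm⟩

theorem osumTy_inj (hG : G.WellTyped) {a b a' b' : Expr}
    (h : TyEquiv G (.osumTy a b) (.osumTy a' b')) : TyEquiv G a a' ∧ TyEquiv G b b' := by
  have inv {a b x : Expr} (h : Relation.ReflTransGen (Pared G) (.osumTy a b) x) :
      ∃ a' b', x = .osumTy a' b' ∧ TyEquiv G a a' ∧ TyEquiv G b b' := by
    induction h with
    | refl => exact ⟨_, _, rfl, .refl _, .refl _⟩
    | tail _ h ih =>
      obtain ⟨_, _, rfl, h₁, h₂⟩ := ih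
      obtain ⟨_, _, rfl, h₁', h₂'⟩ := h.osumTy_inv
      exact ⟨_, _, rfl, h₁.trans (of_pared h₁'), h₂.trans (of_pared h₂')⟩
  obtain ⟨_, h, h'⟩ := h.join hG
  obtain ⟨_, _, rfl, h₁, h₂⟩ := inv h
  obtain ⟨_, _, h, h₁', h₂'⟩ := inv h'
  cases h
  exact ⟨h₁.trans h₁'.symm, h₂.trans h₂'.symm⟩

theorem psi_inj (hG : G.WellTyped) {O O' : Name} (h : TyEquiv G (.psi O) (.psi O')) : O = O' :=
  TyHead.psi.inj (h.tyHead hG rfl rfl)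

theorem oty_inj (hG : G.WellTyped) {ω ω' : OTy} (h : TyEquiv G ω.toExpr ω'.toExpr) : ω = ω' := by
  have inv {ω : OTy} {x : Expr} (h : Relation.ReflTransGen (Pared G) ω.toExpr x) :
      x = ω.toExpr := by
    induction h with
    | refl => rfl
    | tail _ h ih => subst ih; exact h.oty_inv
  obtain ⟨_, h, h'⟩ := h.join hG
  exact OTy.toExpr_injective ((inv h).symm.trans (inv h'))

end TyEquiv

/-! ## Inversion -/

namespace Kinding

variable {G : GCtx} {m : Mode} {Γ : List Expr}

theorem le_mixed {τ : Expr} {κ : Kind} (h : Kinding G m Γ τ κ) : Kinding G m Γ τ .mixed :=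
  .sub h (.inr (.inr rfl))

theorem pi_inv {τ τ₁ τ₂ : Expr} {κ : Kind} : Kinding G m Γ τ κ → τ = .pi τ₁ τ₂ →
    ∃ κ₁ κ₂, Kinding G m Γ τ₁ κ₁ ∧ Kinding G m (τ₁ :: Γ) τ₂ κ₂
  | .sub h _, e => h.pi_inv e
  | .pi h₁ h₂, e => by cases e; exact ⟨_, _, h₁, h₂⟩

theorem prodTy_inv {τ τ₁ τ₂ : Expr} {κ : Kind} : Kinding G m Γ τ κ → τ = .prodTy τ₁ τ₂ →
    ∃ κ, Kinding G m Γ τ₁ κ ∧ Kinding G m Γ τ₂ κ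
  | .sub h _, e => h.prodTy_inv e
  | .prod h₁ h₂, e => by cases e; exact ⟨_, h₁, h₂⟩

theorem osumTy_inv {τ τ₁ τ₂ : Expr} {κ : Kind} : Kinding G m Γ τ κ → τ = .osumTy τ₁ τ₂ →
    Kinding G m Γ τ₁ .obl ∧ Kinding G m Γ τ₂ .obl
  | .sub h _, e => h.osumTy_inv e
  | .osum h₁ h₂, e => by cases e; exact ⟨h₁, h₂⟩

theorem psi_inv {τ : Expr} {O : Name} {κ : Kind} : Kinding G m Γ τ κ → τ = .psi O →
    ∃ τ body, G O = some (.obliv τ body)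
  | .sub h _, e => h.psi_inv e
  | .psi h, e => by cases e; exact ⟨_, _, h⟩

theorem adt_inv {τ : Expr} {T : Name} {κ : Kind} : Kinding G m Γ τ κ → τ = .adt T →
    ∃ k η, G T = some (.data k η)
  | .sub h _, e => h.adt_inv e
  | .adt h, e => by cases e; exact ⟨_, _, h⟩

theorem oty (ω : OTy) : Kinding G m Γ ω.toExpr .obl := by
  induction ω with
  | unit => exact .sub .unit (.inr (.inl rfl))
  | obool => exact .obool
  | prod _ _ h₁ h₂ => exact .prod h₁ h₂
  | sum _ _ h₁ h₂ => exact .osum h₁ h₂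

end Kinding

/-- What a typing derivation says about the components of an introduction form. -/
def Typing.Inv (G : GCtx) (m : Mode) (Γ : List Expr) : Expr → Expr → Prop
  | .unit, τ => TyEquiv G .unitTy τ
  | .lit _, τ => TyEquiv G .boolTy τ
  | .boxLit _, τ => TyEquiv G .oboolTy τ
  | .boxInj b ω v, τ => OValTy (.inj b ω v) ω ∧ TyEquiv G ω.toExpr τ
  | .pair e₁ e₂, τ => ∃ τ₁ τ₂, Typing G m Γ e₁ τ₁ ∧ Typing G m Γ e₂ τ₂ ∧
      TyEquiv G (.prodTy τ₁ τ₂) τ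
  | .psiPair e₁ e₂, τ => ∃ O τ₁ body, G O = some (.obliv τ₁ body) ∧ Typing G m Γ e₁ τ₁ ∧
      Typing G m Γ e₂ (.oapp O e₁) ∧ TyEquiv G (.psi O) τ
  | .lam τ₁ e, τ => ∃ τ₂ κ, Typing G m (τ₁ :: Γ) e τ₂ ∧ Kinding G m Γ τ₁ κ ∧
      TyEquiv G (.pi τ₁ τ₂) τ
  | .ctor T i e, τ => ∃ (k : ℕ) (η : Fin k → Expr) (j : Fin k), i = j ∧
      G T = some (.data k η) ∧ Typing G m Γ e (η j) ∧ TyEquiv G (.adt T) τ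
  | _, _ => True

theorem Typing.Inv.conv {G : GCtx} {m : Mode} {Γ : List Expr} {e τ τ' : Expr}
    (h : Typing.Inv G m Γ e τ) (hτ : TyEquiv G τ τ') : Typing.Inv G m Γ e τ' := by
  cases e with
  | unit => exact .trans h hτ
  | lit => exact .trans h hτ
  | boxLit => exact .trans h hτ
  | boxInj => exact ⟨h.1, h.2.trans hτ⟩
  | pair =>
    obtain ⟨_, _, h₁, h₂, h⟩ := h
    exact ⟨_, _, h₁, h₂, h.trans hτ⟩
  | psiPair =>
    obtain ⟨_, _, _, hO, h₁, h₂, h⟩ := h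
    exact ⟨_, _, _, hO, h₁, h₂, h.trans hτ⟩
  | lam =>
    obtain ⟨_, _, h₁, h₂, h⟩ := h
    exact ⟨_, _, h₁, h₂, h.trans hτ⟩
  | ctor =>
    obtain ⟨_, _, _, hi, hT, h₁, h⟩ := h
    exact ⟨_, _, _, hi, hT, h₁, h.trans hτ⟩
  | _ => trivial

theorem Typing.inv {G : GCtx} {m : Mode} {Γ : List Expr} {e τ : Expr} :
    Typing G m Γ e τ → Typing.Inv G m Γ e τ
  | .conv h hτ _ => h.inv.conv hτ
  | .unit => .refl _
  | .lit => .refl _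
  | .boxLit => .refl _
  | .boxInj h => ⟨h, .refl _⟩
  | .pair h₁ h₂ => ⟨_, _, h₁, h₂, .refl _⟩
  | .psiPair hO h₁ h₂ => ⟨_, _, _, hO, h₁, h₂, .refl _⟩
  | .abs h₁ h₂ => ⟨_, _, h₁, h₂, .refl _⟩
  | .ctor i hT h => ⟨_, _, i, rfl, hT, h, .refl _⟩
  | .var _ _ => trivial
  | .fn _ _ => trivial
  | .app _ _ => trivial
  | .letIn _ _ => trivial
  | .proj _ => trivial
  | .ite _ _ _ _ => trivial
  | .mtch _ _ _ _ => trivial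
  | .psiProj₁ _ _ => trivial
  | .psiProj₂ _ _ => trivial
  | .mux _ _ _ _ => trivial
  | .oinj _ _ => trivial
  | .omatch _ _ _ _ => trivial
  | .sec _ => trivial

/-! ## Substitution -/

section

variable {G : GCtx} {m : Mode} {R : List Expr → (ℕ → Expr) → List Expr → Prop}

mutual

theorem Kinding.subst_of (hG : G.WellTyped)
    (up : ∀ {Γ σ Δ}, R Γ σ Δ → ∀ τ : Expr, R (τ :: Γ) (upSub σ) (τ.subst σ :: Δ))
    (point : ∀ {Γ σ Δ}, R Γ σ Δ → ∀ (x : ℕ) (τ : Expr) (κ : Kind), Γ[x]? = some τ →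
      Kinding G m Δ ((τ.rename (· + (x + 1))).subst σ) κ →
      Typing G m Δ (σ x) ((τ.rename (· + (x + 1))).subst σ))
    {Γ Δ : List Expr} {σ : ℕ → Expr} {τ : Expr} {κ : Kind} :
    Kinding G m Γ τ κ → R Γ σ Δ → Kinding G m Δ (τ.subst σ) κ
  | .sub h hκ, r => .sub (h.subst_of hG up point r) hκ
  | .unit, _ => .unit
  | .bool, _ => .bool
  | .obool, _ => .obool
  | .adt h, _ => .adt h
  | .oadt hO h, r => .oadt hO <| by
      have h := h.subst_of hG up point r
      rwa [(hG.obliv_closed hO).1.subst] at h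
  | .pi h₁ h₂, r => .pi (h₁.subst_of hG up point r) (h₂.subst_of hG up point (up r _))
  | .prod h₁ h₂, r => .prod (h₁.subst_of hG up point r) (h₂.subst_of hG up point r)
  | .osum h₁ h₂, r => .osum (h₁.subst_of hG up point r) (h₂.subst_of hG up point r)
  | .psi h, _ => .psi h
  | .letIn h₁ h₂, r => .letIn (h₁.subst_of hG up point r) (h₂.subst_of hG up point (up r _))
  | .ite h₀ h₁ h₂, r => .ite (h₀.subst_of hG up point r) (h₁.subst_of hG up point r)
      (h₂.subst_of hG up point r)
  | .mtch hT h₀ h, r => .mtch hT (h₀.subst_of hG up point r) fun i => by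
      have h := (h i).subst_of hG up point (up r _)
      rwa [(hG.data_closed hT i).subst] at h

theorem Typing.subst_of (hG : G.WellTyped)
    (up : ∀ {Γ σ Δ}, R Γ σ Δ → ∀ τ : Expr, R (τ :: Γ) (upSub σ) (τ.subst σ :: Δ))
    (point : ∀ {Γ σ Δ}, R Γ σ Δ → ∀ (x : ℕ) (τ : Expr) (κ : Kind), Γ[x]? = some τ →
      Kinding G m Δ ((τ.rename (· + (x + 1))).subst σ) κ →
      Typing G m Δ (σ x) ((τ.rename (· + (x + 1))).subst σ))
    {Γ Δ : List Expr} {σ : ℕ → Expr} {e τ : Expr} :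
    Typing G m Γ e τ → R Γ σ Δ → Typing G m Δ (e.subst σ) (τ.subst σ)
  | .conv h hτ hκ, r =>
      .conv (h.subst_of hG up point r) (hτ.subst hG σ) (hκ.subst_of hG up point r)
  | .unit, _ => .unit
  | .lit, _ => .lit
  | .var hx hκ, r => point r _ _ _ hx (hκ.subst_of hG up point r)
  | .fn hf hm, _ => by rw [(hG.fn_closed hf).1.subst]; exact .fn hf hm
  | .abs h hκ, r => .abs (h.subst_of hG up point (up r _)) (hκ.subst_of hG up point r)
  | .app h₁ h₂, r => by
      rw [Expr.inst_subst]
      exact .app (h₁.subst_of hG up point r) (h₂.subst_of hG up point r)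
  | .letIn h₁ h₂, r => by
      rw [Expr.inst_subst]
      exact .letIn (h₁.subst_of hG up point r) (h₂.subst_of hG up point (up r _))
  | .pair h₁ h₂, r => .pair (h₁.subst_of hG up point r) (h₂.subst_of hG up point r)
  | .proj h, r => by
      rw [apply_ite (Expr.subst · σ)]
      exact .proj (h.subst_of hG up point r)
  | .ite h₀ h₁ h₂ hκ, r => by
      have h₁ := h₁.subst_of hG up point r
      have h₂ := h₂.subst_of hG up point r
      have hκ := hκ.subst_of hG up point r
      rw [Expr.inst_subst] at h₁ h₂ hκ ⊢
      exact .ite (h₀.subst_of hG up point r) h₁ h₂ hκ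
  | .ctor i hT h, r => .ctor i hT <| by
      have h := h.subst_of hG up point r
      rwa [(hG.data_closed hT i).subst] at h
  | .mtch hT h₀ h hκ, r => by
      have hκ := hκ.subst_of hG up point r
      rw [Expr.inst_subst] at hκ ⊢
      refine .mtch hT (h₀.subst_of hG up point r) (fun i => ?_) hκ
      have h := (h i).subst_of hG up point (up r _)
      rwa [(hG.data_closed hT i).subst, Expr.instCtor_subst] at h
  | .psiPair hO h₁ h₂, r => by
      have h₁ := h₁.subst_of hG up point r
      rw [(hG.obliv_closed hO).1.subst] at h₁
      exact .psiPair hO h₁ (h₂.subst_of hG up point r)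
  | .psiProj₁ hO h, r => by
      rw [(hG.obliv_closed hO).1.subst]
      exact .psiProj₁ hO (h.subst_of hG up point r)
  | .psiProj₂ hO h, r => .psiProj₂ hO (h.subst_of hG up point r)
  | .mux h₀ hκ h₁ h₂, r => .mux (h₀.subst_of hG up point r) (hκ.subst_of hG up point r)
      (h₁.subst_of hG up point r) (h₂.subst_of hG up point r)
  | .oinj h hκ, r => by
      have h := h.subst_of hG up point r
      rw [apply_ite (Expr.subst · σ)] at h
      exact .oinj h (hκ.subst_of hG up point r)
  | .omatch h₀ hκ h₁ h₂, r => by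
      have h₁ := h₁.subst_of hG up point (up r _)
      have h₂ := h₂.subst_of hG up point (up r _)
      rw [Expr.shift_subst_up] at h₁ h₂
      exact .omatch (h₀.subst_of hG up point r) (hκ.subst_of hG up point r) h₁ h₂
  | .sec h, r => .sec (h.subst_of hG up point r)
  | .boxLit, _ => .boxLit
  | .boxInj h, _ => by rw [OTy.toExpr_subst]; exact .boxInj h

end

end

/-- The substitution `σ` replaces `x` by a variable of `Δ` of the same type. -/
def IsVarAt (Γ : List Expr) (σ : ℕ → Expr) (Δ : List Expr) (x : ℕ) : Prop :=
  ∀ τ : Expr, Γ[x]? = some τ → ∃ (y : ℕ) (τ' : Expr), σ x = .var y ∧ Δ[y]? = some τ' ∧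
    τ'.rename (· + (y + 1)) = (τ.rename (· + (x + 1))).subst σ

theorem Expr.rename_succ (τ : Expr) (x : ℕ) :
    τ.rename (· + (x + 1 + 1)) = (τ.rename (· + (x + 1))).shift := by
  rw [Expr.shift, rename_rename]; rfl

theorem IsVarAt.up_zero {Γ Δ : List Expr} {σ : ℕ → Expr} (τ : Expr) :
    IsVarAt (τ :: Γ) (upSub σ) (τ.subst σ :: Δ) 0 := by
  intro _ h
  cases h
  exact ⟨0, _, rfl, rfl, (Expr.shift_subst_up τ σ).symm⟩

theorem IsVarAt.up_succ {Γ Δ : List Expr} {σ : ℕ → Expr} {x : ℕ} (h : IsVarAt Γ σ Δ x)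
    (τ τ' : Expr) : IsVarAt (τ :: Γ) (upSub σ) (τ' :: Δ) (x + 1) := by
  intro τ₀ hτ₀
  obtain ⟨y, τ'', hy, hΔ, hτ⟩ := h τ₀ hτ₀
  refine ⟨y + 1, τ'', ?_, hΔ, ?_⟩
  · simp only [upSub, hy]; rfl
  · rw [Expr.rename_succ, Expr.rename_succ, Expr.shift_subst_up, hτ]

theorem IsVarAt.typing {G : GCtx} {m : Mode} {Γ Δ : List Expr} {σ : ℕ → Expr} {x : ℕ} {τ : Expr}
    {κ : Kind} (h : IsVarAt Γ σ Δ x) (hx : Γ[x]? = some τ)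
    (hκ : Kinding G m Δ ((τ.rename (· + (x + 1))).subst σ) κ) :
    Typing G m Δ (σ x) ((τ.rename (· + (x + 1))).subst σ) := by
  obtain ⟨y, τ', hy, hΔ, hτ⟩ := h τ hx
  rw [← hτ] at hκ ⊢
  rw [hy]
  exact .var hΔ hκ

section

variable {G : GCtx} {m : Mode} {Γ Δ : List Expr} {σ : ℕ → Expr} {e τ : Expr} {κ : Kind}

theorem isVarAt_up (h : ∀ x, IsVarAt Γ σ Δ x) (τ : Expr) (x : ℕ) :
    IsVarAt (τ :: Γ) (upSub σ) (τ.subst σ :: Δ) x := by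
  cases x
  · exact .up_zero τ
  · exact (h _).up_succ _ _

theorem Kinding.renaming (hG : G.WellTyped) (hτ : Kinding G m Γ τ κ)
    (h : ∀ x, IsVarAt Γ σ Δ x) : Kinding G m Δ (τ.subst σ) κ :=
  hτ.subst_of hG (R := fun Γ σ Δ => ∀ x, IsVarAt Γ σ Δ x) isVarAt_up
    (fun h _ _ _ hx hκ => (h _).typing hx hκ) h

theorem Typing.renaming (hG : G.WellTyped) (he : Typing G m Γ e τ)
    (h : ∀ x, IsVarAt Γ σ Δ x) : Typing G m Δ (e.subst σ) (τ.subst σ) :=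
  he.subst_of hG (R := fun Γ σ Δ => ∀ x, IsVarAt Γ σ Δ x) isVarAt_up
    (fun h _ _ _ hx hκ => (h _).typing hx hκ) h

theorem isVarAt_shift (τ : Expr) (x : ℕ) : IsVarAt Γ (fun x => .var (x + 1)) (τ :: Γ) x :=
  fun τ' h => ⟨x + 1, τ', rfl, h, by
    rw [Expr.rename_succ, Expr.shift, Expr.rename_eq_subst _ Nat.succ]⟩

theorem Kinding.shift (hG : G.WellTyped) (hτ : Kinding G m Γ τ κ) (τ' : Expr) :
    Kinding G m (τ' :: Γ) τ.shift κ := by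
  rw [Expr.shift, Expr.rename_eq_subst]
  exact hτ.renaming hG (isVarAt_shift τ')

theorem Typing.shift (hG : G.WellTyped) (he : Typing G m Γ e τ) (τ' : Expr) :
    Typing G m (τ' :: Γ) e.shift τ.shift := by
  rw [Expr.shift, Expr.shift, Expr.rename_eq_subst, Expr.rename_eq_subst]
  exact he.renaming hG (isVarAt_shift τ')

theorem isVarAt_append (x : ℕ) : IsVarAt Γ .var (Γ ++ Δ) x := fun τ h =>
  ⟨x, τ, rfl, by
    rw [List.getElem?_append_left (List.getElem?_eq_some_iff.1 h).1, h], by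
    rw [Expr.subst_id]⟩

theorem Kinding.append (hG : G.WellTyped) (hτ : Kinding G m Γ τ κ) (Δ : List Expr) :
    Kinding G m (Γ ++ Δ) τ κ := by
  simpa using hτ.renaming hG (isVarAt_append (Δ := Δ))

theorem Typing.append (hG : G.WellTyped) (he : Typing G m Γ e τ) (Δ : List Expr) :
    Typing G m (Γ ++ Δ) e τ := by
  simpa using he.renaming hG (isVarAt_append (Δ := Δ))

theorem Kinding.weaken (hG : G.WellTyped) (hτ : Kinding G m [] τ κ) : Kinding G m Γ τ κ :=
  hτ.append hG Γ

theorem Typing.weaken (hG : G.WellTyped) (he : Typing G m [] e τ) : Typing G m Γ e τ :=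
  he.append hG Γ

/-- The substitution `σ` maps the variables of `Γ` to expressions of their types in `Δ`. -/
def SubstTyping (G : GCtx) (m : Mode) (Γ : List Expr) (σ : ℕ → Expr) (Δ : List Expr) : Prop :=
  ∀ x, IsVarAt Γ σ Δ x ∨
    ∀ τ : Expr, Γ[x]? = some τ → Typing G m Δ (σ x) ((τ.rename (· + (x + 1))).subst σ)

theorem SubstTyping.up (hG : G.WellTyped) (h : SubstTyping G m Γ σ Δ) (τ : Expr) :
    SubstTyping G m (τ :: Γ) (upSub σ) (τ.subst σ :: Δ) := by
  intro x
  cases x with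
  | zero => exact .inl (.up_zero τ)
  | succ x =>
    refine (h x).imp (fun h => h.up_succ _ _) fun h τ' hτ' => ?_
    rw [Expr.rename_succ, Expr.shift_subst_up]
    exact (h τ' hτ').shift hG _

theorem Kinding.subst (hG : G.WellTyped) (hτ : Kinding G m Γ τ κ) (h : SubstTyping G m Γ σ Δ) :
    Kinding G m Δ (τ.subst σ) κ :=
  hτ.subst_of hG (R := SubstTyping G m) (fun h τ => h.up hG τ)
    (fun h x τ _ hx hκ => (h x).elim (fun h => h.typing hx hκ) fun h => h τ hx) h

theorem Typing.subst (hG : G.WellTyped) (he : Typing G m Γ e τ) (h : SubstTyping G m Γ σ Δ) :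
    Typing G m Δ (e.subst σ) (τ.subst σ) :=
  he.subst_of hG (R := SubstTyping G m) (fun h τ => h.up hG τ)
    (fun h x τ _ hx hκ => (h x).elim (fun h => h.typing hx hκ) fun h => h τ hx) h

theorem SubstTyping.single {a τ₁ : Expr} (ha : Typing G m Γ a τ₁) :
    SubstTyping G m (τ₁ :: Γ) (scons a .var) Γ := by
  have shift_scons (τ : Expr) : τ.shift.subst (scons a .var) = τ := by
    rw [← Expr.inst_eq, Expr.shift_inst]
  intro x
  cases x with
  | zero =>
    refine .inr fun τ h => ?_
    cases h
    exact (shift_scons τ₁).symm ▸ ha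
  | succ x =>
    refine .inl fun τ h => ⟨x, τ, rfl, h, ?_⟩
    rw [Expr.rename_succ, shift_scons]

theorem Kinding.inst (hG : G.WellTyped) {a τ₁ : Expr} (hτ : Kinding G m (τ₁ :: Γ) τ κ)
    (ha : Typing G m Γ a τ₁) : Kinding G m Γ (τ.inst a) κ := by
  rw [Expr.inst_eq]; exact hτ.subst hG (.single ha)

theorem Typing.inst (hG : G.WellTyped) {a τ₁ : Expr} (he : Typing G m (τ₁ :: Γ) e τ)
    (ha : Typing G m Γ a τ₁) : Typing G m Γ (e.inst a) (τ.inst a) := by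
  rw [Expr.inst_eq, Expr.inst_eq]; exact he.subst hG (.single ha)

theorem SubstTyping.context_conv (hG : G.WellTyped) {τ₁ τ₁' : Expr} {κ₁ κ₁' : Kind}
    (h : TyEquiv G τ₁' τ₁) (h₁ : Kinding G m Γ τ₁ κ₁) (h₁' : Kinding G m Γ τ₁' κ₁') :
    SubstTyping G m (τ₁ :: Γ) .var (τ₁' :: Γ) := by
  intro x
  cases x with
  | zero =>
    refine .inr fun τ hτ => ?_
    cases hτ
    rw [Expr.subst_id]
    refine .conv (.var (Γ := τ₁' :: Γ) (x := 0) rfl (h₁'.shift hG _)) ?_ (h₁.shift hG _)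
    exact h.map fun _ _ h => h.rename hG _
  | succ x =>
    exact .inl fun τ hτ => ⟨x + 1, τ, rfl, hτ, by rw [Expr.subst_id]⟩

theorem Kinding.context_conv (hG : G.WellTyped) {τ₁ τ₁' : Expr} {κ₁ κ₁' : Kind}
    (hτ : Kinding G m (τ₁ :: Γ) τ κ) (h : TyEquiv G τ₁' τ₁) (h₁ : Kinding G m Γ τ₁ κ₁)
    (h₁' : Kinding G m Γ τ₁' κ₁') : Kinding G m (τ₁' :: Γ) τ κ := by
  simpa using hτ.subst hG (.context_conv hG h h₁ h₁')

theorem Typing.context_conv (hG : G.WellTyped) {τ₁ τ₁' : Expr} {κ₁ κ₁' : Kind}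
    (he : Typing G m (τ₁ :: Γ) e τ) (h : TyEquiv G τ₁' τ₁) (h₁ : Kinding G m Γ τ₁ κ₁)
    (h₁' : Kinding G m Γ τ₁' κ₁') : Typing G m (τ₁' :: Γ) e τ := by
  simpa using he.subst hG (.context_conv hG h h₁ h₁')

end

end Taypsi

namespace Taypsi

/-! ## Regularity -/

/-- Types of well-typed expressions are well-kinded. -/
theorem Typing.regular {G : GCtx} (hG : G.WellTyped) {m : Mode} {Γ : List Expr} {e τ : Expr} :
    Typing G m Γ e τ → m = .secure → ∃ κ, Kinding G m Γ τ κ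
  | .conv _ _ hκ, _ => ⟨_, hκ⟩
  | .unit, _ => ⟨_, .unit⟩
  | .lit, _ => ⟨_, .bool⟩
  | .var _ hκ, _ => ⟨_, hκ⟩
  | .fn hf hm, h => by
      subst h
      rcases hm with rfl | hm
      · exact (hG _ _ hf).1.imp fun _ h => h.weaken hG
      · cases hm
  | .abs h hκ, hm =>
      have ⟨_, h⟩ := h.regular hG hm
      ⟨_, .pi hκ h⟩
  | .app h₁ h₂, hm =>
      have ⟨_, h⟩ := h₁.regular hG hm
      have ⟨_, _, _, h⟩ := h.pi_inv rfl
      ⟨_, h.inst hG h₂⟩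
  | .letIn h₁ h₂, hm =>
      have ⟨_, h⟩ := h₂.regular hG hm
      ⟨_, h.inst hG h₁⟩
  | .pair h₁ h₂, hm =>
      have ⟨_, h₁⟩ := h₁.regular hG hm
      have ⟨_, h₂⟩ := h₂.regular hG hm
      ⟨_, .prod h₁.le_mixed h₂.le_mixed⟩
  | .proj (b := b) h, hm => by
      obtain ⟨_, h⟩ := h.regular hG hm
      obtain ⟨_, h₁, h₂⟩ := h.prodTy_inv rfl
      cases b
      · exact ⟨_, h₂⟩
      · exact ⟨_, h₁⟩
  | .ite _ _ _ hκ, _ => ⟨_, hκ⟩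
  | .ctor _ hT _, _ => ⟨_, .adt hT⟩
  | .mtch _ _ _ hκ, _ => ⟨_, hκ⟩
  | .psiPair hO _ _, _ => ⟨_, .psi hO⟩
  | .psiProj₁ hO _, hm => by subst hm; exact ⟨_, (hG _ _ hO).1.weaken hG⟩
  | .psiProj₂ hO h, _ => ⟨_, .oadt hO (.psiProj₁ hO h)⟩
  | .mux _ hκ _ _, _ => ⟨_, hκ⟩
  | .oinj _ hκ, _ => ⟨_, hκ⟩
  | .omatch _ hκ _ _, _ => ⟨_, hκ⟩
  | .sec _, _ => ⟨_, .obool⟩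
  | .boxLit, _ => ⟨_, .obool⟩
  | .boxInj _, _ => ⟨_, .oty _⟩

section

variable {G : GCtx} {Γ : List Expr} {e e₁ e₂ τ τ' τ₁ τ₂ : Expr}

theorem Typing.conv_of (h : Typing G .secure Γ e τ) (hτ : TyEquiv G τ τ')
    (hκ : ∃ κ, Kinding G .secure Γ τ' κ) : Typing G .secure Γ e τ' :=
  have ⟨_, hκ⟩ := hκ
  .conv h hτ hκ

/-! ## Inversion at the intended type -/

theorem Typing.lam_inv (hG : G.WellTyped) (h : Typing G .secure Γ (.lam τ e) (.pi τ₁ τ₂)) :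
    TyEquiv G τ τ₁ ∧ (∃ κ, Kinding G .secure Γ τ κ) ∧ Typing G .secure (τ :: Γ) e τ₂ := by
  obtain ⟨τ₂', κ, hb, hκ, heq⟩ := h.inv
  obtain ⟨h₁, h₂⟩ := heq.pi_inj hG
  obtain ⟨_, hp⟩ := h.regular hG rfl
  obtain ⟨_, _, hp₁, hp₂⟩ := hp.pi_inv rfl
  exact ⟨h₁, ⟨_, hκ⟩, .conv hb h₂ (hp₂.context_conv hG h₁ hp₁ hκ)⟩

/-- A body of a typed abstraction is typed after instantiation. -/
theorem Typing.beta (hG : G.WellTyped) (h : Typing G .secure Γ (.lam τ e) (.pi τ₁ τ₂))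
    (h₁ : Typing G .secure Γ e₁ τ₁) : Typing G .secure Γ (e.inst e₁) (τ₂.inst e₁) := by
  obtain ⟨hτ, hκ, hb⟩ := h.lam_inv hG
  exact hb.inst hG (h₁.conv_of hτ.symm hκ)

theorem Typing.pair_inv (hG : G.WellTyped) (h : Typing G .secure Γ (.pair e₁ e₂) (.prodTy τ₁ τ₂)) :
    Typing G .secure Γ e₁ τ₁ ∧ Typing G .secure Γ e₂ τ₂ := by
  obtain ⟨_, _, h₁, h₂, heq⟩ := h.inv
  obtain ⟨hτ₁, hτ₂⟩ := heq.prodTy_inj hG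
  obtain ⟨_, hκ⟩ := h.regular hG rfl
  obtain ⟨_, hκ₁, hκ₂⟩ := hκ.prodTy_inv rfl
  exact ⟨.conv h₁ hτ₁ hκ₁, .conv h₂ hτ₂ hκ₂⟩

theorem Typing.psiPair_inv (hG : G.WellTyped) {O : Name} {body : Expr}
    (hO : G O = some (.obliv τ body)) (h : Typing G .secure Γ (.psiPair e₁ e₂) (.psi O)) :
    Typing G .secure Γ e₁ τ ∧ Typing G .secure Γ e₂ (.oapp O e₁) := by
  obtain ⟨_, _, _, hO', h₁, h₂, heq⟩ := h.inv
  cases heq.psi_inj hG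
  cases hO.symm.trans hO'
  exact ⟨h₁, h₂⟩

theorem Typing.ctor_inv {T : Name} {k i : ℕ} {η : Fin k → Expr}
    (hT : G T = some (.data k η)) (h : Typing G .secure Γ (.ctor T i e) τ) :
    ∃ j : Fin k, i = j ∧ Typing G .secure Γ e (η j) := by
  obtain ⟨_, _, j, rfl, hT', h, -⟩ := h.inv
  cases hT.symm.trans hT'
  exact ⟨j, rfl, h⟩

theorem OValTy.typing {m : Mode} {v : OVal} {ω : OTy} (h : OValTy v ω) :
    Typing G m Γ v.toExpr ω.toExpr := by
  induction h with
  | unit => exact .unit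
  | lit => exact .boxLit
  | pair _ _ h₁ h₂ => exact .pair h₁ h₂
  | inj h _ => exact .boxInj (.inj h)

theorem OValTy.of_typing (hG : G.WellTyped) {v : OVal} {ω : OTy}
    (h : Typing G .secure Γ v.toExpr ω.toExpr) : OValTy v ω := by
  induction v generalizing ω with
  | unit =>
    cases (TyEquiv.oty_inj hG (ω := .unit) h.inv)
    exact .unit
  | lit b =>
    cases (TyEquiv.oty_inj hG (ω := .obool) h.inv)
    exact .lit b
  | pair v₁ v₂ h₁ h₂ =>
    cases ω with
    | prod ω₁ ω₂ =>
      have ⟨h₁', h₂'⟩ := Typing.pair_inv hG h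
      exact .pair (h₁ h₁') (h₂ h₂')
    | _ =>
      obtain ⟨_, _, -, -, heq⟩ := h.inv
      cases heq.tyHead hG rfl rfl
  | inj b ω' v _ =>
    obtain ⟨hv, heq⟩ := h.inv
    cases heq.oty_inj hG
    exact hv

end

/-! ## Preservation -/

mutual

/-- Parallel reduction preserves kinds. -/
theorem Kinding.pared {G : GCtx} (hG : G.WellTyped) {m : Mode} {Γ : List Expr} {τ : Expr}
    {κ : Kind} : Kinding G m Γ τ κ → m = .secure → ∀ τ', Pared G τ τ' → Kinding G m Γ τ' κ
  | .sub h hκ, hm, τ', p => .sub (h.pared hG hm τ' p) hκ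
  | .unit, _, _, p => by cases p; exact .unit
  | .bool, _, _, p => by cases p; exact .bool
  | .obool, _, _, p => by cases p; exact .obool
  | .adt h, _, _, p => by cases p; exact .adt h
  | .psi h, _, _, p => by cases p; exact .psi h
  | .oadt hO h, hm, _, p => by
      have ih := h.pared hG hm
      subst hm
      cases p with
      | refl => exact .oadt hO h
      | oadt hO' p =>
        cases hO.symm.trans hO'
        exact ((hG _ _ hO).2.append hG Γ).inst hG (ih _ p)
      | oapp p => exact .oadt hO (ih _ p)
  | .pi h₁ h₂, hm, _, p => by
      have ih₁ := h₁.pared hG hm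
      have ih₂ := h₂.pared hG hm
      obtain ⟨_, _, rfl, p₁, p₂⟩ := p.pi_inv
      have h₁' := ih₁ _ p₁
      exact .pi h₁' ((ih₂ _ p₂).context_conv hG (TyEquiv.of_pared p₁).symm h₁ h₁')
  | .prod h₁ h₂, hm, _, p => by
      have ih₁ := h₁.pared hG hm
      have ih₂ := h₂.pared hG hm
      obtain ⟨_, _, rfl, p₁, p₂⟩ := p.prodTy_inv
      exact .prod (ih₁ _ p₁) (ih₂ _ p₂)
  | .osum h₁ h₂, hm, _, p => by
      have ih₁ := h₁.pared hG hm
      have ih₂ := h₂.pared hG hm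
      obtain ⟨_, _, rfl, p₁, p₂⟩ := p.osumTy_inv
      exact .osum (ih₁ _ p₁) (ih₂ _ p₂)
  | .letIn h₁ h₂, hm, _, p => by
      have ih₁ := h₁.pared hG hm
      have ih₂ := h₂.pared hG hm
      cases p with
      | refl => exact .letIn h₁ h₂
      | letBeta p₁ p₂ => exact (ih₂ _ p₂).inst hG (ih₁ _ p₁)
      | letIn p₁ p₂ => exact .letIn (ih₁ _ p₁) (ih₂ _ p₂)
  | .ite h₀ h₁ h₂, hm, _, p => by
      have ih₀ := h₀.pared hG hm
      have ih₁ := h₁.pared hG hm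
      have ih₂ := h₂.pared hG hm
      cases p with
      | refl => exact .ite h₀ h₁ h₂
      | @iteBeta b _ _ _ _ p₁ p₂ =>
        cases b
        · exact ih₂ _ p₂
        · exact ih₁ _ p₁
      | ite p₀ p₁ p₂ => exact .ite (ih₀ _ p₀) (ih₁ _ p₁) (ih₂ _ p₂)
  | .mtch hT h₀ hb, hm, _, p => by
      have ih₀ := h₀.pared hG hm
      have ihb := fun i => (hb i).pared hG hm
      cases p with
      | refl => exact .mtch hT h₀ hb
      | mtchBeta i p₁ p₂ =>
        have h := ih₀ _ (.ctor p₁)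
        subst hm
        obtain ⟨j, hj, h⟩ := h.ctor_inv hT
        cases Fin.ext hj
        exact (ihb i _ p₂).inst hG h
      | mtch p₀ pb => exact .mtch hT (ih₀ _ p₀) fun i => ihb i _ (pb i)

/-- Parallel reduction preserves types. -/
theorem Typing.pared {G : GCtx} (hG : G.WellTyped) {m : Mode} {Γ : List Expr} {e τ : Expr} :
    Typing G m Γ e τ → m = .secure → ∀ e', Pared G e e' → Typing G m Γ e' τ
  | .conv h hτ hκ, hm, e', p => .conv (h.pared hG hm e' p) hτ hκ
  | .unit, _, _, p => by cases p; exact .unit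
  | .lit, _, _, p => by cases p; exact .lit
  | .boxLit, _, _, p => by cases p; exact .boxLit
  | .boxInj h, _, _, p => by cases p; exact .boxInj h
  | .var hx hκ, _, _, p => by cases p; exact .var hx hκ
  | .fn hf hm', hm, _, p => by
      subst hm
      cases p with
      | refl => exact .fn hf hm'
      | fn hf' =>
        cases hf.symm.trans hf'
        rcases hm' with rfl | hm'
        · exact (hG _ _ hf).2.weaken hG
        · cases hm'
  | .abs h hκ, hm, _, p => by
      have ih := h.pared hG hm
      have ihκ := hκ.pared hG hm
      subst hm
      obtain ⟨_, _, rfl, p₁, p₂⟩ := p.lam_inv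
      have hκ' := ihκ _ p₁
      refine .conv_of (.abs ((ih _ p₂).context_conv hG (TyEquiv.of_pared p₁).symm hκ hκ') hκ')
        ?_ ((Typing.abs h hκ).regular hG rfl)
      exact (TyEquiv.of_pared (.pi p₁ (.refl _))).symm
  | .app h₂ h₁, hm, _, p => by
      have ih₁ := h₁.pared hG hm
      have ih₂ := h₂.pared hG hm
      subst hm
      have hκ := (Typing.app h₂ h₁).regular hG rfl
      cases p with
      | refl => exact .app h₂ h₁
      | beta p₁ p₂ =>
        exact .conv_of ((ih₂ _ (.lam (.refl _) p₁)).beta hG (ih₁ _ p₂))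
          (TyEquiv.inst_arg hG _ p₂).symm hκ
      | app p₁ p₂ =>
        exact .conv_of (.app (ih₂ _ p₁) (ih₁ _ p₂)) (TyEquiv.inst_arg hG _ p₂).symm hκ
  | .letIn h₁ h₂, hm, _, p => by
      have ih₁ := h₁.pared hG hm
      have ih₂ := h₂.pared hG hm
      subst hm
      have hκ := (Typing.letIn h₁ h₂).regular hG rfl
      cases p with
      | refl => exact .letIn h₁ h₂
      | letBeta p₁ p₂ =>
        exact .conv_of ((ih₂ _ p₂).inst hG (ih₁ _ p₁)) (TyEquiv.inst_arg hG _ p₁).symm hκ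
      | letIn p₁ p₂ =>
        exact .conv_of (.letIn (ih₁ _ p₁) (ih₂ _ p₂)) (TyEquiv.inst_arg hG _ p₁).symm hκ
  | .pair h₁ h₂, hm, _, p => by
      have ih₁ := h₁.pared hG hm
      have ih₂ := h₂.pared hG hm
      obtain ⟨_, _, rfl, p₁, p₂⟩ := p.pair_inv
      exact .pair (ih₁ _ p₁) (ih₂ _ p₂)
  | .proj (b := b) h, hm, _, p => by
      have ih := h.pared hG hm
      subst hm
      cases p with
      | refl => exact .proj h
      | projBeta p₁ p₂ =>
        obtain ⟨h₁, h₂⟩ := (ih _ (.pair p₁ p₂)).pair_inv hG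
        cases b
        · exact h₂
        · exact h₁
      | psiProjBeta p₁ p₂ =>
        obtain ⟨_, _, _, _, _, _, heq⟩ := h.inv
        cases heq.tyHead hG rfl rfl
      | proj p => exact .proj (ih _ p)
  | .ite h₀ h₁ h₂ hκ, hm, _, p => by
      have ih₀ := h₀.pared hG hm
      have ih₁ := h₁.pared hG hm
      have ih₂ := h₂.pared hG hm
      have ihκ := hκ.pared hG hm
      cases p with
      | refl => exact .ite h₀ h₁ h₂ hκ
      | @iteBeta b _ _ _ _ p₁ p₂ =>
        cases b
        · exact ih₂ _ p₂
        · exact ih₁ _ p₁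
      | ite p₀ p₁ p₂ =>
        exact .conv (.ite (ih₀ _ p₀) (ih₁ _ p₁) (ih₂ _ p₂) (ihκ _ ((Pared.refl _).inst hG p₀)))
          (TyEquiv.inst_arg hG _ p₀).symm hκ
  | .ctor i hT h, hm, _, p => by
      have ih := h.pared hG hm
      obtain ⟨_, rfl, p'⟩ := p.ctor_inv
      exact .ctor i hT (ih _ p')
  | .mtch (τ' := τ') hT h₀ hb hκ, hm, _, p => by
      have ih₀ := h₀.pared hG hm
      have ihb := fun i => (hb i).pared hG hm
      have ihκ := hκ.pared hG hm
      cases p with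
      | refl => exact .mtch hT h₀ hb hκ
      | mtchBeta i p₁ p₂ =>
        have h := ih₀ _ (.ctor p₁)
        subst hm
        obtain ⟨j, hj, h⟩ := h.ctor_inv hT
        cases Fin.ext hj
        have h := (ihb i _ p₂).inst hG h
        rw [Expr.instCtor_inst] at h
        exact .conv h (TyEquiv.inst_arg hG _ (.ctor p₁)).symm hκ
      | mtch p₀ pb =>
        exact .conv (.mtch hT (ih₀ _ p₀) (fun i => ihb i _ (pb i))
          (ihκ _ ((Pared.refl _).inst hG p₀))) (TyEquiv.inst_arg hG _ p₀).symm hκ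
  | .psiPair hO h₁ h₂, hm, _, p => by
      have ih₁ := h₁.pared hG hm
      have ih₂ := h₂.pared hG hm
      obtain ⟨_, _, rfl, p₁, p₂⟩ := p.psiPair_inv
      have h₁' := ih₁ _ p₁
      exact .psiPair hO h₁' (.conv (ih₂ _ p₂) (.of_pared (.oapp p₁)) (.oadt hO h₁'))
  | .psiProj₁ hO h, hm, _, p => by
      have ih := h.pared hG hm
      subst hm
      generalize hb : true = b at p
      cases p with
      | refl => subst hb; exact .psiProj₁ hO h
      | projBeta p₁ p₂ =>
        obtain ⟨_, _, _, _, heq⟩ := h.inv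
        cases heq.tyHead hG rfl rfl
      | psiProjBeta p₁ p₂ =>
        subst hb
        exact ((ih _ (.psiPair p₁ p₂)).psiPair_inv hG hO).1
      | proj p => subst hb; exact .psiProj₁ hO (ih _ p)
  | .psiProj₂ hO h, hm, _, p => by
      have ih := h.pared hG hm
      subst hm
      have hκ := (Typing.psiProj₂ hO h).regular hG rfl
      generalize hb : false = b at p
      cases p with
      | refl => subst hb; exact .psiProj₂ hO h
      | projBeta p₁ p₂ =>
        obtain ⟨_, _, _, _, heq⟩ := h.inv
        cases heq.tyHead hG rfl rfl
      | psiProjBeta p₁ p₂ =>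
        subst hb
        refine ((ih _ (.psiPair p₁ p₂)).psiPair_inv hG hO).2.conv_of (.symm ?_) hκ
        exact .of_pared (.oapp (.psiProjBeta (b := true) p₁ p₂))
      | proj p =>
        subst hb
        exact .conv_of (.psiProj₂ hO (ih _ p)) (.symm (.of_pared (.oapp (.proj p)))) hκ
  | .mux h₀ hκ h₁ h₂, hm, _, p => by
      have ih₀ := h₀.pared hG hm
      have ih₁ := h₁.pared hG hm
      have ih₂ := h₂.pared hG hm
      cases p with
      | refl => exact .mux h₀ hκ h₁ h₂
      | @muxBeta b _ _ _ _ p₁ p₂ =>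
        cases b
        · exact ih₂ _ p₂
        · exact ih₁ _ p₁
      | mux p₀ p₁ p₂ => exact .mux (ih₀ _ p₀) hκ (ih₁ _ p₁) (ih₂ _ p₂)
  | .oinj (b := b) (e := e) (τ₁ := τ₁) (τ₂ := τ₂) h hκ, hm, _, p => by
      have ih := h.pared hG hm
      have ihκ := hκ.pared hG hm
      generalize hτ : Expr.osumTy τ₁ τ₂ = τ at p
      cases p with
      | refl => subst hτ; exact .oinj h hκ
      | @oinjBeta _ ω v =>
        subst hm
        cases ω with
        | sum ω₁ ω₂ =>
          cases hτ
          refine .boxInj (ω := .sum ω₁ ω₂) (.inj (.of_typing hG (Γ := Γ) ?_))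
          cases b <;> exact h
        | _ => cases hτ
      | oinj pτ p =>
        subst hτ
        have hκ' := ihκ _ pτ
        have hτ := TyEquiv.of_pared pτ
        obtain ⟨_, _, rfl, p₁, p₂⟩ := pτ.osumTy_inv
        obtain ⟨hκ₁, hκ₂⟩ := hκ'.osumTy_inv rfl
        refine .conv (.oinj ?_ hκ') hτ.symm hκ
        cases b
        · exact .conv (ih _ p) (.of_pared p₂) hκ₂
        · exact .conv (ih _ p) (.of_pared p₁) hκ₁
  | .omatch h₀ hκ h₁ h₂, hm, _, p => by
      have ih₀ := h₀.pared hG hm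
      have ih₁ := h₁.pared hG hm
      have ih₂ := h₂.pared hG hm
      cases p with
      | refl => exact .omatch h₀ hκ h₁ h₂
      | @omatchBeta b ω₁ ω₂ v v₁ v₂ _ _ _ _ hv₁ hv₂ p₁ p₂ =>
        obtain ⟨hv, heq⟩ := h₀.inv
        obtain ⟨heq₁, heq₂⟩ := TyEquiv.osumTy_inj hG heq
        obtain ⟨_, hs⟩ := h₀.regular hG hm
        obtain ⟨hκ₁, hκ₂⟩ := hs.osumTy_inv rfl
        have inst₁ {u : OVal} (hu : OValTy u ω₁) :=
          (ih₁ _ p₁).inst hG (.conv hu.typing heq₁ hκ₁)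
        have inst₂ {u : OVal} (hu : OValTy u ω₂) :=
          (ih₂ _ p₂).inst hG (.conv hu.typing heq₂ hκ₂)
        simp only [Expr.shift_inst] at inst₁ inst₂
        cases hv with
        | inj hv =>
          cases b
          · exact .mux .boxLit hκ (inst₁ hv₁) (inst₂ hv)
          · exact .mux .boxLit hκ (inst₁ hv) (inst₂ hv₂)
      | omatch p₀ p₁ p₂ => exact .omatch (ih₀ _ p₀) hκ (ih₁ _ p₁) (ih₂ _ p₂)
  | .sec h, hm, _, p => by
      have ih := h.pared hG hm
      cases p with
      | refl => exact .sec h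
      | secBeta => exact .boxLit
      | sec p => exact .sec (ih _ p)

end

end Taypsi

namespace Taypsi

/-! ## Small steps -/

theorem Step.pared {G : GCtx} {e e' : Expr} (h : Step G e e') : Pared G e e' := by
  induction h with
  | fn h => exact .fn h
  | oadt h _ => exact .oadt h (.refl _)
  | app _ => exact .beta (.refl _) (.refl _)
  | letIn _ => exact .letBeta (.refl _) (.refl _)
  | ite => exact .iteBeta (.refl _) (.refl _)
  | mux _ _ => exact .muxBeta (.refl _) (.refl _)
  | mtch i _ => exact .mtchBeta i (.refl _) (.refl _)
  | proj _ _ => exact .projBeta (.refl _) (.refl _)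
  | psiProj _ _ => exact .psiProjBeta (.refl _) (.refl _)
  | sec => exact .secBeta
  | oinj => exact .oinjBeta
  | omatch h₁ h₂ => exact .omatchBeta h₁ h₂ (.refl _) (.refl _)
  | ctx_prodTy₁ _ ih => exact .prodTy ih (.refl _)
  | ctx_prodTy₂ _ ih => exact .prodTy (.refl _) ih
  | ctx_osumTy₁ _ ih => exact .osumTy ih (.refl _)
  | ctx_osumTy₂ _ ih => exact .osumTy (.refl _) ih
  | ctx_letIn _ ih => exact .letIn ih (.refl _)
  | ctx_app₂ _ ih => exact .app (.refl _) ih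
  | ctx_app₁ _ _ ih => exact .app ih (.refl _)
  | ctx_ctor _ ih => exact .ctor ih
  | ctx_oapp _ ih => exact .oapp ih
  | ctx_ite _ ih => exact .ite ih (.refl _) (.refl _)
  | ctx_mux₀ _ ih => exact .mux ih (.refl _) (.refl _)
  | ctx_mux₁ _ _ ih => exact .mux (.refl _) ih (.refl _)
  | ctx_mux₂ _ _ _ ih => exact .mux (.refl _) (.refl _) ih
  | ctx_pair₁ _ ih => exact .pair ih (.refl _)
  | ctx_pair₂ _ _ ih => exact .pair (.refl _) ih
  | ctx_psiPair₁ _ ih => exact .psiPair ih (.refl _)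
  | ctx_psiPair₂ _ _ ih => exact .psiPair (.refl _) ih
  | ctx_proj _ ih => exact .proj ih
  | ctx_oinj₁ _ ih => exact .oinj ih (.refl _)
  | ctx_oinj₂ _ ih => exact .oinj (.refl _) ih
  | ctx_omatch _ ih => exact .omatch ih (.refl _) (.refl _)
  | ctx_mtch _ ih => exact .mtch ih fun _ => .refl _
  | ctx_sec _ ih => exact .sec ih

theorem Steps.pareds {G : GCtx} {e e' : Expr} (h : Steps G e e') :
    Relation.ReflTransGen (Pared G) e e' :=
  Relation.ReflTransGen.mono (fun _ _ => Step.pared) _ _ h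

theorem Steps.typing {G : GCtx} (hG : G.WellTyped) {Γ : List Expr} {e e' τ : Expr}
    (h : Steps G e e') (he : Typing G .secure Γ e τ) : Typing G .secure Γ e' τ := by
  induction h with
  | refl => exact he
  | tail _ h ih => exact ih.pared hG rfl _ h.pared

theorem IsVal.not_step {G : GCtx} {v e : Expr} (hv : IsVal v) : ¬ Step G v e := by
  induction hv generalizing e with
  | pair _ _ h₁ h₂ =>
    rintro (_ | _)
    · exact h₁ ‹_›
    · exact h₂ ‹_›
  | psiPair _ _ h₁ h₂ =>
    rintro (_ | _)
    · exact h₁ ‹_›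
    · exact h₂ ‹_›
  | ctor _ h =>
    rintro (_ | _)
    exact h ‹_›
  | _ => rintro (_ | _)

theorem IsVal.steps {G : GCtx} {v e : Expr} (hv : IsVal v) (h : Steps G v e) : e = v := by
  rcases Relation.ReflTransGen.cases_head h with h | ⟨_, h, _⟩
  · exact h.symm
  · exact (hv.not_step h).elim

theorem StepN.steps {G : GCtx} {n : ℕ} {e e' : Expr} (h : StepN G n e e') : Steps G e e' := by
  induction h with
  | zero => exact .refl
  | succ h _ ih => exact .head h ih

theorem IsVal.stepN {G : GCtx} {n : ℕ} {v e : Expr} (hv : IsVal v) (h : StepN G n v e) :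
    n = 0 ∧ e = v := by
  cases h with
  | zero => exact ⟨rfl, rfl⟩
  | succ h _ => exact (hv.not_step h).elim

theorem StepN.trans {G : GCtx} {n m : ℕ} {a b c : Expr} (h : StepN G n a b)
    (h' : StepN G m b c) : StepN G (n + m) a c := by
  induction h with
  | zero => rwa [Nat.zero_add]
  | succ h _ ih => rw [Nat.add_right_comm]; exact .succ h (ih h')

/-! ## Decomposition of evaluations -/

namespace StepN

variable {G : GCtx} {n : ℕ} {v e f e₀ e₁ e₂ u τ : Expr}

theorem app_arg (h : StepN G n (.app f e) v) (hv : IsVal v) :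
    ∃ j l u, j + l = n ∧ IsVal u ∧ StepN G j e u ∧ StepN G l (.app f u) v := by
  generalize hx : Expr.app f e = x at h
  induction h generalizing f e with
  | zero => subst hx; cases hv
  | succ s t ih =>
    subst hx
    cases s with
    | app hu => exact ⟨0, _, _, by omega, hu, .zero _, .succ (.app hu) t⟩
    | ctx_app₂ s =>
      obtain ⟨j, l, u, rfl, hu, h₁, h₂⟩ := ih hv rfl
      exact ⟨j + 1, l, u, by omega, hu, .succ s h₁, h₂⟩
    | ctx_app₁ hu s => exact ⟨0, _, _, by omega, hu, .zero _, .succ (.ctx_app₁ hu s) t⟩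

theorem app_fun (h : StepN G n (.app f u) v) (hu : IsVal u) (hv : IsVal v) :
    ∃ j l w, j + l = n ∧ IsVal w ∧ StepN G j f w ∧ StepN G l (.app w u) v := by
  generalize hx : Expr.app f u = x at h
  induction h generalizing f with
  | zero => subst hx; cases hv
  | succ s t ih =>
    subst hx
    cases s with
    | app hu => exact ⟨0, _, _, by omega, .lam _ _, .zero _, .succ (.app hu) t⟩
    | ctx_app₂ s => exact (hu.not_step s).elim
    | ctx_app₁ _ s =>
      obtain ⟨j, l, w, rfl, hw, h₁, h₂⟩ := ih hv rfl
      exact ⟨j + 1, l, w, by omega, hw, .succ s h₁, h₂⟩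

theorem beta (h : StepN G n (.app (.lam τ e) u) v) (hu : IsVal u) (hv : IsVal v) :
    ∃ l, l + 1 = n ∧ StepN G l (e.inst u) v := by
  cases h with
  | zero => cases hv
  | succ s t =>
    cases s with
    | app _ => exact ⟨_, rfl, t⟩
    | ctx_app₂ s => exact (hu.not_step s).elim
    | ctx_app₁ _ s => exact ((IsVal.lam _ _).not_step s).elim

theorem letIn (h : StepN G n (.letIn e₁ e₂) v) (hv : IsVal v) :
    ∃ j l u, j + l + 1 = n ∧ IsVal u ∧ StepN G j e₁ u ∧ StepN G l (e₂.inst u) v := by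
  generalize hx : Expr.letIn e₁ e₂ = x at h
  induction h generalizing e₁ with
  | zero => subst hx; cases hv
  | succ s t ih =>
    subst hx
    cases s with
    | letIn hu => exact ⟨0, _, _, by omega, hu, .zero _, t⟩
    | ctx_letIn s =>
      obtain ⟨j, l, u, rfl, hu, h₁, h₂⟩ := ih hv rfl
      exact ⟨j + 1, l, u, by omega, hu, .succ s h₁, h₂⟩

theorem pair (h : StepN G n (.pair e₁ e₂) v) (hv : IsVal v) :
    ∃ j l u₁ u₂, j + l = n ∧ v = .pair u₁ u₂ ∧ IsVal u₁ ∧ IsVal u₂ ∧ StepN G j e₁ u₁ ∧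
      StepN G l e₂ u₂ := by
  generalize hx : Expr.pair e₁ e₂ = x at h
  induction h generalizing e₁ e₂ with
  | zero =>
    subst hx
    cases hv with
    | pair h₁ h₂ => exact ⟨0, 0, _, _, rfl, rfl, h₁, h₂, .zero _, .zero _⟩
  | succ s t ih =>
    subst hx
    cases s with
    | ctx_pair₁ s =>
      obtain ⟨j, l, _, _, rfl, rfl, hu₁, hu₂, h₁, h₂⟩ := ih hv rfl
      exact ⟨j + 1, l, _, _, by omega, rfl, hu₁, hu₂, .succ s h₁, h₂⟩
    | ctx_pair₂ hu s =>
      obtain ⟨j, l, _, _, rfl, rfl, hu₁, hu₂, h₁, h₂⟩ := ih hv rfl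
      exact ⟨j, l + 1, _, _, by omega, rfl, hu₁, hu₂, h₁, .succ s h₂⟩

theorem psiPair (h : StepN G n (.psiPair e₁ e₂) v) (hv : IsVal v) :
    ∃ u₁ u₂, v = .psiPair u₁ u₂ ∧ IsVal u₁ ∧ IsVal u₂ ∧ Steps G e₁ u₁ ∧ Steps G e₂ u₂ := by
  generalize hx : Expr.psiPair e₁ e₂ = x at h
  induction h generalizing e₁ e₂ with
  | zero =>
    subst hx
    cases hv with
    | psiPair h₁ h₂ => exact ⟨_, _, rfl, h₁, h₂, .refl, .refl⟩
  | succ s t ih =>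
    subst hx
    cases s with
    | ctx_psiPair₁ s =>
      obtain ⟨_, _, rfl, hu₁, hu₂, h₁, h₂⟩ := ih hv rfl
      exact ⟨_, _, rfl, hu₁, hu₂, .head s h₁, h₂⟩
    | ctx_psiPair₂ hu s =>
      obtain ⟨_, _, rfl, hu₁, hu₂, h₁, h₂⟩ := ih hv rfl
      exact ⟨_, _, rfl, hu₁, hu₂, h₁, .head s h₂⟩

theorem proj {b : Bool} (h : StepN G n (.proj b e) v) (hv : IsVal v) :
    ∃ j u, j + 1 = n ∧ IsVal u ∧ StepN G j e u ∧
      ∃ u₁ u₂, (u = .pair u₁ u₂ ∨ u = .psiPair u₁ u₂) ∧ v = if b then u₁ else u₂ := by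
  generalize hx : Expr.proj b e = x at h
  induction h generalizing e with
  | zero => subst hx; cases hv
  | succ s t ih =>
    subst hx
    cases s with
    | proj h₁ h₂ =>
      obtain ⟨rfl, rfl⟩ := IsVal.stepN (by split <;> assumption) t
      exact ⟨0, _, rfl, .pair h₁ h₂, .zero _, _, _, .inl rfl, rfl⟩
    | psiProj h₁ h₂ =>
      obtain ⟨rfl, rfl⟩ := IsVal.stepN (by split <;> assumption) t
      exact ⟨0, _, rfl, .psiPair h₁ h₂, .zero _, _, _, .inr rfl, rfl⟩
    | ctx_proj s =>
      obtain ⟨j, u, rfl, hu, h, h'⟩ := ih hv rfl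
      exact ⟨j + 1, u, rfl, hu, .succ s h, h'⟩

theorem ite (h : StepN G n (.ite e₀ e₁ e₂) v) (hv : IsVal v) :
    ∃ j l b, j + l + 1 = n ∧ StepN G j e₀ (.lit b) ∧ StepN G l (if b then e₁ else e₂) v := by
  generalize hx : Expr.ite e₀ e₁ e₂ = x at h
  induction h generalizing e₀ with
  | zero => subst hx; cases hv
  | succ s t ih =>
    subst hx
    cases s with
    | ite => exact ⟨0, _, _, by omega, .zero _, t⟩
    | ctx_ite s =>
      obtain ⟨j, l, b, rfl, h₁, h₂⟩ := ih hv rfl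
      exact ⟨j + 1, l, b, by omega, .succ s h₁, h₂⟩

theorem mux (h : StepN G n (.mux e₀ e₁ e₂) v) (hv : IsVal v) :
    ∃ b u₁ u₂, IsVal u₁ ∧ IsVal u₂ ∧ Steps G e₀ (.boxLit b) ∧ Steps G e₁ u₁ ∧ Steps G e₂ u₂ ∧
      v = if b then u₁ else u₂ := by
  generalize hx : Expr.mux e₀ e₁ e₂ = x at h
  induction h generalizing e₀ e₁ e₂ with
  | zero => subst hx; cases hv
  | succ s t ih =>
    subst hx
    cases s with
    | mux h₁ h₂ =>
      obtain ⟨-, rfl⟩ := IsVal.stepN (by split <;> assumption) t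
      exact ⟨_, _, _, h₁, h₂, .refl, .refl, .refl, rfl⟩
    | ctx_mux₀ s =>
      obtain ⟨b, u₁, u₂, hu₁, hu₂, h₀, h₁, h₂, h⟩ := ih hv rfl
      exact ⟨b, u₁, u₂, hu₁, hu₂, .head s h₀, h₁, h₂, h⟩
    | ctx_mux₁ _ s =>
      obtain ⟨b, u₁, u₂, hu₁, hu₂, h₀, h₁, h₂, h⟩ := ih hv rfl
      exact ⟨b, u₁, u₂, hu₁, hu₂, h₀, .head s h₁, h₂, h⟩
    | ctx_mux₂ _ _ s =>
      obtain ⟨b, u₁, u₂, hu₁, hu₂, h₀, h₁, h₂, h⟩ := ih hv rfl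
      exact ⟨b, u₁, u₂, hu₁, hu₂, h₀, h₁, .head s h₂, h⟩

theorem ctor {T : Name} {i : ℕ} (h : StepN G n (.ctor T i e) v) (hv : IsVal v) :
    ∃ u, v = .ctor T i u ∧ IsVal u ∧ StepN G n e u := by
  generalize hx : Expr.ctor T i e = x at h
  induction h generalizing e with
  | zero =>
    subst hx
    cases hv with
    | ctor h => exact ⟨_, rfl, h, .zero _⟩
  | succ s t ih =>
    subst hx
    cases s with
    | ctx_ctor s =>
      obtain ⟨u, rfl, hu, h⟩ := ih hv rfl
      exact ⟨u, rfl, hu, .succ s h⟩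

theorem mtch {T : Name} {k : ℕ} {br : Fin k → Expr} (h : StepN G n (.mtch T k e₀ br) v)
    (hv : IsVal v) : ∃ j l, ∃ (i : Fin k) (u : Expr), j + l + 1 = n ∧ IsVal u ∧
      StepN G j e₀ (.ctor T i u) ∧ StepN G l ((br i).inst u) v := by
  generalize hx : Expr.mtch T k e₀ br = x at h
  induction h generalizing e₀ with
  | zero => subst hx; cases hv
  | succ s t ih =>
    subst hx
    cases s with
    | mtch i hu => exact ⟨0, _, i, _, by omega, hu, .zero _, t⟩
    | ctx_mtch s =>
      obtain ⟨j, l, i, u, rfl, hu, h₁, h₂⟩ := ih hv rfl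
      exact ⟨j + 1, l, i, u, by omega, hu, .succ s h₁, h₂⟩

theorem sec (h : StepN G n (.sec e) v) (hv : IsVal v) :
    ∃ j b, j + 1 = n ∧ StepN G j e (.lit b) ∧ v = .boxLit b := by
  generalize hx : Expr.sec e = x at h
  induction h generalizing e with
  | zero => subst hx; cases hv
  | succ s t ih =>
    subst hx
    cases s with
    | sec =>
      obtain ⟨rfl, rfl⟩ := (IsVal.boxLit _).stepN t
      exact ⟨0, _, rfl, .zero _, rfl⟩
    | ctx_sec s =>
      obtain ⟨j, b, rfl, h, rfl⟩ := ih hv rfl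
      exact ⟨j + 1, b, rfl, .succ s h, rfl⟩

/-- The first of several arguments, the others being values. -/
theorem apps_arg {vs : List Expr} (hvs : ∀ u ∈ vs, IsVal u)
    (h : StepN G n (apps (.app f e) vs) v) (hv : IsVal v) :
    ∃ j l u, j + l = n ∧ IsVal u ∧ StepN G j e u ∧ StepN G l (apps (.app f u) vs) v := by
  induction vs using List.reverseRecOn generalizing n v with
  | nil => exact h.app_arg hv
  | append_singleton vs a ih =>
    have eq (x : Expr) : apps x (vs ++ [a]) = .app (apps x vs) a := by simp [apps]
    rw [eq] at h
    have ha : IsVal a := hvs a (by simp)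
    obtain ⟨j, l, w, rfl, hw, h₁, h₂⟩ := h.app_fun ha hv
    obtain ⟨j, m, u, rfl, hu, h₁, h₃⟩ := ih (fun u hu => hvs u (by simp [hu])) h₁ hw
    refine ⟨j, m + l, u, by omega, hu, h₁, ?_⟩
    rw [eq]
    have lift {m : ℕ} {x y : Expr} (h : StepN G m x y) :
        StepN G m (.app x a) (.app y a) := by
      induction h with
      | zero => exact .zero _
      | succ s _ ih => exact .succ (.ctx_app₁ ha s) ih
    exact (lift h₃).trans h₂

end StepN

/-! ## Reduction under evaluation contexts -/

namespace Steps

variable {G : GCtx} {e e' f f' e₁ e₁' e₂ e₂' u : Expr}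

theorem map {C : Expr → Expr} (hC : ∀ a b, Step G a b → Step G (C a) (C b)) (h : Steps G e e') :
    Steps G (C e) (C e') :=
  Relation.ReflTransGen.lift C hC _ _ h

theorem trans {a b c : Expr} (h : Steps G a b) (h' : Steps G b c) : Steps G a c :=
  Relation.ReflTransGen.trans h h'

theorem app (h₁ : Steps G f f') (h₂ : Steps G e e') (hv : IsVal e') :
    Steps G (.app f e) (.app f' e') :=
  (h₂.map fun _ _ => .ctx_app₂).trans (h₁.map (C := (.app · e')) fun _ _ => .ctx_app₁ hv)

theorem pair (h₁ : Steps G e₁ e₁') (h₂ : Steps G e₂ e₂') (hv : IsVal e₁') :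
    Steps G (.pair e₁ e₂) (.pair e₁' e₂') :=
  (h₁.map (C := (.pair · e₂)) fun _ _ => .ctx_pair₁).trans (h₂.map fun _ _ => .ctx_pair₂ hv)

theorem letIn (h : Steps G e u) (hu : IsVal u) : Steps G (.letIn e e₂) (e₂.inst u) :=
  (h.map (C := (.letIn · e₂)) fun _ _ => .ctx_letIn).tail (.letIn hu)

theorem proj {b : Bool} (h : Steps G e (.pair e₁ e₂)) (h₁ : IsVal e₁) (h₂ : IsVal e₂) :
    Steps G (.proj b e) (if b then e₁ else e₂) :=
  (h.map fun _ _ => .ctx_proj).tail (.proj h₁ h₂)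

theorem ite {b : Bool} (h : Steps G e (.lit b)) :
    Steps G (.ite e e₁ e₂) (if b then e₁ else e₂) :=
  (h.map (C := (.ite · e₁ e₂)) fun _ _ => .ctx_ite).tail .ite

theorem ctor {T : Name} {i : ℕ} (h : Steps G e e') : Steps G (.ctor T i e) (.ctor T i e') :=
  h.map fun _ _ => .ctx_ctor

theorem mtch {T : Name} {k : ℕ} {br : Fin k → Expr} {i : Fin k}
    (h : Steps G e (.ctor T i u)) (hu : IsVal u) :
    Steps G (.mtch T k e br) ((br i).inst u) :=
  (h.map (C := (.mtch T k · br)) fun _ _ => .ctx_mtch).tail (.mtch i hu)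

end Steps

/-! ## Canonical forms -/

/-- The values at types with a given head. -/
def TyHead.HasVal : TyHead → Expr → Prop
  | .unit, v => v = .unit
  | .bool, v => ∃ b, v = .lit b
  | .obool, v => ∃ b, v = .boxLit b
  | .prod, v => ∃ v₁ v₂, v = .pair v₁ v₂ ∧ IsVal v₁ ∧ IsVal v₂
  | .osum, v => ∃ b ω w, v = .boxInj b ω w
  | .pi, v => ∃ τ e, v = .lam τ e
  | .psi _, v => ∃ v₁ v₂, v = .psiPair v₁ v₂ ∧ IsVal v₁ ∧ IsVal v₂
  | .adt T, v => ∃ i w, v = .ctor T i w ∧ IsVal w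

theorem IsVal.head {G : GCtx} {Γ : List Expr} {v τ : Expr} (hv : IsVal v)
    (h : Typing G .secure Γ v τ) :
    ∃ t τ', τ'.tyHead = some t ∧ TyEquiv G τ' τ ∧ t.HasVal v := by
  have hi := h.inv
  cases hv with
  | unit => exact ⟨.unit, .unitTy, rfl, hi, rfl⟩
  | lit => exact ⟨.bool, .boolTy, rfl, hi, _, rfl⟩
  | boxLit => exact ⟨.obool, .oboolTy, rfl, hi, _, rfl⟩
  | boxInj b ω w =>
    obtain ⟨hw, hi⟩ := hi
    cases hw
    exact ⟨.osum, _, rfl, hi, _, _, _, rfl⟩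
  | pair h₁ h₂ =>
    obtain ⟨_, _, -, -, hi⟩ := hi
    exact ⟨.prod, _, rfl, hi, _, _, rfl, h₁, h₂⟩
  | psiPair h₁ h₂ =>
    obtain ⟨_, _, _, -, -, -, hi⟩ := hi
    exact ⟨.psi _, _, rfl, hi, _, _, rfl, h₁, h₂⟩
  | lam =>
    obtain ⟨_, _, -, -, hi⟩ := hi
    exact ⟨.pi, _, rfl, hi, _, _, rfl⟩
  | ctor hw =>
    obtain ⟨_, _, _, -, -, -, hi⟩ := hi
    exact ⟨.adt _, _, rfl, hi, _, _, rfl, hw⟩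

theorem IsVal.canonical {G : GCtx} (hG : G.WellTyped) {Γ : List Expr} {v τ τ' : Expr} {t : TyHead}
    (hv : IsVal v) (h : Typing G .secure Γ v τ) (hτ : TyEquiv G τ τ') (ht : τ'.tyHead = some t) :
    t.HasVal v := by
  obtain ⟨t', _, ht', heq, h⟩ := hv.head h
  cases (heq.trans hτ).tyHead hG ht' ht
  exact h

theorem ValOf.canonical {G : GCtx} (hG : G.WellTyped) {v τ : Expr} {t : TyHead}
    (h : ValOf G v τ) (ht : τ.tyHead = some t) : t.HasVal v :=
  h.1.canonical hG h.2 (.refl _) ht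

theorem ValOf.ctor {G : GCtx} (hG : G.WellTyped) {v : Expr} {T : Name} {k : ℕ}
    {η : Fin k → Expr} (hT : G T = some (.data k η)) (h : ValOf G v (.adt T)) :
    ∃ (i : Fin k) (w : Expr), v = .ctor T i w ∧ ValOf G w (η i) := by
  obtain ⟨_, w, rfl, hw⟩ := h.canonical hG rfl
  obtain ⟨i, rfl, hw'⟩ := h.2.ctor_inv hT
  exact ⟨i, w, rfl, hw, hw'⟩

/-- Types that have the form of an oblivious type. -/
inductive Obliv (G : GCtx) : Expr → Prop
  | unit : Obliv G .unitTy
  | obool : Obliv G .oboolTy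
  | oapp {O τ body} (e) : G O = some (.obliv τ body) → Obliv G (.oapp O e)
  | prod {τ₁ τ₂} : Obliv G τ₁ → Obliv G τ₂ → Obliv G (.prodTy τ₁ τ₂)
  | osum (τ₁ τ₂) : Obliv G (.osumTy τ₁ τ₂)
  | letIn (e) {τ} : Obliv G τ → Obliv G (.letIn e τ)
  | ite (e₀) {τ₁ τ₂} : Obliv G τ₁ → Obliv G τ₂ → Obliv G (.ite e₀ τ₁ τ₂)
  | mtch (T k e₀) {τ : Fin k → Expr} : (∀ i, Obliv G (τ i)) → Obliv G (.mtch T k e₀ τ)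

theorem Kinding.obliv {G : GCtx} {m : Mode} {Γ : List Expr} {τ : Expr} {κ : Kind} :
    Kinding G m Γ τ κ → κ.Le .obl → Obliv G τ
  | .sub h hκ, hκ' => h.obliv <| by
      rcases hκ with rfl | rfl | rfl
      · exact hκ'
      · exact .inr (.inl rfl)
      · rcases hκ' with h | h | h <;> cases h
  | .unit, _ => .unit
  | .bool, h => by rcases h with h | h | h <;> cases h
  | .obool, _ => .obool
  | .adt _, h => by rcases h with h | h | h <;> cases h
  | .oadt h _, _ => .oapp _ h
  | .pi _ _, h => by rcases h with h | h | h <;> cases h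
  | .prod h₁ h₂, h => .prod (h₁.obliv h) (h₂.obliv h)
  | .osum _ _, _ => .osum _ _
  | .psi _, h => by rcases h with h | h | h <;> cases h
  | .letIn _ h, _ => .letIn _ (h.obliv (.inl rfl))
  | .ite _ h₁ h₂, _ => .ite _ (h₁.obliv (.inl rfl)) (h₂.obliv (.inl rfl))
  | .mtch _ _ h, _ => .mtch _ _ _ fun i => (h i).obliv (.inl rfl)

theorem Obliv.subst {G : GCtx} {τ : Expr} (h : Obliv G τ) (σ : ℕ → Expr) :
    Obliv G (τ.subst σ) := by
  induction h generalizing σ with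
  | unit => exact .unit
  | obool => exact .obool
  | oapp _ h => exact .oapp _ h
  | prod _ _ h₁ h₂ => exact .prod (h₁ σ) (h₂ σ)
  | osum => exact .osum _ _
  | letIn _ _ h => exact .letIn _ (h _)
  | ite _ _ _ h₁ h₂ => exact .ite _ (h₁ σ) (h₂ σ)
  | mtch _ _ _ _ h => exact .mtch _ _ _ fun i => h i _

theorem Obliv.inst {G : GCtx} {τ : Expr} (h : Obliv G τ) (e : Expr) : Obliv G (τ.inst e) :=
  h.subst _

theorem Obliv.pared {G : GCtx} (hG : G.WellTyped) {τ τ' : Expr} (h : Obliv G τ)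
    (p : Pared G τ τ') : Obliv G τ' := by
  induction h generalizing τ' with
  | unit => cases p; exact .unit
  | obool => cases p; exact .obool
  | oapp _ h =>
    cases p with
    | refl => exact .oapp _ h
    | oadt h _ => exact ((hG _ _ h).2.obliv (.inl rfl)).inst _
    | oapp _ => exact .oapp _ h
  | prod _ _ h₁ h₂ =>
    obtain ⟨_, _, rfl, p₁, p₂⟩ := p.prodTy_inv
    exact .prod (h₁ p₁) (h₂ p₂)
  | osum =>
    obtain ⟨_, _, rfl, -, -⟩ := p.osumTy_inv
    exact .osum _ _
  | letIn _ h ih =>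
    cases p with
    | refl => exact .letIn _ h
    | letBeta _ p => exact (ih p).inst _
    | letIn _ p => exact .letIn _ (ih p)
  | ite _ h₁ h₂ ih₁ ih₂ =>
    cases p with
    | refl => exact .ite _ h₁ h₂
    | iteBeta p₁ p₂ => split; exacts [ih₁ p₁, ih₂ p₂]
    | ite _ p₁ p₂ => exact .ite _ (ih₁ p₁) (ih₂ p₂)
  | mtch _ _ _ h ih =>
    cases p with
    | refl => exact .mtch _ _ _ h
    | mtchBeta i _ p => exact (ih i p).inst _
    | mtch _ p => exact .mtch _ _ _ fun i => ih i (p i)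

theorem Obliv.pareds {G : GCtx} (hG : G.WellTyped) {τ τ' : Expr} (h : Obliv G τ)
    (p : Relation.ReflTransGen (Pared G) τ τ') : Obliv G τ' := by
  induction p with
  | refl => exact h
  | tail _ p ih => exact ih.pared hG p

theorem Obliv.head {G : GCtx} (hG : G.WellTyped) {τ τ' : Expr} {t : TyHead} (ho : Obliv G τ')
    (h : TyEquiv G τ τ') (ht : τ.tyHead = some t) :
    t = .unit ∨ t = .obool ∨ t = .prod ∨ t = .osum := by
  obtain ⟨c, h₁, h₂⟩ := h.join hG
  have hc := Pared.tyHead_star h₁ ht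
  cases ho.pareds hG h₂ <;> cases hc <;> simp

/-- The values of oblivious types are oblivious values. -/
theorem IsVal.oval {G : GCtx} (hG : G.WellTyped) {Γ : List Expr} {v τ τ' : Expr} (hv : IsVal v)
    (h : Typing G .secure Γ v τ) (hτ : TyEquiv G τ τ') (ho : Obliv G τ') :
    ∃ w : OVal, v = w.toExpr := by
  induction hv generalizing τ τ' with
  | unit => exact ⟨.unit, rfl⟩
  | boxLit b => exact ⟨.lit b, rfl⟩
  | boxInj b ω v => exact ⟨.inj b ω v, rfl⟩
  | lit => simpa using ho.head hG (TyEquiv.trans h.inv hτ) rfl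
  | pair _ _ ih₁ ih₂ =>
    obtain ⟨_, _, h₁, h₂, heq⟩ := h.inv
    obtain ⟨_, p₁, p₂⟩ := (heq.trans hτ).join hG
    obtain ⟨_, _, rfl, e₁, e₂⟩ := Pared.prodTy_inv_star p₁
    cases ho.pareds hG p₂ with
    | prod o₁ o₂ =>
      obtain ⟨w₁, rfl⟩ := ih₁ h₁ e₁ o₁
      obtain ⟨w₂, rfl⟩ := ih₂ h₂ e₂ o₂
      exact ⟨.pair w₁ w₂, rfl⟩
  | psiPair =>
    obtain ⟨_, _, _, -, -, -, heq⟩ := h.inv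
    simpa using ho.head hG (heq.trans hτ) rfl
  | lam =>
    obtain ⟨_, _, -, -, heq⟩ := h.inv
    simpa using ho.head hG (heq.trans hτ) rfl
  | ctor =>
    obtain ⟨_, _, _, -, -, -, heq⟩ := h.inv
    simpa using ho.head hG (heq.trans hτ) rfl

theorem ValOf.psiPair_inv {G : GCtx} (hG : G.WellTyped) {O : Name} {τ body k u : Expr}
    (hO : G O = some (.obliv τ body)) (h : ValOf G (.psiPair k u) (.psi O)) :
    ValOf G k τ ∧ ValOf G u (.oapp O k) := by
  obtain ⟨h₁, h₂⟩ := h.2.psiPair_inv hG hO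
  cases h.1 with
  | psiPair hk hu => exact ⟨⟨hk, h₁⟩, hu, h₂⟩

/-- A value of a `psi` type is a public view with an oblivious value at that view. -/
theorem ValOf.psi {G : GCtx} (hG : G.WellTyped) {O : Name} {τ body v : Expr}
    (hO : G O = some (.obliv τ body)) (h : ValOf G v (.psi O)) :
    ∃ (k : Expr) (w : OVal), v = .psiPair k w.toExpr ∧ ValOf G k τ ∧
      ValOf G w.toExpr (.oapp O k) := by
  obtain ⟨k, u, rfl, -, -⟩ := h.canonical hG rfl
  obtain ⟨hk, hu⟩ := h.psiPair_inv hG hO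
  obtain ⟨w, rfl⟩ := hu.1.oval hG hu.2 (.refl _) (.oapp _ hO)
  exact ⟨k, w, rfl, hk, hu⟩

/-- Types that have the form of a public type. -/
inductive Public : Expr → Prop
  | unit : Public .unitTy
  | bool : Public .boolTy
  | adt (T) : Public (.adt T)
  | prod {τ₁ τ₂} : Public τ₁ → Public τ₂ → Public (.prodTy τ₁ τ₂)

theorem Kinding.public {G : GCtx} {m : Mode} {Γ : List Expr} {τ : Expr} {κ : Kind} :
    Kinding G m Γ τ κ → κ.Le .pub → Public τ
  | .sub h hκ, hκ' => h.public <| by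
      rcases hκ with rfl | rfl | rfl
      · exact hκ'
      · exact .inr (.inl rfl)
      · rcases hκ' with h | h | h <;> cases h
  | .unit, _ => .unit
  | .bool, _ => .bool
  | .obool, h => by rcases h with h | h | h <;> cases h
  | .adt _, _ => .adt _
  | .oadt _ _, h => by rcases h with h | h | h <;> cases h
  | .pi _ _, h => by rcases h with h | h | h <;> cases h
  | .prod h₁ h₂, h => .prod (h₁.public h) (h₂.public h)
  | .osum _ _, h => by rcases h with h | h | h <;> cases h
  | .psi _, h => by rcases h with h | h | h <;> cases h
  | .letIn _ _, h => by rcases h with h | h | h <;> cases h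
  | .ite _ _ _, h => by rcases h with h | h | h <;> cases h
  | .mtch _ _ _, h => by rcases h with h | h | h <;> cases h

/-- Public values are normal for parallel reduction. -/
theorem IsVal.public_normal {G : GCtx} (hG : G.WellTyped) {Γ : List Expr} {v τ τ' x : Expr}
    (hv : IsVal v) (h : Typing G .secure Γ v τ) (hτ : TyEquiv G τ τ') (hp : Public τ')
    (p : Pared G v x) : x = v := by
  induction hv generalizing τ τ' x with
  | pair _ _ ih₁ ih₂ =>
    obtain ⟨_, _, h₁, h₂, heq⟩ := h.inv
    obtain ⟨_, _, rfl, p₁, p₂⟩ := p.pair_inv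
    have heq := heq.trans hτ
    cases hp with
    | prod o₁ o₂ =>
      obtain ⟨e₁, e₂⟩ := heq.prodTy_inj hG
      rw [ih₁ h₁ e₁ o₁ p₁, ih₂ h₂ e₂ o₂ p₂]
    | _ => cases heq.tyHead hG rfl rfl
  | psiPair =>
    obtain ⟨_, _, _, -, -, -, heq⟩ := h.inv
    cases hp <;> cases (heq.trans hτ).tyHead hG rfl rfl
  | lam =>
    obtain ⟨_, _, -, -, heq⟩ := h.inv
    cases hp <;> cases (heq.trans hτ).tyHead hG rfl rfl
  | ctor _ ih =>
    obtain ⟨_, η, j, -, hT, h, -⟩ := h.inv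
    obtain ⟨_, rfl, p'⟩ := p.ctor_inv
    rw [ih h (.refl _) ((hG _ _ hT j).public (.inl rfl)) p']
  | _ => cases p; rfl

/-- Evaluation at public types is deterministic. -/
theorem ValOf.public_unique {G : GCtx} (hG : G.WellTyped) {e v v' τ : Expr} (hv : ValOf G v τ)
    (hv' : ValOf G v' τ) (hp : Public τ) (h : Steps G e v) (h' : Steps G e v') : v = v' := by
  have normal {v x : Expr} (hv : ValOf G v τ) (h : Relation.ReflTransGen (Pared G) v x) :
      x = v := by
    induction h with
    | refl => rfl
    | tail _ p ih => subst ih; exact hv.1.public_normal hG hv.2 (.refl _) hp p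
  obtain ⟨c, j, j'⟩ :=
    ((TyEquiv.of_pareds h.pareds).symm.trans (.of_pareds h'.pareds)).join hG
  exact (normal hv j).symm.trans (normal hv' j')

end Taypsi

namespace Taypsi

/-! ## Specification types -/

namespace SpecTy

@[simp] theorem toExpr_subst (θ : SpecTy) (σ : ℕ → Expr) : θ.toExpr.subst σ = θ.toExpr := by
  induction θ generalizing σ <;> simp_all [toExpr, Expr.subst]

@[simp] theorem toExpr_rename (θ : SpecTy) (ξ : ℕ → ℕ) : θ.toExpr.rename ξ = θ.toExpr := by
  rw [Expr.rename_eq_subst, toExpr_subst]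

@[simp] theorem toExpr_inst (θ : SpecTy) (e : Expr) : θ.toExpr.inst e = θ.toExpr :=
  toExpr_subst _ _

@[simp] theorem toExpr_instCtor (θ : SpecTy) (T : Name) (i : ℕ) :
    θ.toExpr.instCtor T i = θ.toExpr :=
  toExpr_subst _ _

variable {G : GCtx} {S : PsiCtx}

/-- Well-kindedness of specification types does not depend on the local context. -/
theorem kinding {Γ : List Expr} {θ : SpecTy} {κ : Kind} (h : Kinding G .secure Γ θ.toExpr κ)
    (Δ : List Expr) : Kinding G .secure Δ θ.toExpr .mixed := by
  induction θ generalizing Γ Δ κ with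
  | unit => exact Kinding.unit.le_mixed
  | bool => exact Kinding.bool.le_mixed
  | obool => exact Kinding.obool.le_mixed
  | adt T =>
    obtain ⟨_, _, hT⟩ := h.adt_inv rfl
    exact (Kinding.adt hT).le_mixed
  | psi O =>
    obtain ⟨_, _, hO⟩ := h.psi_inv rfl
    exact .psi hO
  | prod _ _ h₁ h₂ =>
    obtain ⟨_, h₁', h₂'⟩ := h.prodTy_inv rfl
    exact .prod (h₁ h₁' Δ) (h₂ h₂' Δ)
  | arr _ _ h₁ h₂ =>
    obtain ⟨_, _, h₁', h₂'⟩ := h.pi_inv rfl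
    exact .pi (h₁ h₁' Δ) (h₂ h₂' _)

theorem kinding_erase (hS : S.IsValid G) {Γ : List Expr} {θ : SpecTy} {κ : Kind}
    (h : Kinding G .secure Γ θ.toExpr κ) (Δ : List Expr) :
    Kinding G .secure Δ (θ.erase S).toExpr .mixed := by
  induction θ generalizing Γ Δ κ with
  | unit => exact Kinding.unit.le_mixed
  | bool => exact Kinding.bool.le_mixed
  | obool => exact Kinding.bool.le_mixed
  | adt T =>
    obtain ⟨_, _, hT⟩ := h.adt_inv rfl
    exact (Kinding.adt hT).le_mixed
  | psi O =>
    obtain ⟨_, _, hO⟩ := h.psi_inv rfl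
    obtain ⟨_, _, hT⟩ := (hS.oadt O _ _ hO).pub_def
    exact (Kinding.adt hT).le_mixed
  | prod _ _ h₁ h₂ =>
    obtain ⟨_, h₁', h₂'⟩ := h.prodTy_inv rfl
    exact .prod (h₁ h₁' Δ) (h₂ h₂' Δ)
  | arr _ _ h₁ h₂ =>
    obtain ⟨_, _, h₁', h₂'⟩ := h.pi_inv rfl
    exact .pi (h₁ h₁' Δ) (h₂ h₂' _)

theorem erase_of_public {θ : SpecTy} (h : Public θ.toExpr) : θ.erase S = θ := by
  induction θ with
  | unit | bool | adt => rfl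
  | prod _ _ h₁ h₂ => cases h with
    | prod p₁ p₂ => rw [erase, h₁ p₁, h₂ p₂]
  | _ => cases h

end SpecTy

namespace SpecTy.WellKinded

variable {G : GCtx} {S : PsiCtx} {θ θ₁ θ₂ : SpecTy}

theorem of_kinding {Γ : List Expr} {κ : Kind} (h : Kinding G .secure Γ θ.toExpr κ) :
    θ.WellKinded G :=
  ⟨_, SpecTy.kinding h []⟩

theorem of_typing (hG : G.WellTyped) {Γ : List Expr} {e : Expr}
    (h : Typing G .secure Γ e θ.toExpr) : θ.WellKinded G :=
  have ⟨_, h⟩ := h.regular hG rfl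
  of_kinding h

theorem kinding (h : θ.WellKinded G) {Γ : List Expr} : Kinding G .secure Γ θ.toExpr .mixed :=
  have ⟨_, h⟩ := h
  SpecTy.kinding h Γ

theorem erase (hS : S.IsValid G) (h : θ.WellKinded G) : (θ.erase S).WellKinded G :=
  have ⟨_, h⟩ := h
  ⟨_, SpecTy.kinding_erase hS h []⟩

theorem prod (h₁ : θ₁.WellKinded G) (h₂ : θ₂.WellKinded G) : (SpecTy.prod θ₁ θ₂).WellKinded G :=
  ⟨_, .prod h₁.kinding h₂.kinding⟩

theorem arr (h₁ : θ₁.WellKinded G) (h₂ : θ₂.WellKinded G) : (SpecTy.arr θ₁ θ₂).WellKinded G :=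
  ⟨_, .pi h₁.kinding h₂.kinding⟩

theorem arr_inv (h : (SpecTy.arr θ₁ θ₂).WellKinded G) : θ₁.WellKinded G ∧ θ₂.WellKinded G :=
  have ⟨_, h⟩ := h
  have ⟨_, _, h₁, h₂⟩ := h.pi_inv rfl
  ⟨of_kinding h₁, of_kinding h₂⟩

theorem arrows_inv {θs : List SpecTy} {α : SpecTy} (h : (SpecTy.arrows θs α).WellKinded G) :
    α.WellKinded G ∧ ∀ θ ∈ θs, θ.WellKinded G := by
  induction θs with
  | nil => exact ⟨h, by simp⟩
  | cons θ θs ih =>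
    obtain ⟨h₁, h₂⟩ := arr_inv h
    obtain ⟨h₃, h₄⟩ := ih h₂
    exact ⟨h₃, by simpa using ⟨h₁, h₄⟩⟩

end SpecTy.WellKinded

/-! ## Typing at specification types -/

theorem apps_subst (e : Expr) (as : List Expr) (σ : ℕ → Expr) :
    (apps e as).subst σ = apps (e.subst σ) (as.map (·.subst σ)) := by
  induction as generalizing e with
  | nil => rfl
  | cons a as ih => exact ih _

namespace Typing

variable {G : GCtx} {S : PsiCtx} {Γ : List Expr} {e f e₁ e₂ : Expr} {θ θ₁ θ₂ : SpecTy}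

theorem spec_app (hf : Typing G .secure Γ f (SpecTy.arr θ₁ θ₂).toExpr)
    (he : Typing G .secure Γ e θ₁.toExpr) : Typing G .secure Γ (.app f e) θ₂.toExpr := by
  simpa using Typing.app hf he

theorem spec_abs (h₁ : θ₁.WellKinded G) (h : Typing G .secure (θ₁.toExpr :: Γ) e θ₂.toExpr) :
    Typing G .secure Γ (.lam θ₁.toExpr e) (SpecTy.arr θ₁ θ₂).toExpr :=
  .abs h h₁.kinding

theorem spec_letIn (h₁ : Typing G .secure Γ e₁ θ₁.toExpr)
    (h₂ : Typing G .secure (θ₁.toExpr :: Γ) e₂ θ₂.toExpr) :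
    Typing G .secure Γ (.letIn e₁ e₂) θ₂.toExpr := by
  simpa using Typing.letIn h₁ h₂

theorem spec_var {x : ℕ} (hx : Γ[x]? = some θ.toExpr) (h : θ.WellKinded G) :
    Typing G .secure Γ (.var x) θ.toExpr := by
  have := Typing.var hx (by rw [SpecTy.toExpr_rename]; exact h.kinding)
  rwa [SpecTy.toExpr_rename] at this

theorem spec_proj {b : Bool} (h : Typing G .secure Γ e (SpecTy.prod θ₁ θ₂).toExpr) :
    Typing G .secure Γ (.proj b e) (if b then θ₁ else θ₂).toExpr := by
  have := Typing.proj (b := b) h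
  cases b <;> exact this

theorem spec_ite (hG : G.WellTyped) {e₀ : Expr} (h₀ : Typing G .secure Γ e₀ .boolTy)
    (h₁ : Typing G .secure Γ e₁ θ.toExpr) (h₂ : Typing G .secure Γ e₂ θ.toExpr) :
    Typing G .secure Γ (.ite e₀ e₁ e₂) θ.toExpr := by
  have := Typing.ite (e₁ := e₁) (e₂ := e₂) (τ := θ.toExpr) h₀ (by rwa [SpecTy.toExpr_inst])
    (by rwa [SpecTy.toExpr_inst])
    (by rw [SpecTy.toExpr_inst]; exact (SpecTy.WellKinded.of_typing hG h₁).kinding)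
  rwa [SpecTy.toExpr_inst] at this

theorem spec_mtch {T : Name} {k : ℕ} {e₀ : Expr} {η : Fin k → SpecTy} {br : Fin k → Expr}
    (hθ : θ.WellKinded G) (hT : G T = some (.data k fun i => (η i).toExpr))
    (h₀ : Typing G .secure Γ e₀ (.adt T))
    (h : ∀ i, Typing G .secure ((η i).toExpr :: Γ) (br i) θ.toExpr) :
    Typing G .secure Γ (.mtch T k e₀ br) θ.toExpr := by
  have := Typing.mtch (τ' := θ.toExpr) hT h₀ (by simpa using h)
    (by rw [SpecTy.toExpr_inst]; exact hθ.kinding)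
  rwa [SpecTy.toExpr_inst] at this

theorem spec_apps {as : List Expr} {θs : List SpecTy} (hl : as.length = θs.length)
    (has : ∀ (i : ℕ) (ha : i < as.length), Typing G .secure Γ as[i] (θs[i]'(hl ▸ ha)).toExpr)
    (hf : Typing G .secure Γ f (SpecTy.arrows θs θ).toExpr) :
    Typing G .secure Γ (apps f as) θ.toExpr := by
  induction as generalizing f θs with
  | nil =>
    cases θs with
    | nil => exact hf
    | cons => simp at hl
  | cons a as ih =>
    cases θs with
    | nil => simp at hl
    | cons θ' θs =>
      refine ih (by simpa using hl) (fun i hi => has (i + 1) (by simpa using hi))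
        (f := .app f a) (hf.spec_app (has 0 (by simp)))

/-- The section of an oblivious data type, applied. -/
theorem sect_app (hG : G.WellTyped) {O : Name} {τ k v : Expr} {A : OADTStruct}
    (hA : A.IsValid G O τ) (hk : Typing G .secure Γ k τ)
    (hv : Typing G .secure Γ v (.adt A.pub)) :
    Typing G .secure Γ (apps (.gvar A.sect) [k, v]) (.oapp O k) := by
  have h₁ : Typing G .secure Γ (.app (.gvar A.sect) k) (.pi (.adt A.pub) (.oapp O k.shift)) :=
    .app (hA.sect_ty.weaken hG) hk
  have h₂ : Typing G .secure Γ (apps (.gvar A.sect) [k, v]) (.oapp O (k.shift.inst v)) :=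
    .app h₁ hv
  rwa [Expr.shift_inst] at h₂

theorem view_app (hG : G.WellTyped) {O : Name} {τ body v : Expr}
    (hO : G O = some (.obliv τ body)) {A : OADTStruct} (hA : A.IsValid G O τ)
    (hv : Typing G .secure Γ v (.adt A.pub)) :
    Typing G .secure Γ (.app (.gvar A.view) v) τ := by
  have h := Typing.app (hA.view_ty.weaken hG) hv
  rwa [(hG.obliv_closed hO).1.inst] at h

theorem join_app (hG : G.WellTyped) {τ body k₁ k₂ : Expr} {J : JoinStruct}
    (hO : G J.oadt = some (.obliv τ body)) (hJ : J.IsValid G S τ)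
    (h₁ : Typing G .secure Γ k₁ τ) (h₂ : Typing G .secure Γ k₂ τ) :
    Typing G .secure Γ (apps (.gvar J.join) [k₁, k₂]) τ := by
  have hτ := (hG.obliv_closed hO).1
  have h : Typing G .secure Γ (.app (.gvar J.join) k₁) (.pi (τ.inst k₁) (τ.subst _)) :=
    .app (hJ.join_ty.weaken hG) h₁
  rw [hτ.inst, hτ.subst] at h
  have h := Typing.app h h₂
  rwa [hτ.inst] at h

theorem reshape_app (hG : G.WellTyped) {τ body k k' w : Expr} {J : JoinStruct}
    (hO : G J.oadt = some (.obliv τ body)) (hJ : J.IsValid G S τ)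
    (hk : Typing G .secure Γ k τ) (hk' : Typing G .secure Γ k' τ)
    (hw : Typing G .secure Γ w (.oapp J.oadt k)) :
    Typing G .secure Γ (apps (.gvar J.reshape) [k, k', w]) (.oapp J.oadt k') := by
  have hτ := (hG.obliv_closed hO).1
  have h₁ : Typing G .secure Γ (.app (.gvar J.reshape) k)
      (.pi (τ.inst k) (.pi (.oapp J.oadt k.shift) (.oapp J.oadt (.var 1)))) :=
    .app (hJ.reshape_ty.weaken hG) hk
  rw [hτ.inst] at h₁
  have h₂ : Typing G .secure Γ (.app (.app (.gvar J.reshape) k) k')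
      (.pi (.oapp J.oadt (k.shift.inst k')) (.oapp J.oadt k'.shift)) :=
    .app h₁ hk'
  rw [Expr.shift_inst] at h₂
  have h₃ : Typing G .secure Γ (apps (.gvar J.reshape) [k, k', w])
      (.oapp J.oadt (k'.shift.inst w)) :=
    .app h₂ hw
  rwa [Expr.shift_inst] at h₃

end Typing

/-! ## Typing of the witnesses -/

section

variable {G : GCtx} {S : PsiCtx}

/-- The type of the witness of mergeability of `θ`. -/
def SpecTy.iteTy (θ : SpecTy) : SpecTy := .arr .obool (.arr θ (.arr θ θ))

theorem Typing.iteTy_app {Γ : List Expr} {θ : SpecTy} {i e₀ e₁ e₂ : Expr}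
    (h : Typing G .secure Γ i θ.iteTy.toExpr) (h₀ : Typing G .secure Γ e₀ .oboolTy)
    (h₁ : Typing G .secure Γ e₁ θ.toExpr) (h₂ : Typing G .secure Γ e₂ θ.toExpr) :
    Typing G .secure Γ (apps i [e₀, e₁, e₂]) θ.toExpr :=
  ((h.spec_app (θ₁ := .obool) h₀).spec_app h₁).spec_app h₂

theorem Typing.iteTy_abs {θ : SpecTy} {e : Expr} (hθ : θ.WellKinded G)
    (h : Typing G .secure [θ.toExpr, θ.toExpr, .oboolTy] e θ.toExpr) :
    Typing G .secure [] (.lam .oboolTy (.lam θ.toExpr (.lam θ.toExpr e))) θ.iteTy.toExpr :=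
  .spec_abs (θ₁ := .obool) ⟨_, .obool⟩ (.spec_abs hθ (.spec_abs hθ h))

theorem Mergeable.typing (hG : G.WellTyped) (hS : S.IsValid G) {θ : SpecTy} {i : Expr}
    (h : Mergeable G S θ i) : θ.WellKinded G ∧ Typing G .secure [] i θ.iteTy.toExpr := by
  have obool : SpecTy.obool.WellKinded G := ⟨_, .obool⟩
  induction h with
  | unit =>
    have wk : SpecTy.unit.WellKinded G := ⟨_, .unit⟩
    exact ⟨wk, .iteTy_abs (θ := .unit) wk <|
      .mux (.spec_var (θ := .obool) rfl obool) (.sub .unit (.inr (.inl rfl)))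
        (.spec_var (θ := .unit) rfl wk) (.spec_var (θ := .unit) rfl wk)⟩
  | obool =>
    exact ⟨obool, .iteTy_abs (θ := .obool) obool <|
      .mux (.spec_var (θ := .obool) rfl obool) .obool
        (.spec_var (θ := .obool) rfl obool) (.spec_var (θ := .obool) rfl obool)⟩
  | @psi J hJ =>
    obtain ⟨τ, body, hO, hJ⟩ := hS.joins J hJ
    have wk : (SpecTy.psi J.oadt).WellKinded G := ⟨_, .psi hO⟩
    have hτ := (hG.obliv_closed hO).1
    have var {Γ : List Expr} {x : ℕ} (hx : Γ[x]? = some (.psi J.oadt)) :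
        Typing G .secure Γ (.var x) (.psi J.oadt) := .spec_var (θ := .psi J.oadt) hx wk
    have key {Γ : List Expr} : Typing G .secure (τ :: Γ) (.var 0) τ := by
      have := Typing.var (G := G) (m := .secure) (Γ := τ :: Γ) (x := 0) (κ := .pub) rfl
        (by rw [hτ.rename]; exact (hG _ _ hO).1.weaken hG)
      rwa [hτ.rename] at this
    have reshaped {Γ : List Expr} {x : ℕ} (hx : (τ :: Γ)[x]? = some (.psi J.oadt)) :
        Typing G .secure (τ :: Γ)
          (apps (.gvar J.reshape) [.proj true (.var x), .var 0, .proj false (.var x)])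
          (.oapp J.oadt (.var 0)) :=
      .reshape_app hG hO hJ (.psiProj₁ hO (var hx)) key (.psiProj₂ hO (var hx))
    exact ⟨wk, .iteTy_abs (θ := .psi J.oadt) wk <|
      .letIn (τ₂ := .psi J.oadt)
        (.join_app hG hO hJ (.psiProj₁ hO (var rfl)) (.psiProj₁ hO (var rfl)))
        (.psiPair hO key (.mux (.spec_var (θ := .obool) rfl obool) (.oadt hO key)
          (reshaped rfl) (reshaped rfl)))⟩
  | @prod θ₁ θ₂ i₁ i₂ h₁ h₂ ih₁ ih₂ =>
    have wk := ih₁.1.prod ih₂.1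
    refine ⟨wk, .iteTy_abs wk ?_⟩
    have v₀ : Typing G .secure [(SpecTy.prod θ₁ θ₂).toExpr, (SpecTy.prod θ₁ θ₂).toExpr, .oboolTy]
        (.var 0) (SpecTy.prod θ₁ θ₂).toExpr := .spec_var rfl wk
    have v₁ : Typing G .secure [(SpecTy.prod θ₁ θ₂).toExpr, (SpecTy.prod θ₁ θ₂).toExpr, .oboolTy]
        (.var 1) (SpecTy.prod θ₁ θ₂).toExpr := .spec_var rfl wk
    exact .pair
      ((ih₁.2.weaken hG).iteTy_app (.spec_var (θ := .obool) rfl obool)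
        (v₁.spec_proj (b := true)) (v₀.spec_proj (b := true)))
      ((ih₂.2.weaken hG).iteTy_app (.spec_var (θ := .obool) rfl obool)
        (v₁.spec_proj (b := false)) (v₀.spec_proj (b := false)))
  | @arr θ₁ θ₂ i₂ h₁ _ ih₂ =>
    have wk := h₁.arr ih₂.1
    have v₀ : Typing G .secure
        [θ₁.toExpr, (SpecTy.arr θ₁ θ₂).toExpr, (SpecTy.arr θ₁ θ₂).toExpr, .oboolTy]
        (.var 0) θ₁.toExpr := .spec_var rfl h₁
    exact ⟨wk, .iteTy_abs wk <| .spec_abs h₁ <|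
      (ih₂.2.weaken hG).iteTy_app (.spec_var (θ := .obool) rfl obool)
        (.spec_app (.spec_var rfl wk) v₀) (.spec_app (.spec_var rfl wk) v₀)⟩

theorem Coercible.typing (hG : G.WellTyped) (hS : S.IsValid G) {θ θ' : SpecTy} {c : Expr}
    (h : Coercible G S θ θ' c) : θ.WellKinded G ∧ θ'.WellKinded G ∧ θ'.erase S = θ.erase S ∧
      Typing G .secure [] c (SpecTy.arr θ θ').toExpr := by
  induction h with
  | refl h => exact ⟨h, h, rfl, .spec_abs h (.spec_var rfl h)⟩
  | bool =>
    exact ⟨⟨_, .bool⟩, ⟨_, .obool⟩, rfl, .spec_abs (θ₁ := .bool) (θ₂ := .obool) ⟨_, .bool⟩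
      (.sec (.spec_var (θ := .bool) rfl ⟨_, .bool⟩))⟩
  | @sect O τ body hO =>
    have hA := hS.oadt O τ body hO
    obtain ⟨_, _, hT⟩ := hA.pub_def
    have wk : (SpecTy.adt (S.oadt O).pub).WellKinded G := ⟨_, .adt hT⟩
    have v₀ : Typing G .secure [.adt (S.oadt O).pub] (.var 0) (.adt (S.oadt O).pub) :=
      .spec_var (θ := .adt (S.oadt O).pub) rfl wk
    have hk := v₀.view_app hG hO hA
    exact ⟨wk, ⟨_, .psi hO⟩, rfl, .spec_abs (θ₁ := .adt (S.oadt O).pub) (θ₂ := .psi O) wk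
      (.psiPair hO hk (.sect_app hG hA hk v₀))⟩
  | @psi C hC =>
    have hC := hS.coers C hC
    obtain ⟨⟨_, _, h₁⟩, _, _, h₂⟩ := And.intro hC.src_def hC.dst_def
    exact ⟨⟨_, .psi h₁⟩, ⟨_, .psi h₂⟩, congrArg SpecTy.adt hC.compat.symm, hC.fn_ty⟩
  | @prod θ₁ θ₂ _ _ _ _ _ _ ih₁ ih₂ =>
    obtain ⟨w₁, w₁', e₁, h₁⟩ := ih₁
    obtain ⟨w₂, w₂', e₂, h₂⟩ := ih₂
    have v₀ : Typing G .secure [(SpecTy.prod θ₁ θ₂).toExpr] (.var 0)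
      (SpecTy.prod θ₁ θ₂).toExpr := .spec_var rfl (w₁.prod w₂)
    refine ⟨w₁.prod w₂, w₁'.prod w₂', by rw [SpecTy.erase, SpecTy.erase, e₁, e₂],
      .spec_abs (w₁.prod w₂) (.pair ?_ ?_)⟩
    · exact (h₁.weaken hG).spec_app (v₀.spec_proj (b := true))
    · exact (h₂.weaken hG).spec_app (v₀.spec_proj (b := false))
  | arr _ _ ih₁ ih₂ =>
    obtain ⟨w₁, w₁', e₁, h₁⟩ := ih₁
    obtain ⟨w₂, w₂', e₂, h₂⟩ := ih₂
    refine ⟨w₁'.arr w₂, w₁.arr w₂', by rw [SpecTy.erase, SpecTy.erase, e₁, e₂],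
      .spec_abs (w₁'.arr w₂) (.spec_abs w₁ ?_)⟩
    exact (h₂.weaken hG).spec_app ((Typing.spec_var rfl (w₁'.arr w₂)).spec_app
      ((h₁.weaken hG).spec_app (.spec_var rfl w₁)))

/-! ## Typing of lifted expressions -/

theorem Lift.typing (hG : G.WellTyped) (hS : S.IsValid G) {L : LiftCtx} {n : ℕ}
    (hL : L.NValid G S n) {Γ : List SpecTy} {e e' : Expr} {θ : SpecTy}
    (h : Lift G S L Γ e θ e') (hΓ : ∀ θ ∈ Γ, θ.WellKinded G) :
    Typing G .secure (Γ.map fun θ => (θ.erase S).toExpr) e (θ.erase S).toExpr ∧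
      Typing G .secure (Γ.map SpecTy.toExpr) e' θ.toExpr := by
  have erase_data {T : Name} {k : ℕ} {η : Fin k → SpecTy}
      (hT : G T = some (.data k fun j => (η j).toExpr)) (i : Fin k) : (η i).erase S = η i :=
    SpecTy.erase_of_public ((hG _ _ hT i).public (.inl rfl))
  induction h with
  | unit => exact ⟨.unit, .unit⟩
  | lit => exact ⟨.lit, .lit⟩
  | @var _ _ θ hx =>
    have hθ := hΓ _ (List.mem_of_getElem? hx)
    exact ⟨.spec_var (by simp [hx]) (hθ.erase hS), .spec_var (by simp [hx]) hθ⟩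
  | fn h =>
    obtain ⟨h₁, h₂, -⟩ := hL _ _ _ h
    exact ⟨h₁.weaken hG, h₂.weaken hG⟩
  | abs hθ _ ih =>
    obtain ⟨h₁, h₂⟩ := ih (by simpa using ⟨hθ, hΓ⟩)
    exact ⟨.spec_abs (hθ.erase hS) h₁, .spec_abs hθ h₂⟩
  | app _ _ ih₁ ih₂ =>
    exact ⟨(ih₁ hΓ).1.spec_app (ih₂ hΓ).1, (ih₁ hΓ).2.spec_app (ih₂ hΓ).2⟩
  | letIn _ _ ih₁ ih₂ =>
    have hθ := SpecTy.WellKinded.of_typing hG (ih₁ hΓ).2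
    obtain ⟨h₁, h₂⟩ := ih₂ (by simpa using ⟨hθ, hΓ⟩)
    exact ⟨.spec_letIn (ih₁ hΓ).1 h₁, .spec_letIn (ih₁ hΓ).2 h₂⟩
  | pair _ _ ih₁ ih₂ => exact ⟨.pair (ih₁ hΓ).1 (ih₂ hΓ).1, .pair (ih₁ hΓ).2 (ih₂ hΓ).2⟩
  | proj _ ih =>
    rw [apply_ite (SpecTy.erase S)]
    exact ⟨(ih hΓ).1.spec_proj, (ih hΓ).2.spec_proj⟩
  | ite₁ _ _ _ ih₀ ih₁ ih₂ =>
    exact ⟨.spec_ite hG (ih₀ hΓ).1 (ih₁ hΓ).1 (ih₂ hΓ).1,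
      .spec_ite hG (ih₀ hΓ).2 (ih₁ hΓ).2 (ih₂ hΓ).2⟩
  | ite₂ _ hm _ _ ih₀ ih₁ ih₂ =>
    exact ⟨.spec_ite hG (ih₀ hΓ).1 (ih₁ hΓ).1 (ih₂ hΓ).1,
      ((hm.typing hG hS).2.weaken hG).iteTy_app (ih₀ hΓ).2 (ih₁ hΓ).2 (ih₂ hΓ).2⟩
  | ctor₁ i hT _ ih =>
    have h₁ := (ih hΓ).1
    rw [erase_data hT] at h₁
    exact ⟨.ctor i hT h₁, .ctor i hT (ih hΓ).2⟩
  | ctor₂ i hI _ ih =>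
    have hI := hS.intros _ hI
    exact ⟨.ctor i hI.compat (ih hΓ).1, ((hI.fn_ty i).weaken hG).spec_app (ih hΓ).2⟩
  | mtch₁ hθ hT _ _ ih₀ ih =>
    have hΓ' := fun i => And.intro (SpecTy.WellKinded.of_kinding (hG _ _ hT i)) hΓ
    refine ⟨.spec_mtch (hθ.erase hS) hT (ih₀ hΓ).1 fun i => ?_,
      .spec_mtch hθ hT (ih₀ hΓ).2 fun i => (ih i (by simpa using hΓ' i)).2⟩
    have h := (ih i (by simpa using hΓ' i)).1
    rwa [List.map_cons, erase_data hT] at h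
  | @mtch₂ Γ E e₀ e₀' br br' hE _ _ ih₀ ih =>
    have hE := hS.elims E hE
    obtain ⟨-, hw⟩ := (SpecTy.WellKinded.of_typing hG hE.fn_ty).arr_inv
    obtain ⟨hα, hw⟩ := hw.arrows_inv
    have hw := fun i => (hw _ (by simp : SpecTy.arr (E.θ i) E.α ∈ _)).arr_inv.1
    have hΓ' := fun i => And.intro (hw i) hΓ
    refine ⟨.spec_mtch (hα.erase hS) hE.compat (ih₀ hΓ).1
      fun i => (ih i (by simpa using hΓ' i)).1, ?_⟩
    refine .spec_apps (by simp) (fun i hi => ?_) ((hE.fn_ty.weaken hG).spec_app (ih₀ hΓ).2)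
    simp only [List.getElem_ofFn]
    exact .spec_abs (hw _) (ih _ (by simpa using hΓ' _)).2
  | coerce _ hc ih =>
    obtain ⟨-, -, he, hc⟩ := hc.typing hG hS
    rw [he]
    exact ⟨(ih hΓ).1, (hc.weaken hG).spec_app (ih hΓ).2⟩

end

end Taypsi

namespace Taypsi

theorem Steps.stepN {G : GCtx} {e e' : Expr} (h : Steps G e e') : ∃ n, StepN G n e e' := by
  induction h using Relation.ReflTransGen.head_induction_on with
  | refl => exact ⟨0, .zero _⟩
  | head s _ ih =>
    obtain ⟨n, h⟩ := ih
    exact ⟨n + 1, .succ s h⟩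

namespace StepN

variable {G : GCtx} {n : ℕ} {f e₀ e₁ e₂ u v : Expr}

theorem app_congr {m : ℕ} {w : Expr} (hu : IsVal u) (h : StepN G m f w) :
    StepN G m (.app f u) (.app w u) := by
  induction h with
  | zero => exact .zero _
  | succ s _ ih => exact .succ (.ctx_app₁ hu s) ih

/-- Evaluation of an application to three arguments. -/
theorem apps_three (h : StepN G n (apps f [e₀, e₁, e₂]) v) (hv : IsVal v) :
    ∃ j₀ j₁ j₂ l u₀ u₁ u₂, j₀ + j₁ + j₂ + l = n ∧ IsVal u₀ ∧ IsVal u₁ ∧ IsVal u₂ ∧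
      StepN G j₀ e₀ u₀ ∧ StepN G j₁ e₁ u₁ ∧ StepN G j₂ e₂ u₂ ∧
      StepN G l (apps f [u₀, u₁, u₂]) v := by
  obtain ⟨j₂, _, u₂, rfl, hu₂, h₂, a₁⟩ := app_arg (f := .app (.app f e₀) e₁) h hv
  obtain ⟨_, l₂, w₂, rfl, hw₂, a₂, b₂⟩ := a₁.app_fun hu₂ hv
  obtain ⟨j₁, _, u₁, rfl, hu₁, h₁, a₃⟩ := a₂.app_arg hw₂
  obtain ⟨_, l₁, w₁, rfl, hw₁, a₄, b₁⟩ := a₃.app_fun hu₁ hw₂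
  obtain ⟨j₀, l₀, u₀, rfl, hu₀, h₀, a₅⟩ := a₄.app_arg hw₁
  exact ⟨j₀, j₁, j₂, _, u₀, u₁, u₂, by omega, hu₀, hu₁, hu₂, h₀, h₁, h₂,
    (app_congr hu₂ ((app_congr hu₁ a₅).trans b₁)).trans b₂⟩

/-- Application of a three-fold abstraction to values. -/
theorem beta_three {τ₀ τ₁ τ₂ b u₀ u₁ u₂ : Expr} (hu₀ : IsVal u₀) (hu₁ : IsVal u₁)
    (hu₂ : IsVal u₂) (hv : IsVal v)
    (h : StepN G n (apps (.lam τ₀ (.lam τ₁ (.lam τ₂ b))) [u₀, u₁, u₂]) v) :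
    ∃ l, l + 3 = n ∧ StepN G l (b.subst (scons u₂ (scons u₁ (scons u₀ .var)))) v := by
  obtain ⟨_, _, w₂, rfl, hw₂, a₂, b₂⟩ :=
    app_fun (f := .app (.app (.lam τ₀ (.lam τ₁ (.lam τ₂ b))) u₀) u₁) h hu₂ hv
  obtain ⟨_, _, w₁, rfl, hw₁, a₁, b₁⟩ := a₂.app_fun hu₁ hw₂
  obtain ⟨_, rfl, b₀⟩ := a₁.beta hu₀ hw₁
  obtain ⟨rfl, rfl⟩ := (IsVal.lam _ _).stepN b₀
  obtain ⟨_, rfl, c₁⟩ := b₁.beta hu₁ hw₂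
  obtain ⟨rfl, rfl⟩ := (IsVal.lam _ _).stepN c₁
  obtain ⟨l, rfl, c₂⟩ := b₂.beta hu₂ hv
  refine ⟨l, by omega, ?_⟩
  rw [Expr.subst_up_inst, Expr.subst_subst] at c₂
  convert c₂ using 3 with x
  rcases x with _ | _ | _ | x
  · rfl
  · rfl
  all_goals simp [scons, upSub, Expr.shift, Expr.subst, Expr.rename_subst]

theorem proj_psi {b : Bool} {k w : Expr} (hk : IsVal k) (hw : IsVal w)
    (h : StepN G n (.proj b (.psiPair k w)) v) (hv : IsVal v) : v = if b then k else w := by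
  obtain ⟨_, u, -, -, h', u₁, u₂, hu, rfl⟩ := h.proj hv
  obtain ⟨-, rfl⟩ := (IsVal.psiPair hk hw).stepN h'
  rcases hu with hu | hu <;> cases hu
  rfl

theorem proj_pair {b : Bool} {k w : Expr} (hk : IsVal k) (hw : IsVal w)
    (h : StepN G n (.proj b (.pair k w)) v) (hv : IsVal v) : v = if b then k else w := by
  obtain ⟨_, u, -, -, h', u₁, u₂, hu, rfl⟩ := h.proj hv
  obtain ⟨-, rfl⟩ := (IsVal.pair hk hw).stepN h'
  rcases hu with hu | hu <;> cases hu
  rfl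

end StepN

/-- Application to a tag and projections of pairs. -/
theorem StepN.apps_proj {G : GCtx} {n : ℕ} {b p : Bool} {f a c a' c' v : Expr} (ha : IsVal a)
    (hc : IsVal c) (ha' : IsVal a') (hc' : IsVal c')
    (h : StepN G n (apps f [.boxLit b, .proj p (.pair a c), .proj p (.pair a' c')]) v)
    (hv : IsVal v) : ∃ l ≤ n,
      StepN G l (apps f [.boxLit b, if p then a else c, if p then a' else c']) v := by
  obtain ⟨_, _, _, l, _, _, _, rfl, h₀, h₁, h₂, s₀, s₁, s₂, hf⟩ := h.apps_three hv
  obtain ⟨rfl, rfl⟩ := (IsVal.boxLit b).stepN s₀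
  rw [proj_pair ha hc s₁ h₁, proj_pair ha' hc' s₂ h₂] at hf
  exact ⟨l, by omega, hf⟩

/-- Evaluation of the arguments of a reshape function. -/
theorem Steps.apps_reshape {G : GCtx} {f k k₁ w v : Expr} (hk : IsVal k) (hk₁ : IsVal k₁)
    (hw : IsVal w) (hv : IsVal v)
    (h : Steps G (apps f [.proj true (.psiPair k₁ w), k, .proj false (.psiPair k₁ w)]) v) :
    Steps G (apps f [k₁, k, w]) v := by
  obtain ⟨_, h'⟩ := h.stepN
  obtain ⟨_, _, _, _, _, _, _, -, h₀, h₁, h₂, s₀, s₁, s₂, hf⟩ := h'.apps_three hv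
  obtain ⟨-, rfl⟩ := hk.stepN s₁
  rw [s₀.proj_psi hk₁ hw h₀, s₂.proj_psi hk₁ hw h₂] at hf
  exact hf.steps

/-- Evaluation of the arguments of a join. -/
theorem StepN.apps_join {G : GCtx} {n : ℕ} {f k₁ w₁ k₂ w₂ v : Expr} (hk₁ : IsVal k₁)
    (hw₁ : IsVal w₁) (hk₂ : IsVal k₂) (hw₂ : IsVal w₂) (hv : IsVal v)
    (h : StepN G n (apps f [.proj true (.psiPair k₁ w₁), .proj true (.psiPair k₂ w₂)]) v) :
    Steps G (apps f [k₁, k₂]) v := by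
  obtain ⟨_, _, u₂, -, hu₂, s₂, h'⟩ :=
    app_arg (f := .app f (.proj true (.psiPair k₁ w₁))) h hv
  obtain ⟨_, _, u, -, hu, s, hf⟩ := h'.app_fun hu₂ hv
  obtain ⟨_, _, u₁, -, hu₁, s₁, hf'⟩ := s.app_arg hu
  rw [s₂.proj_psi hk₂ hw₂ hu₂] at hf
  rw [s₁.proj_psi hk₁ hw₁ hu₁] at hf'
  exact ((app_congr hk₂ hf').trans hf).steps

/-! ## Basic properties of the logical relation -/

/-- Refinement up to `n` steps, without the typing conditions of `ERel`. -/
def Refines (G : GCtx) (S : PsiCtx) (θ : SpecTy) (n : ℕ) (e e' : Expr) : Prop :=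
  ∀ i < n, ∀ v', IsVal v' → StepN G i e' v' →
    ∃ v, IsVal v ∧ Steps G e v ∧ ValRel G S θ (n - i) v v'

section

variable {G : GCtx} {S : PsiCtx} {θ : SpecTy} {n m : ℕ} {v v' e e' : Expr}

theorem ValRel.source (h : ValRel G S θ n v v') : ValOf G v (θ.erase S).toExpr := by
  cases θ <;> exact h.1

theorem ValRel.target (h : ValRel G S θ n v v') : ValOf G v' θ.toExpr := by
  cases θ <;> exact h.2.1

theorem ValRel.mono (h : ValRel G S θ n v v') (hm : m ≤ n) : ValRel G S θ m v v' := by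
  induction θ generalizing v v' with
  | unit | bool | adt => exact ⟨h.1, h.2.1, fun h₀ => h.2.2 (by omega)⟩
  | obool =>
    obtain ⟨h₁, h₂, b, b', hv, hv', h⟩ := h
    exact ⟨h₁, h₂, b, b', hv, hv', fun h₀ => h (by omega)⟩
  | psi =>
    obtain ⟨h₁, h₂, k, w, hv', h⟩ := h
    exact ⟨h₁, h₂, k, w, hv', fun h₀ => h (by omega)⟩
  | prod _ _ ih₁ ih₂ =>
    obtain ⟨h₁, h₂, _, _, _, _, hv, hv', r₁, r₂⟩ := h
    exact ⟨h₁, h₂, _, _, _, _, hv, hv', ih₁ r₁, ih₂ r₂⟩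
  | arr =>
    obtain ⟨h₁, h₂, b, b', hv, hv', h⟩ := h
    exact ⟨h₁, h₂, b, b', hv, hv', fun i hi => h i (by omega)⟩

theorem Refines.mono (h : Refines G S θ n e e') (hm : m ≤ n) : Refines G S θ m e e' := by
  intro i hi v' hv' he'
  obtain ⟨v, hv, he, hr⟩ := h i (by omega) v' hv' he'
  exact ⟨v, hv, he, hr.mono (by omega)⟩

theorem ERel.mono (h : ERel G S θ n e e') (hm : m ≤ n) : ERel G S θ m e e' :=
  ⟨h.1, h.2.1, Refines.mono h.2.2 hm⟩

theorem ValRel.refines (h : ValRel G S θ n v v') : Refines G S θ n v v' := by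
  intro i hi u' hu' he'
  obtain ⟨rfl, rfl⟩ := h.target.1.stepN he'
  exact ⟨v, h.source.1, .refl, h⟩

theorem ValRel.public_eq (hθ : Public θ.toExpr) (h : ValRel G S θ n v v') (hn : 0 < n) :
    v = v' := by
  induction θ generalizing v v' with
  | unit | bool | adt => exact h.2.2 hn
  | prod _ _ ih₁ ih₂ =>
    obtain ⟨-, -, _, _, _, _, rfl, rfl, r₁, r₂⟩ := h
    cases hθ with
    | prod p₁ p₂ => rw [ih₁ p₁ r₁, ih₂ p₂ r₂]
  | _ => cases hθ

theorem ValOf.public_rel (hG : G.WellTyped) (hθ : Public θ.toExpr) (h : ValOf G v θ.toExpr) :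
    ValRel G S θ n v v := by
  induction θ generalizing v with
  | unit | bool | adt => exact ⟨h, h, fun _ => rfl⟩
  | prod _ _ ih₁ ih₂ =>
    have he := SpecTy.erase_of_public (S := S) hθ
    obtain ⟨v₁, v₂, rfl, hv₁, hv₂⟩ := h.canonical hG rfl
    obtain ⟨h₁, h₂⟩ := h.2.pair_inv hG
    cases hθ with
    | prod p₁ p₂ =>
      exact ⟨he.symm ▸ h, h, _, _, _, _, rfl, rfl, ih₁ p₁ ⟨hv₁, h₁⟩, ih₂ p₂ ⟨hv₂, h₂⟩⟩
  | _ => cases hθ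

theorem ValRel.arr_form {θ₁ θ₂ : SpecTy} (h : ValRel G S (.arr θ₁ θ₂) n v v') :
    ∃ b b', v = .lam (θ₁.erase S).toExpr b ∧ v' = .lam θ₁.toExpr b' := by
  obtain ⟨-, -, b, b', h₁, h₂, -⟩ := h
  exact ⟨b, b', h₁, h₂⟩

/-- The typing conditions on the pairs of functions in the logical relation. -/
theorem ValRel.arr_intro {θ₁ θ₂ : SpecTy} (hv : ValOf G (.lam (θ₁.erase S).toExpr e)
      ((SpecTy.arr θ₁ θ₂).erase S).toExpr)
    (hv' : ValOf G (.lam θ₁.toExpr e') (SpecTy.arr θ₁ θ₂).toExpr) (hG : G.WellTyped)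
    (h : ∀ i < n, ∀ u u', ValRel G S θ₁ i u u' → Refines G S θ₂ i (e.inst u) (e'.inst u')) :
    ValRel G S (.arr θ₁ θ₂) n (.lam (θ₁.erase S).toExpr e) (.lam θ₁.toExpr e') := by
  refine ⟨hv, hv', _, _, rfl, rfl, fun i hi u u' hu => ⟨?_, ?_, h i hi u u' hu⟩⟩
  · simpa using Typing.beta hG hv.2 hu.source.2
  · simpa using Typing.beta hG hv'.2 hu.target.2

/-- Related abstractions applied to related values. -/
theorem ValRel.beta {θ₁ θ₂ : SpecTy} {τ τ' u u' w' : Expr} {i k : ℕ}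
    (hf : ValRel G S (.arr θ₁ θ₂) n (.lam τ e) (.lam τ' e')) (hu : ValRel G S θ₁ k u u')
    (hk : k < n) (hw' : IsVal w') (h : StepN G i (.app (.lam τ' e') u') w') (hi : i ≤ k) :
    ∃ w, IsVal w ∧ Steps G (e.inst u) w ∧ ValRel G S θ₂ (k + 1 - i) w w' := by
  obtain ⟨-, -, b, b', hb, hb', hr⟩ := hf
  cases hb
  cases hb'
  obtain ⟨l, rfl, h₁⟩ := h.beta hu.target.1 hw'
  obtain ⟨-, -, h₂⟩ := hr k hk u u' hu
  obtain ⟨w, hw, hs, hr⟩ := h₂ l (by omega) w' hw' h₁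
  exact ⟨w, hw, hs, hr.mono (by omega)⟩

/-- Related functions applied to related values. -/
theorem ValRel.app {θ₁ θ₂ : SpecTy} {f f' u u' w' : Expr} {i k : ℕ}
    (hf : ValRel G S (.arr θ₁ θ₂) n f f') (hu : ValRel G S θ₁ k u u') (hk : k < n)
    (hw' : IsVal w') (h : StepN G i (.app f' u') w') (hi : i ≤ k) :
    ∃ w, IsVal w ∧ Steps G (.app f u) w ∧ ValRel G S θ₂ (k + 1 - i) w w' := by
  obtain ⟨b, b', rfl, rfl⟩ := hf.arr_form
  obtain ⟨w, hw, hs, hr⟩ := hf.beta hu hk hw' h hi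
  exact ⟨w, hw, .head (.app hu.source.1) hs, hr⟩

end

end Taypsi

namespace Taypsi

section

variable {G : GCtx} {S : PsiCtx}

/-! ## Mergeable types -/

theorem StepN.mux_values {n : ℕ} {b : Bool} {v₁ v₂ w : Expr} (h₁ : IsVal v₁) (h₂ : IsVal v₂)
    (hw : IsVal w) (h : StepN G n (.mux (.boxLit b) v₁ v₂) w) : w = if b then v₁ else v₂ := by
  obtain ⟨b', u₁, u₂, -, -, s₀, s₁, s₂, rfl⟩ := h.mux hw
  cases (IsVal.boxLit b).steps s₀
  rw [h₁.steps s₁, h₂.steps s₂]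

theorem Mergeable.values (hG : G.WellTyped) (hS : S.IsValid G) {θ : SpecTy} {i : Expr}
    (hi : Mergeable G S θ i) {m j : ℕ} {b : Bool} {v₁ v₁' v₂ v₂' w : Expr}
    (r₁ : ValRel G S θ m v₁ v₁') (r₂ : ValRel G S θ m v₂ v₂') (hw : IsVal w)
    (hs : StepN G j (apps i [.boxLit b, v₁', v₂']) w) :
    ValOf G (if b then v₁ else v₂) (θ.erase S).toExpr ∧ ValOf G w θ.toExpr := by
  refine ⟨?_, hw, hs.steps.typing hG
    ((hi.typing hG hS).2.iteTy_app .boxLit r₁.target.2 r₂.target.2)⟩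
  cases b
  exacts [r₂.source, r₁.source]

/-- The witness of mergeability refines the conditional on values. -/
theorem Mergeable.refines (hG : G.WellTyped) (hS : S.IsValid G) {θ : SpecTy} {i : Expr}
    (hi : Mergeable G S θ i) {m : ℕ} {b : Bool} {v₁ v₁' v₂ v₂' : Expr}
    (r₁ : ValRel G S θ m v₁ v₁') (r₂ : ValRel G S θ m v₂ v₂') :
    Refines G S θ m (if b then v₁ else v₂) (apps i [.boxLit b, v₁', v₂']) := by
  have mux {θ : SpecTy} {m j : ℕ} {τ₀ τ₁ τ₂ v₁ v₁' v₂ v₂' w : Expr}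
      (r₁ : ValRel G S θ m v₁ v₁') (r₂ : ValRel G S θ m v₂ v₂') (hw : IsVal w)
      (hs : StepN G j (apps (.lam τ₀ (.lam τ₁ (.lam τ₂ (.mux (.var 2) (.var 1) (.var 0)))))
        [.boxLit b, v₁', v₂']) w) :
      ∃ v, IsVal v ∧ Steps G (if b then v₁ else v₂) v ∧ ValRel G S θ (m - j) v w := by
    obtain ⟨l, rfl, h⟩ := hs.beta_three (.boxLit b) r₁.target.1 r₂.target.1 hw
    cases StepN.mux_values r₁.target.1 r₂.target.1 hw h
    cases b
    · exact ⟨_, r₂.source.1, .refl, r₂.mono (by omega)⟩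
    · exact ⟨_, r₁.source.1, .refl, r₁.mono (by omega)⟩
  induction hi generalizing m v₁ v₁' v₂ v₂' with
  | unit | obool =>
    intro j _ w hw hs
    exact mux r₁ r₂ hw hs
  | @psi J hJ =>
    intro j hj w hw hs
    obtain ⟨source, target⟩ := Mergeable.values hG hS (.psi hJ) r₁ r₂ hw hs
    obtain ⟨τ, body, hO, hJ⟩ := hS.joins J hJ
    have hA := hS.oadt _ _ _ hO
    obtain ⟨l, rfl, h⟩ := hs.beta_three (.boxLit b) r₁.target.1 r₂.target.1 hw
    obtain ⟨_, _, k, -, hk, hjoin, h'⟩ := h.letIn hw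
    rw [Expr.subst_up_inst] at h'
    obtain ⟨_, u, rfl, -, hu, hk', hmux⟩ := h'.psiPair hw
    cases hk.steps hk'
    obtain ⟨hk, hu⟩ := target.psiPair_inv hG hO
    obtain ⟨_, hmux⟩ := hmux.stepN
    obtain ⟨b', u₁, u₂, hu₁, hu₂, hb, s₁, s₂, rfl⟩ := hmux.mux hu.1
    cases (IsVal.boxLit b).steps hb
    obtain ⟨c₁, t₁, k₁, x₁, rfl, ret₁⟩ := r₁
    obtain ⟨c₂, t₂, k₂, x₂, rfl, ret₂⟩ := r₂
    obtain ⟨hk₁, hx₁⟩ := t₁.psiPair_inv hG hO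
    obtain ⟨hk₂, hx₂⟩ := t₂.psiPair_inv hG hO
    obtain ⟨le₁, le₂⟩ := hJ.le_join k₁ k₂ k hk₁ hk₂ hk
      (hjoin.apps_join hk₁.1 hx₁.1 hk₂.1 hx₂.1 hk.1)
    have reshaped {v k₀ u : Expr} {x : OVal} (hv : ValOf G v (.adt (S.oadt J.oadt).pub))
        (hk₀ : ValOf G k₀ τ) (hx : ValOf G x.toExpr (.oapp J.oadt k₀)) (le : J.Le k₀ k)
        (ret : Steps G (apps (.gvar (S.oadt J.oadt).retr) [k₀, x.toExpr]) v) (hu : IsVal u)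
        (s : Steps G (apps (.gvar J.reshape) [.proj true (.psiPair k₀ x.toExpr), k,
          .proj false (.psiPair k₀ x.toExpr)]) u) :
        ∃ w : OVal, u = w.toExpr ∧
          Steps G (apps (.gvar (S.oadt J.oadt).retr) [k, w.toExpr]) v := by
      have s := s.apps_reshape hk.1 hk₀.1 hx.1 hu
      have hu' := s.typing hG (.reshape_app hG hO hJ hk₀.2 hk.2 hx.2)
      obtain ⟨w, rfl⟩ := hu.oval hG hu' (.refl _) (.oapp _ hO)
      refine ⟨w, rfl, hJ.retr_reshape v k₀ k x w hv hk₀ hk hx ⟨hu, hu'⟩ ret ?_ s⟩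
      exact hJ.view_mono v k₀ k hv hk₀ hk (hA.retr_view v k₀ x hv hk₀ hx ret) le
    refine ⟨_, source.1, .refl, source, target, ?_⟩
    cases b
    · obtain ⟨x, rfl, hr⟩ := reshaped c₂ hk₂ hx₂ le₂ (ret₂ (by omega)) hu₂ s₂
      exact ⟨k, x, rfl, fun _ => hr⟩
    · obtain ⟨x, rfl, hr⟩ := reshaped c₁ hk₁ hx₁ le₁ (ret₁ (by omega)) hu₁ s₁
      exact ⟨k, x, rfl, fun _ => hr⟩
  | @prod θ₁ θ₂ i₁ i₂ h₁ h₂ ih₁ ih₂ =>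
    intro j hj w hw hs
    obtain ⟨source, target⟩ := Mergeable.values hG hS (.prod h₁ h₂) r₁ r₂ hw hs
    have cl₁ := (h₁.typing hG hS).2.closedAt
    have cl₂ := (h₂.typing hG hS).2.closedAt
    obtain ⟨-, -, a₁, c₁, a₁', c₁', rfl, rfl, ra₁, rc₁⟩ := r₁
    obtain ⟨-, -, a₂, c₂, a₂', c₂', rfl, rfl, ra₂, rc₂⟩ := r₂
    have h₁' := ra₁.target
    have h₂' := ra₂.target
    have h₃' := rc₁.target
    have h₄' := rc₂.target
    obtain ⟨l, rfl, h⟩ := hs.beta_three (.boxLit b) (.pair h₁'.1 h₃'.1) (.pair h₂'.1 h₄'.1) hw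
    simp only [Expr.subst, apps_subst, List.map, cl₁.subst, cl₂.subst] at h
    obtain ⟨l₁, l₂, u₁, u₂, rfl, rfl, hu₁, hu₂, s₁, s₂⟩ := h.pair hw
    obtain ⟨j₁, hj₁, s₁⟩ := StepN.apps_proj (p := true) h₁'.1 h₃'.1 h₂'.1 h₄'.1 s₁ hu₁
    obtain ⟨j₂, hj₂, s₂⟩ := StepN.apps_proj (p := false) h₁'.1 h₃'.1 h₂'.1 h₄'.1 s₂ hu₂
    obtain ⟨x₁, -, t₁, r₁⟩ := ih₁ ra₁ ra₂ j₁ (by omega) _ hu₁ s₁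
    obtain ⟨x₂, -, t₂, r₂⟩ := ih₂ rc₁ rc₂ j₂ (by omega) _ hu₂ s₂
    have e₁ : x₁ = if b then a₁ else a₂ := by
      cases b
      exacts [ra₂.source.1.steps t₁, ra₁.source.1.steps t₁]
    have e₂ : x₂ = if b then c₁ else c₂ := by
      cases b
      exacts [rc₂.source.1.steps t₂, rc₁.source.1.steps t₂]
    refine ⟨_, source.1, .refl, source, target, x₁, x₂, u₁, u₂, ?_, rfl,
      r₁.mono (by omega), r₂.mono (by omega)⟩
    rw [e₁, e₂]
    cases b <;> rfl
  | @arr θ₁ θ₂ i₂ h₁ h₂ ih₂ =>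
    intro j hj w hw hs
    obtain ⟨source, target⟩ := Mergeable.values hG hS (.arr h₁ h₂) r₁ r₂ hw hs
    have cl₂ := (h₂.typing hG hS).2.closedAt
    obtain ⟨e₁, e₁', rfl, rfl⟩ := r₁.arr_form
    obtain ⟨e₂, e₂', rfl, rfl⟩ := r₂.arr_form
    obtain ⟨l, rfl, h⟩ := hs.beta_three (.boxLit b) (.lam _ _) (.lam _ _) hw
    rw [Expr.subst, SpecTy.toExpr_subst] at h
    obtain ⟨rfl, rfl⟩ := (IsVal.lam _ _).stepN h
    have hif : (if b then Expr.lam (θ₁.erase S).toExpr e₁ else .lam (θ₁.erase S).toExpr e₂) =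
        .lam (θ₁.erase S).toExpr (if b then e₁ else e₂) := by cases b <;> rfl
    rw [hif] at source ⊢
    refine ⟨_, source.1, .refl, .arr_intro source target hG fun i hi u u' hu => ?_⟩
    intro k hk w' hw' hs'
    rw [Expr.subst_up_inst] at hs'
    simp only [apps_subst, List.map, cl₂.subst, Expr.subst, scons] at hs'
    obtain ⟨j₀, j₁, j₂, l, b', p₁, p₂, rfl, hb, hp₁, hp₂, s₀, s₁, s₂, hs'⟩ := hs'.apps_three hw'
    cases ((IsVal.boxLit b).stepN s₀).2
    obtain ⟨x₁, -, t₁, q₁⟩ := r₁.beta hu (by omega) hp₁ s₁ (by omega)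
    obtain ⟨x₂, -, t₂, q₂⟩ := r₂.beta hu (by omega) hp₂ s₂ (by omega)
    obtain ⟨x, hx, t, q⟩ := ih₂ (q₁.mono (m := i - j₁ - j₂) (by omega))
      (q₂.mono (m := i - j₁ - j₂) (by omega)) l (by omega) w' hw' hs'
    refine ⟨x, hx, .trans ?_ t, q.mono (by omega)⟩
    cases b
    exacts [t₂, t₁]

end

end Taypsi

namespace Taypsi

section

variable {G : GCtx} {S : PsiCtx}

/-! ## Coercions -/

/-- Coercions relate a value to what its coercion evaluates to. -/
theorem Coercible.refines (hG : G.WellTyped) (hS : S.IsValid G) {θ θ' : SpecTy} {c : Expr}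
    (hc : Coercible G S θ θ' c) {m : ℕ} {v v' : Expr} (r : ValRel G S θ m v v') :
    Refines G S θ' m v (.app c v') := by
  have values {θ θ' : SpecTy} {c : Expr} {m j : ℕ} {v v' w : Expr}
      (hc : Coercible G S θ θ' c) (r : ValRel G S θ m v v') (hw : IsVal w)
      (hs : StepN G j (.app c v') w) :
      ValOf G v (θ'.erase S).toExpr ∧ ValOf G w θ'.toExpr := by
    obtain ⟨-, -, he, ht⟩ := hc.typing hG hS
    rw [he]
    exact ⟨r.source, hw, hs.steps.typing hG (ht.spec_app r.target.2)⟩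
  induction hc generalizing m v v' with
  | refl =>
    intro j hj w hw hs
    obtain ⟨l, rfl, h⟩ := hs.beta r.target.1 hw
    obtain ⟨rfl, rfl⟩ := r.target.1.stepN (v := v') h
    exact ⟨v, r.source.1, .refl, r.mono (by omega)⟩
  | bool =>
    intro j hj w hw hs
    obtain ⟨source, target⟩ := values .bool r hw hs
    obtain ⟨l, rfl, h⟩ := hs.beta r.target.1 hw
    obtain ⟨l', b, rfl, h', rfl⟩ := StepN.sec (e := v') h hw
    obtain ⟨rfl, hb⟩ := r.target.1.stepN h'
    obtain rfl : v = v' := r.2.2 (by omega)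
    exact ⟨v, r.source.1, .refl, source, target, b, b, hb.symm, rfl, fun _ => rfl⟩
  | @sect O τ body hO =>
    intro j hj w hw hs
    obtain ⟨source, target⟩ := values (.sect hO) r hw hs
    have hA := hS.oadt O τ body hO
    obtain ⟨l, rfl, h⟩ := hs.beta r.target.1 hw
    obtain ⟨k, u, rfl, -, hu, hk, hsect⟩ := StepN.psiPair
      (e₁ := .app (.gvar (S.oadt O).view) v')
      (e₂ := apps (.gvar (S.oadt O).sect) [.app (.gvar (S.oadt O).view) v', v']) h hw
    obtain rfl : v = v' := r.2.2 (by omega)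
    obtain ⟨k', x, hx, hk', hx'⟩ := target.psi hG hO
    cases hx
    obtain ⟨_, hsect⟩ := hsect.stepN
    obtain ⟨_, _, f, -, hf, s₁, s₂⟩ :=
      StepN.app_fun (f := .app (.gvar (S.oadt O).sect) (.app (.gvar (S.oadt O).view) v))
        hsect r.target.1 hu
    obtain ⟨_, _, k₂, -, hk₂, s₃, s₄⟩ := s₁.app_arg hf
    obtain rfl : k₂ = k := ValOf.public_unique hG
      ⟨hk₂, s₃.steps.typing hG (.view_app hG hO hA r.target.2)⟩ hk'
      ((hG _ _ hO).1.public (.inl rfl)) s₃.steps hk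
    refine ⟨v, r.source.1, .refl, source, target, k₂, x, rfl, fun _ => ?_⟩
    exact hA.retr_sect v k₂ x r.target hk' hx' (hA.view_view v k₂ r.target hk' hk)
      ((StepN.app_congr r.target.1 s₄).trans s₂).steps
  | @psi C hC =>
    intro j hj w hw hs
    obtain ⟨source, target⟩ := values (.psi hC) r hw hs
    have hC := hS.coers C hC
    obtain ⟨_, _, hO⟩ := hC.dst_def
    obtain ⟨k', x', rfl, -, -⟩ := target.psi hG hO
    obtain ⟨c₁, t₁, k, x, rfl, ret⟩ := r
    exact ⟨v, source.1, .refl, source, target, k', x', rfl, fun _ =>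
      hC.refines v k k' x x' c₁ t₁ target (ret (by omega)) hs.steps⟩
  | @prod θ₁ θ₂ θ₁' θ₂' c₁ c₂ h₁ h₂ ih₁ ih₂ =>
    intro j hj w hw hs
    obtain ⟨source, target⟩ := values (.prod h₁ h₂) r hw hs
    have cl₁ := (h₁.typing hG hS).2.2.2.closedAt
    have cl₂ := (h₂.typing hG hS).2.2.2.closedAt
    obtain ⟨l, rfl, h⟩ := hs.beta r.target.1 hw
    rw [Expr.inst_eq] at h
    simp only [Expr.subst, cl₁.subst, cl₂.subst, scons] at h
    obtain ⟨-, -, a, b, a', b', rfl, rfl, ra, rb⟩ := r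
    obtain ⟨l₁, l₂, u₁, u₂, rfl, rfl, hu₁, hu₂, s₁, s₂⟩ := h.pair hw
    obtain ⟨_, j₁, x₁, rfl, hx₁, p₁, t₁⟩ := s₁.app_arg hu₁
    obtain ⟨_, j₂, x₂, rfl, hx₂, p₂, t₂⟩ := s₂.app_arg hu₂
    rw [p₁.proj_pair ra.target.1 rb.target.1 hx₁] at t₁
    rw [p₂.proj_pair ra.target.1 rb.target.1 hx₂] at t₂
    obtain ⟨y₁, -, q₁, r₁⟩ := ih₁ ra j₁ (by omega) _ hu₁ t₁
    obtain ⟨y₂, -, q₂, r₂⟩ := ih₂ rb j₂ (by omega) _ hu₂ t₂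
    cases ra.source.1.steps q₁
    cases rb.source.1.steps q₂
    exact ⟨_, source.1, .refl, source, target, _, _, _, _, rfl, rfl, r₁.mono (by omega),
      r₂.mono (by omega)⟩
  | @arr θ₁ θ₂ θ₁' θ₂' c₁ c₂ h₁ h₂ ih₁ ih₂ =>
    intro j hj w hw hs
    obtain ⟨source, target⟩ := values (.arr h₁ h₂) r hw hs
    obtain ⟨-, -, he₁, ht₁⟩ := h₁.typing hG hS
    have cl₁ := ht₁.closedAt
    have cl₂ := (h₂.typing hG hS).2.2.2.closedAt
    obtain ⟨l, rfl, h⟩ := hs.beta r.target.1 hw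
    obtain ⟨b, b', rfl, rfl⟩ := r.arr_form
    rw [Expr.inst_eq, Expr.subst, SpecTy.toExpr_subst] at h
    obtain ⟨rfl, rfl⟩ := (IsVal.lam _ _).stepN h
    rw [he₁] at source ⊢
    refine ⟨_, source.1, .refl, .arr_intro source target hG fun i hi u u' hu => ?_⟩
    intro k hk w' hw' hs'
    rw [Expr.subst_up_inst] at hs'
    simp only [Expr.subst, cl₁.subst, cl₂.subst, scons] at hs'
    obtain ⟨_, j₂, p₂, rfl, hp₂, s, s₂⟩ := hs'.app_arg hw'
    obtain ⟨_, j₁, p₁, rfl, hp₁, s₀, s₁⟩ := s.app_arg hp₂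
    obtain ⟨x₀, hx₀, q₀, r₀⟩ := ih₁ hu _ (by omega) _ hp₁ s₀
    cases hu.source.1.steps q₀
    obtain ⟨x₁, hx₁, q₁, r₁⟩ := r.beta r₀ (by omega) hp₂ s₁ (by omega)
    obtain ⟨x₂, hx₂, q₂, r₂⟩ := ih₂ r₁ j₂ (by omega) _ hw' s₂
    cases hx₁.steps q₂
    exact ⟨x₁, hx₁, q₁, r₂.mono (by omega)⟩

/-! ## The fundamental property -/

/-- Closing substitutions that are related at the types of a local context. -/
def EnvRel (G : GCtx) (S : PsiCtx) (n : ℕ) (Γ : List SpecTy) (σ σ' : ℕ → Expr) : Prop :=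
  ∀ (x : ℕ) (θ : SpecTy), Γ[x]? = some θ → ValRel G S θ n (σ x) (σ' x)

namespace EnvRel

variable {n m : ℕ} {Γ : List SpecTy} {σ σ' : ℕ → Expr}

theorem mono (h : EnvRel G S n Γ σ σ') (hm : m ≤ n) : EnvRel G S m Γ σ σ' :=
  fun x θ hx => (h x θ hx).mono hm

theorem cons (h : EnvRel G S n Γ σ σ') {θ : SpecTy} {u u' : Expr} (hu : ValRel G S θ n u u') :
    EnvRel G S n (θ :: Γ) (scons u σ) (scons u' σ') := by
  intro x θ' hx
  cases x with
  | zero => cases hx; exact hu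
  | succ x => exact h x θ' hx

theorem wellKinded (hG : G.WellTyped) (h : EnvRel G S n Γ σ σ') :
    ∀ θ ∈ Γ, θ.WellKinded G := by
  intro θ hθ
  obtain ⟨x, hx⟩ := List.mem_iff_getElem?.1 hθ
  exact .of_typing hG (h x θ hx).target.2

end EnvRel

theorem substTyping_map {f : SpecTy → SpecTy} {Γ : List SpecTy} {σ : ℕ → Expr}
    (h : ∀ (x : ℕ) (θ : SpecTy), Γ[x]? = some θ → Typing G .secure [] (σ x) (f θ).toExpr) :
    SubstTyping G .secure (Γ.map fun θ => (f θ).toExpr) σ [] := by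
  refine fun x => .inr fun τ hτ => ?_
  rw [List.getElem?_map, Option.map_eq_some_iff] at hτ
  obtain ⟨θ, hθ, rfl⟩ := hτ
  rw [SpecTy.toExpr_rename, SpecTy.toExpr_subst]
  exact h x θ hθ

theorem Lift.closed_typing (hG : G.WellTyped) (hS : S.IsValid G) {L : LiftCtx} {n m : ℕ}
    (hL : L.NValid G S n) {Γ : List SpecTy} {e e' : Expr} {θ : SpecTy}
    (h : Lift G S L Γ e θ e') {σ σ' : ℕ → Expr} (env : EnvRel G S m Γ σ σ') :
    Typing G .secure [] (e.subst σ) (θ.erase S).toExpr ∧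
      Typing G .secure [] (e'.subst σ') θ.toExpr := by
  obtain ⟨h₁, h₂⟩ := h.typing hG hS hL (env.wellKinded hG)
  have h₁ := h₁.subst hG (substTyping_map (f := SpecTy.erase S)
    fun x θ hx => (env x θ hx).source.2)
  have h₂ := h₂.subst hG (substTyping_map (f := id) fun x θ hx => (env x θ hx).target.2)
  rw [SpecTy.toExpr_subst] at h₁ h₂
  exact ⟨h₁, h₂⟩

/-- Lifted expressions refine their sources under related closing substitutions. -/
theorem Lift.refines (hG : G.WellTyped) (hS : S.IsValid G) {L : LiftCtx} {n : ℕ}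
    (hL : L.NValid G S n) {Γ : List SpecTy} {e e' : Expr} {θ : SpecTy}
    (h : Lift G S L Γ e θ e') {m : ℕ} (hm : m ≤ n) {σ σ' : ℕ → Expr}
    (env : EnvRel G S m Γ σ σ') : Refines G S θ m (e.subst σ) (e'.subst σ') := by
  have abs {Γ : List SpecTy} {θ₁ θ₂ : SpecTy} {e e' : Expr} {m : ℕ} {σ σ' : ℕ → Expr}
      (h₁ : θ₁.WellKinded G) (h : Lift G S L (θ₁ :: Γ) e θ₂ e')
      (ih : ∀ {m : ℕ}, m ≤ n → ∀ {σ σ' : ℕ → Expr}, EnvRel G S m (θ₁ :: Γ) σ σ' →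
        Refines G S θ₂ m (e.subst σ) (e'.subst σ'))
      (hm : m ≤ n) (env : EnvRel G S m Γ σ σ') :
      ValRel G S (.arr θ₁ θ₂) m (.lam (θ₁.erase S).toExpr (e.subst (upSub σ)))
        (.lam θ₁.toExpr (e'.subst (upSub σ'))) := by
    obtain ⟨t, t'⟩ := (Lift.abs h₁ h).closed_typing hG hS hL env
    rw [Expr.subst, SpecTy.toExpr_subst] at t t'
    refine .arr_intro ⟨.lam _ _, t⟩ ⟨.lam _ _, t'⟩ hG fun i hi u u' hu => ?_
    rw [Expr.subst_up_inst, Expr.subst_up_inst]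
    exact ih (by omega) ((env.mono (by omega)).cons hu)
  induction h generalizing m σ σ' with
  | unit =>
    exact ValRel.refines ⟨⟨.unit, .unit⟩, ⟨.unit, .unit⟩, fun _ => rfl⟩
  | lit =>
    exact ValRel.refines ⟨⟨.lit _, .lit⟩, ⟨.lit _, .lit⟩, fun _ => rfl⟩
  | var hx => exact (env _ _ hx).refines
  | fn hx => exact ((hL _ _ _ hx).mono hm).2.2
  | abs h₁ h ih =>
    rw [Expr.subst, Expr.subst, SpecTy.toExpr_subst, SpecTy.toExpr_subst]
    exact (abs h₁ h ih hm env).refines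
  | app _ _ ih₂ ih₁ =>
    intro i hi v' hv' hs
    obtain ⟨j, _, u', rfl, hu', s₁, h⟩ := hs.app_arg hv'
    obtain ⟨k, l, f', rfl, hf', s₂, h'⟩ := h.app_fun hu' hv'
    obtain ⟨u, hu, t₁, r₁⟩ := ih₁ hm env j (by omega) u' hu' s₁
    obtain ⟨f, hf, t₂, r₂⟩ := ih₂ hm env k (by omega) f' hf' s₂
    have hl : 0 < l := by
      rcases Nat.eq_zero_or_pos l with rfl | hl
      · cases h'
        cases hv'
      · exact hl
    obtain ⟨v, hv, t, r⟩ := r₂.app (k := m - (j + k + 1)) (r₁.mono (by omega)) (by omega) hv' h'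
      (by omega)
    exact ⟨v, hv, (t₂.app t₁ hu).trans t, r.mono (by omega)⟩
  | letIn _ _ ih₁ ih₂ =>
    intro i hi v' hv' hs
    obtain ⟨j, l, u', rfl, hu', s₁, s₂⟩ := hs.letIn hv'
    rw [Expr.subst_up_inst] at s₂
    obtain ⟨u, hu, t₁, r₁⟩ := ih₁ hm env j (by omega) u' hu' s₁
    obtain ⟨v, hv, t₂, r₂⟩ := ih₂ (m := m - j) (by omega) ((env.mono (by omega)).cons r₁) l
      (by omega) v' hv' s₂
    refine ⟨v, hv, ((t₁.letIn hu).trans ?_), r₂.mono (by omega)⟩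
    rwa [Expr.subst_up_inst]
  | pair _ _ ih₁ ih₂ =>
    intro i hi v' hv' hs
    obtain ⟨j, l, u₁', u₂', rfl, rfl, hu₁', hu₂', s₁, s₂⟩ := hs.pair hv'
    obtain ⟨u₁, hu₁, t₁, r₁⟩ := ih₁ hm env j (by omega) _ hu₁' s₁
    obtain ⟨u₂, hu₂, t₂, r₂⟩ := ih₂ hm env l (by omega) _ hu₂' s₂
    exact ⟨_, .pair hu₁ hu₂, t₁.pair t₂ hu₁,
      ⟨.pair hu₁ hu₂, .pair r₁.source.2 r₂.source.2⟩, ⟨hv', .pair r₁.target.2 r₂.target.2⟩,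
      _, _, _, _, rfl, rfl, r₁.mono (by omega), r₂.mono (by omega)⟩
  | @proj _ b _ _ _ _ _ ih =>
    intro i hi v' hv' hs
    obtain ⟨j, u', rfl, hu', s, u₁', u₂', hu, rfl⟩ := hs.proj hv'
    obtain ⟨u, -, t, -, -, v₁, v₂, v₁', v₂', rfl, rfl, r₁, r₂⟩ := ih hm env j (by omega) u' hu' s
    rcases hu with hu | hu <;> cases hu
    refine ⟨_, ?_, t.proj r₁.source.1 r₂.source.1, ?_⟩ <;> cases b
    exacts [r₂.source.1, r₁.source.1, r₂.mono (by omega), r₁.mono (by omega)]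
  | ite₁ _ _ _ ih₀ ih₁ ih₂ =>
    intro i hi v' hv' hs
    obtain ⟨j, l, b, rfl, s₀, s⟩ := hs.ite hv'
    obtain ⟨u, -, t₀, r₀⟩ := ih₀ hm env j (by omega) _ (.lit b) s₀
    obtain rfl := r₀.2.2 (by omega)
    cases b
    · obtain ⟨v, hv, t, r⟩ := ih₂ hm env l (by omega) v' hv' s
      exact ⟨v, hv, t₀.ite.trans t, r.mono (by omega)⟩
    · obtain ⟨v, hv, t, r⟩ := ih₁ hm env l (by omega) v' hv' s
      exact ⟨v, hv, t₀.ite.trans t, r.mono (by omega)⟩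
  | ite₂ _ hi₀ _ _ ih₀ ih₁ ih₂ =>
    intro i hi v' hv' hs
    simp only [apps_subst, List.map, (hi₀.typing hG hS).2.closedAt.subst] at hs
    obtain ⟨j₀, j₁, j₂, l, u₀, u₁, u₂, rfl, hu₀, hu₁, hu₂, s₀, s₁, s₂, s⟩ := hs.apps_three hv'
    obtain ⟨_, -, t₀, -, -, b, b', rfl, rfl, hb⟩ := ih₀ hm env j₀ (by omega) _ hu₀ s₀
    obtain rfl := hb (by omega)
    obtain ⟨w₁, -, t₁, r₁⟩ := ih₁ hm env j₁ (by omega) _ hu₁ s₁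
    obtain ⟨w₂, -, t₂, r₂⟩ := ih₂ hm env j₂ (by omega) _ hu₂ s₂
    obtain ⟨v, hv, t, r⟩ := hi₀.refines hG hS (r₁.mono (m := m - j₀ - j₁ - j₂) (by omega))
      (r₂.mono (m := m - j₀ - j₁ - j₂) (by omega)) l (by omega) v' hv' s
    refine ⟨v, hv, t₀.ite.trans (.trans ?_ t), r.mono (by omega)⟩
    cases b
    exacts [t₂, t₁]
  | ctor₁ i₀ hT _ ih =>
    intro i hi v' hv' hs
    obtain ⟨u', rfl, hu', s⟩ := hs.ctor hv'
    obtain ⟨u, hu, t, r⟩ := ih hm env i hi u' hu' s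
    obtain rfl := r.public_eq ((hG _ _ hT i₀).public (.inl rfl)) (by omega)
    have hv : ValOf G (.ctor _ i₀ u) (.adt _) := ⟨.ctor hu, .ctor i₀ hT r.target.2⟩
    exact ⟨_, hv.1, t.ctor, hv, hv, fun _ => rfl⟩
  | ctor₂ i₀ hI _ ih =>
    intro i hi v' hv' hs
    obtain ⟨j, l, u', rfl, hu', s, s'⟩ := hs.app_arg hv'
    obtain ⟨u, hu, t, r⟩ := ih hm env j (by omega) u' hu' s
    obtain ⟨-, -, h⟩ := (hS.intros _ hI).refines i₀ _ _ _ r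
    obtain ⟨v, hv, t', r'⟩ := h l (by omega) v' hv' s'
    exact ⟨v, hv, t.ctor.trans t', r'.mono (by omega)⟩
  | mtch₁ hθ hT _ _ ih₀ ih =>
    intro i hi v' hv' hs
    obtain ⟨j, l, c, u, rfl, hu, s₀, s⟩ := hs.mtch hv'
    rw [Expr.subst_up_inst] at s
    obtain ⟨u₀, -, t₀, r₀⟩ := ih₀ hm env j (by omega) _ (.ctor hu) s₀
    obtain rfl := r₀.2.2 (by omega)
    obtain ⟨c', hc, hu'⟩ := r₀.target.2.ctor_inv hT
    cases Fin.ext hc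
    have hu₀ := ValOf.public_rel (S := S) (n := m - j) hG ((hG _ _ hT c).public (.inl rfl))
      ⟨hu, hu'⟩
    obtain ⟨v, hv, t, r⟩ := ih c (m := m - j) (by omega) ((env.mono (by omega)).cons hu₀) l
      (by omega) v' hv' s
    refine ⟨v, hv, (t₀.mtch hu).trans ?_, r.mono (by omega)⟩
    rwa [Expr.subst_up_inst]
  | @mtch₂ Γ E e₀ e₀' br br' hE _ hbr ih₀ ih =>
    intro i hi v' hv' hs
    have hE := hS.elims E hE
    obtain ⟨_, _, hO⟩ := hE.oadt_def
    obtain ⟨-, hw⟩ := (SpecTy.WellKinded.of_typing hG hE.fn_ty).arr_inv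
    obtain ⟨-, hw⟩ := hw.arrows_inv
    have hw := fun i => (hw _ (by simp : SpecTy.arr (E.θ i) E.α ∈ _)).arr_inv.1
    simp only [apps_subst, Expr.subst, List.map_ofFn, Function.comp_def,
      SpecTy.toExpr_subst] at hs
    obtain ⟨j, l, u', rfl, hu', s, s'⟩ := hs.apps_arg (by
      intro u hu
      obtain ⟨i, rfl⟩ := (List.mem_ofFn' _ _).1 hu
      exact .lam _ _) hv'
    obtain ⟨u, hu, t₀, hsrc, htgt, k, x, rfl, ret⟩ := ih₀ hm env j (by omega) u' hu' s
    obtain ⟨c, w, rfl, hw'⟩ := hsrc.ctor hG hE.compat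
    obtain ⟨-, -, h⟩ := hE.refines c (m - j) w k x (fun i => (br i).subst (upSub σ))
      (fun i => (br' i).subst (upSub σ')) hw' htgt (ret (by omega))
      fun i => abs (hw i) (hbr i) (ih i) (by omega) (env.mono (by omega))
    obtain ⟨v, hv, t, r⟩ := h l (by omega) v' hv' s'
    exact ⟨v, hv, (t₀.mtch hw'.1).trans t, r.mono (by omega)⟩
  | coerce _ hc ih =>
    intro i hi v' hv' hs
    rw [Expr.subst, (hc.typing hG hS).2.2.2.closedAt.subst] at hs
    obtain ⟨j, l, u', rfl, hu', s, s'⟩ := hs.app_arg hv'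
    obtain ⟨u, hu, t, r⟩ := ih hm env j (by omega) u' hu' s
    obtain ⟨v, hv, t', r'⟩ := hc.refines hG hS r l (by omega) v' hv' s'
    exact ⟨v, hv, t.trans t', r'.mono (by omega)⟩

end

end Taypsi

theorem theorem3 (G : Taypsi.GCtx) (hG : G.WellTyped)
    (S : Taypsi.PsiCtx) (hS : S.IsValid G)
    (L : Taypsi.LiftCtx) (n : ℕ) (hL : Taypsi.LiftCtx.NValid G S L n)
    (e e' : Taypsi.Expr) (θ : Taypsi.SpecTy) (h : Taypsi.Lift G S L [] e θ e') :
    Taypsi.ERel G S θ n e e' := by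
  have env : Taypsi.EnvRel G S n [] .var .var := fun x θ hx => by simp at hx
  have hT := h.closed_typing hG hS hL env
  have hR := h.refines hG hS hL le_rfl env
  rw [Taypsi.Expr.subst_id, Taypsi.Expr.subst_id] at hT hR
  exact ⟨hT.1, hT.2, hR⟩
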